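/- **Theorem 1.2.** Let $k$ be a field of characteristic $0$. For a finite group $\Gamma$ let $\operatorname{VRep}(\Gamma)$ be the group of virtual finite-dimensional representations of $\Gamma$ over $k$. For every action of a finite group $\Gamma$ on a loopless matroid $\mathsf M$ on a finite ground set (an action on the ground set that sends flats to flats), let $P_{\mathsf M}^{\Gamma}(t),\ Z_{\mathsf M}^{\Gamma}(t)\in\operatorname{VRep}(\Gamma)[t]$ be the equivariant Kazhdan–Lusztig polynomial and the equivariant $Z$-polynomial, that is, the unique assignment such that 1. $P_{\mathsf M}^{\Gamma}(t)$ is the trivial representation (in degree $0$) if $\operatorname{rk}\mathsf M=0$; 2. $\deg P_{\mathsf M}^{\Gamma}(t)<\tfrac12\operatorname{rk}\mathsf M$ if $\operatorname{rk}\mathsf M>0$; 3. $Z_{\mathsf M}^{\Gamma}(t)=\sum_{[F]\in\mathcal L(\mathsf M)/\Gamma}t^{\operatorname{rk}F}\operatorname{Ind}_{\Gamma_F}^{\Gamma}P_{\mathsf M/F}^{\Gamma_F}(t)$ is palindromic and has degree exactly $\operatorname{rk}\mathsf M$, where the sum is over the $\Gamma$-orbits of flats of $\mathsf M$ and $\Gamma_F$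 is the stabilizer of the flat $F$. A matroid is *series-parallel* if it is obtained from a single loop or a single coloop by a finite sequence of series and parallel extensions. It is *quasi series-parallel* if all its connected components are series-parallel, and *simple* if it has no loops and no circuits of size $2$. Let $\mathcal A(m,r)$ be the set of all quasi series-parallel matroids of rank $r$ with ground set $[m]=\{1,\dots,m\}$, and let $\mathcal S(m,r)\subseteq\mathcal A(m,r)$ be the subset of the simple ones. The symmetric group $\mathfrak S_m$ acts on both sets by relabelling; for $r<0$ they are empty, and then the permutation representation is $0$. Let $n\ge 1$, and let $\mathsf K_n$ be the cycle matroid of the complete graph on $[n]$, on which $\mathfrak S_n$ acts by permuting the vertices. Let $v\in[n]$, and let $\mathfrak S_{n-1}\subseteq\mathfrak S_n$ be the stabilizer of $v$, identified with the group of permutations of $[n-1]$ by any bijection $[n]\setminus\{v\}\cong[n-1]$. Then for every $i\ge 0$: (i) the coefficient of $t^i$ in $P_{\mathsf K_n}^{\mathfrak S_{n-1}}(t)$ is the class of the permutation representation of $\mathfrak S_{n-1}$ on $\mathcal S(n-1,\,n-1-i)$; (ii) the coefficient of $t^i$ in $Z_{\mathsf K_n}^{\mathfrak S_{n-1}}(t)$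 is the class of the permutation representation of $\mathfrak S_{n-1}$ on $\mathcal A(n-1,\,n-1-i)$. -/

import Mathlib

open scoped Matroid Pointwise

set_option linter.unusedSectionVars false

universe u

/-! ### Virtual representations -/

/-- A finite-dimensional `k`-linear representation of a group `G`, on a `k`-vector space `V`. -/
structure FinRep (k : Type u) (G : Type) [Field k] [Group G] where
  V : Type u
  [addCommGroup : AddCommGroup V]
  [module : Module k V]
  [finite : Module.Finite k V]
  ρ : Representation k G V

attribute [instance] FinRep.addCommGroup FinRep.module FinRep.finite

/-- The relations `[W] = [U] + [V]` for `W ≅ U ⊕ V`. -/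
def VRep.relations (k : Type u) (G : Type) [Field k] [Group G] :
    AddSubgroup (FreeAbelianGroup (FinRep k G)) :=
  AddSubgroup.closure {x | ∃ U V W : FinRep k G, Nonempty (W.ρ.Equiv (U.ρ.prod V.ρ)) ∧
    x = FreeAbelianGroup.of W - (FreeAbelianGroup.of U + FreeAbelianGroup.of V)}

/-- The group of virtual representations of `G` over `k` (for `G` finite and `k` of characteristic
zero): the free abelian group on the finite-dimensional representations, modulo the relations
`[W] = [U] + [V]` whenever `W ≅ U ⊕ V`. (In particular isomorphic representations have the same
class, and the zero representation has class `0`.) -/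
abbrev VRep (k : Type u) (G : Type) [Field k] [Group G] : Type (u + 1) :=
  FreeAbelianGroup (FinRep k G) ⧸ VRep.relations k G

namespace VRep

section
variable {k : Type u} {G H : Type} [Field k] [Group G] [Group H]

/-- The class of a finite-dimensional representation. -/
def of {V : Type u} [AddCommGroup V] [Module k V] [Module.Finite k V]
    (ρ : Representation k G V) : VRep k G :=
  QuotientAddGroup.mk (FreeAbelianGroup.of ⟨V, ρ⟩)

/-- Additive invariants of representations extend to virtual representations. -/
def lift {A : Type*} [AddCommGroup A] (f : FinRep k G → A)
    (hf : ∀ U V W : FinRep k G, Nonempty (W.ρ.Equiv (U.ρ.prod V.ρ)) → f W = f U + f V) :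
    VRep k G →+ A :=
  QuotientAddGroup.lift _ (FreeAbelianGroup.lift f) (by
    rw [relations, AddSubgroup.closure_le]
    rintro _ ⟨U, V, W, h, rfl⟩
    simp [hf U V W h])

theorem of_eq_add {W U V : FinRep k G} (h : Nonempty (W.ρ.Equiv (U.ρ.prod V.ρ))) :
    of W.ρ = of U.ρ + of V.ρ := by
  refine (QuotientAddGroup.eq_iff_sub_mem).2 (AddSubgroup.subset_closure ⟨U, V, W, h, rfl⟩)

theorem lift_of {A : Type*} [AddCommGroup A] (f : FinRep k G → A) (hf) {V : Type u}
    [AddCommGroup V] [Module k V] [Module.Finite k V] (ρ : Representation k G V) :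
    lift f hf (of ρ) = f ⟨V, ρ⟩ := by
  simp [lift, of]

/-- The trivial one-dimensional representation. -/
def triv (k : Type u) (G : Type) [Field k] [Group G] : VRep k G :=
  of (Representation.trivial k G k)

end

section ind
variable {k : Type u} {G H : Type} [Field k] [Group G] [Group H] (φ : G →* H)
open Representation

/-- Functoriality of induction. -/
noncomputable def indMap {V W : Type u} [AddCommGroup V] [Module k V] [AddCommGroup W]
    [Module k W] {ρ : Representation k G V} {σ : Representation k G W}
    (f : IntertwiningMap ρ σ) : IndV φ ρ →ₗ[k] IndV φ σ :=
  Coinvariants.map _ _ (IntertwiningMap.lTensor ((leftRegular k H).comp φ) f)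

theorem indMap_mk {V W : Type u} [AddCommGroup V] [Module k V] [AddCommGroup W]
    [Module k W] {ρ : Representation k G V} {σ : Representation k G W}
    (f : IntertwiningMap ρ σ) (h : H) (v : V) :
    indMap φ f (IndV.mk φ ρ h v) = IndV.mk φ σ h (f v) := by
  simp [indMap]

theorem indMap_comp {V W X : Type u} [AddCommGroup V] [Module k V] [AddCommGroup W]
    [Module k W] [AddCommGroup X] [Module k X] {ρ : Representation k G V}
    {σ : Representation k G W} {τ : Representation k G X}
    (f : IntertwiningMap σ τ) (g : IntertwiningMap ρ σ) :
    indMap φ f ∘ₗ indMap φ g = indMap φ (f.comp g) :=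
  IndV.hom_ext _ _ fun h => LinearMap.ext fun w => by
    change indMap φ f (indMap φ g (IndV.mk φ ρ h w)) = indMap φ (f.comp g) (IndV.mk φ ρ h w)
    rw [indMap_mk, indMap_mk, indMap_mk, IntertwiningMap.comp_apply]

theorem indMap_zero {V W : Type u} [AddCommGroup V] [Module k V] [AddCommGroup W]
    [Module k W] {ρ : Representation k G V} {σ : Representation k G W} :
    indMap φ (0 : IntertwiningMap ρ σ) = 0 :=
  IndV.hom_ext _ _ fun h => LinearMap.ext fun w => by
    change indMap φ (0 : IntertwiningMap ρ σ) (IndV.mk φ ρ h w) = 0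
    rw [indMap_mk, IntertwiningMap.coe_zero, Pi.zero_apply, map_zero]

theorem indMap_id {V : Type u} [AddCommGroup V] [Module k V] {ρ : Representation k G V} :
    indMap φ (IntertwiningMap.id ρ) = LinearMap.id :=
  IndV.hom_ext _ _ fun h => LinearMap.ext fun w => by
    change indMap φ (IntertwiningMap.id ρ) (IndV.mk φ ρ h w) = IndV.mk φ ρ h w
    rw [indMap_mk, IntertwiningMap.id_apply]

theorem indMap_add {V W : Type u} [AddCommGroup V] [Module k V] [AddCommGroup W]
    [Module k W] {ρ : Representation k G V} {σ : Representation k G W}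
    (f g : IntertwiningMap ρ σ) : indMap φ f + indMap φ g = indMap φ (f + g) :=
  IndV.hom_ext _ _ fun h => LinearMap.ext fun w => by
    change indMap φ f (IndV.mk φ ρ h w) + indMap φ g (IndV.mk φ ρ h w) =
      indMap φ (f + g) (IndV.mk φ ρ h w)
    rw [indMap_mk, indMap_mk, indMap_mk, IntertwiningMap.coe_add, Pi.add_apply, map_add]

theorem indMap_ind {V W : Type u} [AddCommGroup V] [Module k V] [AddCommGroup W]
    [Module k W] {ρ : Representation k G V} {σ : Representation k G W}
    (f : IntertwiningMap ρ σ) (g : H) :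
    indMap φ f ∘ₗ ind φ ρ g = ind φ σ g ∘ₗ indMap φ f :=
  IndV.hom_ext _ _ fun h => LinearMap.ext fun w => by
    change indMap φ f (ind φ ρ g (IndV.mk φ ρ h w)) = ind φ σ g (indMap φ f (IndV.mk φ ρ h w))
    rw [ind_mk, indMap_mk, indMap_mk, ind_mk]

/-- Induction commutes with direct sums. -/
noncomputable def indEquiv {U V W : FinRep k G} (e : W.ρ.Equiv (U.ρ.prod V.ρ)) :
    (ind φ W.ρ).Equiv ((ind φ U.ρ).prod (ind φ V.ρ)) :=
  Representation.Equiv.mk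
    (LinearEquiv.ofLinearMap
      ((indMap φ ((IntertwiningMap.fst k U.ρ V.ρ).comp e.toIntertwiningMap)).prod
        (indMap φ ((IntertwiningMap.snd k U.ρ V.ρ).comp e.toIntertwiningMap)))
      ((indMap φ (e.symm.toIntertwiningMap.comp (IntertwiningMap.inl k U.ρ V.ρ))).coprod
        (indMap φ (e.symm.toIntertwiningMap.comp (IntertwiningMap.inr k U.ρ V.ρ))))
      (by
        have h1 : ∀ {X Y : FinRep k G} (f : IntertwiningMap (U.ρ.prod V.ρ) X.ρ)
            (g : IntertwiningMap Y.ρ (U.ρ.prod V.ρ)),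
            (f.comp e.toIntertwiningMap).comp (e.symm.toIntertwiningMap.comp g) = f.comp g := by
          intro X Y f g
          ext x
          simp
        apply LinearMap.prod_ext
        · rw [LinearMap.comp_assoc, LinearMap.coprod_inl, LinearMap.prod_comp, indMap_comp,
            indMap_comp, h1 (X := U) (Y := U), h1 (X := V) (Y := U),
            IntertwiningMap.fst_comp_inl, IntertwiningMap.snd_comp_inl, indMap_id, indMap_zero]
          rfl
        · rw [LinearMap.comp_assoc, LinearMap.coprod_inr, LinearMap.prod_comp, indMap_comp,
            indMap_comp, h1 (X := U) (Y := V), h1 (X := V) (Y := V),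
            IntertwiningMap.fst_comp_inr, IntertwiningMap.snd_comp_inr, indMap_id, indMap_zero]
          rfl)
      (by
        rw [LinearMap.coprod_comp_prod, indMap_comp, indMap_comp, indMap_add, ← indMap_id]
        congr 1
        ext x
        have h2 : (((e x).1, 0) : U.V × V.V) + (0, (e x).2) = e x := by ext <;> simp
        have := congrArg e.symm h2
        rw [map_add, Representation.Equiv.symm_apply_apply] at this
        exact this))
    (fun g => by
      have h1 := indMap_ind φ ((IntertwiningMap.fst k U.ρ V.ρ).comp e.toIntertwiningMap) g
      have h2 := indMap_ind φ ((IntertwiningMap.snd k U.ρ V.ρ).comp e.toIntertwiningMap) g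
      refine LinearMap.ext fun x => Prod.ext ?_ ?_
      · exact LinearMap.congr_fun h1 x
      · exact LinearMap.congr_fun h2 x)

theorem finite_ind [Finite H] {V : Type u} [AddCommGroup V] [Module k V] [Module.Finite k V]
    (ρ : Representation k G V) : Module.Finite k (IndV φ ρ) := by
  have : Module.Finite k (MonoidAlgebra k H) := by infer_instance
  infer_instance

/-- Induction of virtual representations along `φ : G →* H`; for the inclusion of a subgroup this
is the usual induction. -/
noncomputable def ind [Finite H] : VRep k G →+ VRep k H :=
  lift (fun V => haveI := finite_ind φ V.ρ; of (Representation.ind φ V.ρ))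
    (fun U V W ⟨e⟩ => by
      have := finite_ind φ U.ρ
      have := finite_ind φ V.ρ
      have := finite_ind φ W.ρ
      exact of_eq_add (W := ⟨_, Representation.ind φ W.ρ⟩) (U := ⟨_, Representation.ind φ U.ρ⟩)
        (V := ⟨_, Representation.ind φ V.ρ⟩) ⟨indEquiv φ e⟩)

theorem of_equiv {V W : Type u} [AddCommGroup V] [Module k V] [Module.Finite k V]
    [AddCommGroup W] [Module k W] [Module.Finite k W] {ρ : Representation k G V}
    {σ : Representation k G W} (e : ρ.Equiv σ) : of ρ = of σ := by
  let Z : FinRep k G := ⟨PUnit.{u + 1}, Representation.trivial k G PUnit.{u + 1}⟩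
  have key : ∀ (W' : FinRep k G) (e : W'.ρ.Equiv σ), of W'.ρ = of σ + of Z.ρ := by
    intro W' e
    refine of_eq_add (U := ⟨W, σ⟩) (V := Z) ⟨e.trans (Representation.Equiv.mk
      (LinearEquiv.ofLinearMap (LinearMap.inl k W PUnit.{u + 1}) (LinearMap.fst k W PUnit.{u + 1})
        (by ext <;> simp) (by ext; simp)) (fun g => ?_))⟩
    ext x
    rfl
  rw [key ⟨V, ρ⟩ e, ← key ⟨W, σ⟩ (Representation.Equiv.refl σ)]

theorem hom_ext {A : Type*} [AddCommGroup A] {f g : VRep k G →+ A}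
    (h : ∀ V : FinRep k G, f (of V.ρ) = g (of V.ρ)) : f = g := by
  apply QuotientAddGroup.addMonoidHom_ext
  apply FreeAbelianGroup.lift_ext
  exact h

theorem ind_of [Finite H] {V : Type u} [AddCommGroup V] [Module k V] [Module.Finite k V]
    (ρ : Representation k G V) :
    haveI := finite_ind φ ρ
    ind φ (of ρ) = of (Representation.ind φ ρ) :=
  lift_of _ _ _

/-- Induction along the identity does nothing. -/
noncomputable def indIdEquiv {V : Type u} [AddCommGroup V] [Module k V]
    (ρ : Representation k G V) : (Representation.ind (MonoidHom.id G) ρ).Equiv ρ :=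
  Representation.Equiv.mk
    (LinearEquiv.ofLinearMap
      (Coinvariants.lift _ (TensorProduct.lift <| (Finsupp.lift _ _ _ fun h : G => ρ h⁻¹) ∘ₗ
        (MonoidAlgebra.coeffLinearEquiv k).toLinearMap)
        fun g => by
          ext h x
          simp [ofMulAction_single, mul_inv_rev])
      (IndV.mk (MonoidHom.id G) ρ 1)
      (by ext x; simp)
      (by
        refine IndV.hom_ext _ _ fun h => LinearMap.ext fun w => ?_
        simp [← Coinvariants.mk_inv_tmul]))
    (fun g => by
      refine IndV.hom_ext _ _ fun h => LinearMap.ext fun w => ?_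
      simp)

theorem ind_id [Finite G] : ind (k := k) (MonoidHom.id G) = AddMonoidHom.id _ := by
  refine hom_ext fun V => ?_
  have := finite_ind (MonoidHom.id G) V.ρ
  rw [ind_of]
  exact of_equiv (indIdEquiv V.ρ)

/-- The virtual dimension. -/
noncomputable def dim : VRep k G →+ ℤ :=
  lift (fun V => (Module.finrank k V.V : ℤ)) (fun U V W ⟨e⟩ => by
    rw [e.toLinearEquiv.finrank_eq, Module.finrank_prod]; push_cast; rfl)

theorem triv_ne_zero : triv k G ≠ 0 := by
  intro h
  have h2 : dim (triv k G) = 1 := by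
    rw [triv, dim, lift_of]; simp
  rw [h, map_zero] at h2
  exact zero_ne_one h2

/-- The class of the permutation representation of `G` on a finite `H`-set `X`, on which `G` acts
through the homomorphism `φ : G →* H`. -/
noncomputable def perm (k : Type u) [Field k] {G H : Type} [Group G] [Group H] (φ : G →* H)
    (X : Type) [MulAction H X] [Finite X] : VRep k G :=
  of (MonoidHom.comp (Representation.ofMulAction k H X) φ)

end ind
end VRep

/-! ### Equivariant Kazhdan-Lusztig polynomials -/

/-- The rank of a finite matroid, as a natural number. -/
noncomputable def Matroid.rankNat {α : Type} (M : Matroid α) : ℕ := M.eRank.toNat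

/-- The rank of a set in a finite matroid, as a natural number. -/
noncomputable def Matroid.rkNat {α : Type} (M : Matroid α) (F : Set α) : ℕ := (M.eRk F).toNat

section KL
variable (k : Type u) [Field k] {G α : Type} [Group G] [Finite G] [MulAction G α] [Finite α]

/-- The subgroup `H` of `G` acts on the matroid `M`: its elements send flats to flats. -/
def Matroid.PreservedBy (M : Matroid α) (H : Subgroup G) : Prop :=
  ∀ h ∈ H, ∀ F : Set α, M.IsFlat F → M.IsFlat (h • F)

/-- Two flats of `M` are equivalent if they lie in the same `H`-orbit. -/
def Matroid.flatSetoid (M : Matroid α) (H : Subgroup G) : Setoid {F : Set α // M.IsFlat F} where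
  r F F' := ∃ h ∈ H, h • F.1 = F'.1
  iseqv := {
    refl := fun F => ⟨1, H.one_mem, one_smul _ _⟩
    symm := by
      rintro F F' ⟨h, hh, e⟩
      exact ⟨h⁻¹, H.inv_mem hh, by rw [← e, inv_smul_smul]⟩
    trans := by
      rintro F F' F'' ⟨h, hh, e⟩ ⟨h', hh', e'⟩
      exact ⟨h' * h, H.mul_mem hh' hh, by rw [mul_smul, e, e']⟩ }

/-- The set of `H`-orbits of flats of `M`. -/
def Matroid.FlatOrbit (M : Matroid α) (H : Subgroup G) : Type :=
  Quotient (M.flatSetoid H)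

instance (M : Matroid α) (H : Subgroup G) : Finite (M.FlatOrbit H) :=
  inferInstanceAs (Finite (Quotient (M.flatSetoid H)))

/-- The orbit of a flat. -/
def Matroid.FlatOrbit.mk {M : Matroid α} (H : Subgroup G) {F : Set α} (hF : M.IsFlat F) :
    M.FlatOrbit H := Quotient.mk (M.flatSetoid H) ⟨F, hF⟩

theorem Matroid.FlatOrbit.exists_smul_flat_mk {M : Matroid α} (H : Subgroup G) {F : Set α}
    (hF : M.IsFlat F) : ∃ h ∈ H, h • (Quotient.out (s := M.flatSetoid H) (Matroid.FlatOrbit.mk H hF)).1 = F :=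
  Quotient.mk_out (s := M.flatSetoid H) ⟨F, hF⟩

/-- A flat representing an orbit of flats. -/
noncomputable def Matroid.FlatOrbit.flat {M : Matroid α} {H : Subgroup G} (q : M.FlatOrbit H) :
    Set α :=
  (Quotient.out q).1

/-- The stabilizer `H_F` of `F` in `H`. -/
def flatStabilizer (H : Subgroup G) (F : Set α) : Subgroup G := H ⊓ MulAction.stabilizer G F

variable (G α) in
/-- A choice, for all subgroups `H` of `G` and all matroids `M` on subsets of `α`, of a polynomial
in one variable `t` with coefficients in the virtual representations of `H`. The polynomial is given
as its sequence of coefficients: `P H M i` is the coefficient of `t ^ i`. -/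
abbrev PolyFamily : Type (u + 1) :=
  (H : Subgroup G) → Matroid α → ℕ → VRep k H

variable {k}

theorem flatStabilizer_le (H : Subgroup G) (F : Set α) : flatStabilizer H F ≤ H := inf_le_left

/-- The coefficient of `t ^ i` in `t ^ (rk F) * Ind_{H_F}^H (P H_F (M / F))`. -/
noncomputable def PolyFamily.flatTerm (P : PolyFamily k G α) (H : Subgroup G) (M : Matroid α)
    (F : Set α) (i : ℕ) : VRep k H :=
  if M.rkNat F ≤ i then
    VRep.ind (Subgroup.inclusion (flatStabilizer_le H F))
      (P (flatStabilizer H F) (M ／ F) (i - M.rkNat F))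
  else 0

/-- The coefficient of `t ^ i` in the sum of `t ^ (rk F) * Ind_{H_F}^H (P H_F (M / F))` over the
`H`-orbits `[F]` of flats of `M`. -/
noncomputable def PolyFamily.zPoly (P : PolyFamily k G α) (H : Subgroup G) (M : Matroid α)
    (i : ℕ) : VRep k H :=
  ∑ᶠ q : M.FlatOrbit H, P.flatTerm H M q.flat i

/-- The conditions that characterize equivariant Kazhdan-Lusztig polynomials:
if `M` is loopless and `H` acts on `M`, then
* `P H M = 1` (the trivial representation in degree zero) if `rk M = 0`;
* `deg (P H M) < rk M / 2` if `rk M > 0`;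
* the polynomial `Z` has degree exactly `rk M` and is palindromic. -/
structure PolyFamily.IsKL (P : PolyFamily k G α) : Prop where
  rank_zero : ∀ (H : Subgroup G) (M : Matroid α), M.Loopless → M.PreservedBy H →
    M.rankNat = 0 → ∀ i, P H M i = if i = 0 then VRep.triv k H else 0
  degree_lt : ∀ (H : Subgroup G) (M : Matroid α), M.Loopless → M.PreservedBy H →
    0 < M.rankNat → ∀ i, M.rankNat ≤ 2 * i → P H M i = 0
  degree_zPoly : ∀ (H : Subgroup G) (M : Matroid α), M.Loopless → M.PreservedBy H →
    P.zPoly H M M.rankNat ≠ 0 ∧ ∀ i, M.rankNat < i → P.zPoly H M i = 0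
  palindromic : ∀ (H : Subgroup G) (M : Matroid α), M.Loopless → M.PreservedBy H →
    ∀ i j, i + j = M.rankNat → P.zPoly H M i = P.zPoly H M j

theorem Matroid.rkNat_add_rankNat_contract (M : Matroid α) (F : Set α) (hF : F ⊆ M.E) :
    M.rkNat F + (M ／ F).rankNat = M.rankNat := by
  have h1 := M.eRk_dual_add_eRank (M.E \ F)
  have h2 := (M✶ ＼ F).eRank_add_eRank_dual
  rw [Matroid.dual_delete_dual, Matroid.delete_eq_restrict, Matroid.eRank_restrict,
    Matroid.dual_ground, Matroid.restrict_ground_eq] at h2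
  rw [Set.sdiff_sdiff_cancel_left hF] at h1
  have fin : ∀ (N : Matroid α) (X : Set α), N.eRk X ≠ ⊤ := fun N X =>
    ((N.eRk_le_encard X).trans_lt (Set.toFinite X).encard_lt_top).ne
  have fin' : ∀ (N : Matroid α), N.eRank ≠ ⊤ := fun N => by rw [Matroid.eRank_def]; exact fin _ _
  unfold Matroid.rkNat Matroid.rankNat
  have hc : (M.E \ F).encard ≠ ⊤ := (Set.toFinite _).encard_lt_top.ne
  lift M.eRk F to ℕ using fin _ _ with a ha
  lift M✶.eRk (M.E \ F) to ℕ using fin _ _ with b hb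
  lift M.eRank to ℕ using fin' _ with c hc'
  lift (M ／ F).eRank to ℕ using fin' _ with d hd
  lift (M.E \ F).encard to ℕ using hc with e he
  simp only [ENat.toNat_natCast]
  norm_cast at h1 h2
  omega

theorem Matroid.isFlat_contract_iff (M : Matroid α) (F X : Set α) (hF : M.IsFlat F) :
    (M ／ F).IsFlat X ↔ M.IsFlat (X ∪ F) ∧ Disjoint X F := by
  rw [Matroid.isFlat_iff_closure_eq, Matroid.isFlat_iff_closure_eq, Matroid.contract_closure_eq]
  constructor
  · intro h
    have hd : Disjoint X F := by rw [← h]; exact Set.disjoint_sdiff_left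
    refine ⟨?_, hd⟩
    conv_rhs => rw [← h]
    rw [Set.sdiff_union_self, eq_comm, Set.union_eq_left]
    refine (M.subset_closure F hF.subset_ground).trans (M.closure_subset_closure Set.subset_union_right)
  · rintro ⟨h, hd⟩
    rw [h, Set.union_sdiff_right, hd.sdiff_eq_left]

theorem Matroid.IsFlat.loopless_contract {M : Matroid α} {F : Set α} (hF : M.IsFlat F) :
    (M ／ F).Loopless := by
  refine ⟨?_⟩
  rw [Matroid.contract_loops_eq, hF.closure, Set.sdiff_self]

theorem Matroid.PreservedBy.contract {M : Matroid α} {H : Subgroup G} (h : M.PreservedBy H)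
    {F : Set α} (hF : M.IsFlat F) : (M ／ F).PreservedBy (flatStabilizer H F) := by
  rintro g ⟨hg, hgF⟩ X hX
  rw [Matroid.isFlat_contract_iff M _ _ hF] at hX ⊢
  have e : g • F = F := hgF
  constructor
  · have := h g hg _ hX.1
    rwa [Set.smul_set_union, e] at this
  · rw [← e]
    exact (Set.disjoint_smul_set).2 hX.2

theorem Matroid.isFlat_empty {M : Matroid α} (h : M.Loopless) : M.IsFlat ∅ := by
  rw [Matroid.isFlat_iff_closure_eq, Matroid.closure_empty]
  exact h.loops_eq_empty

theorem Matroid.exists_orbit_empty {M : Matroid α} (h : M.Loopless) (H : Subgroup G) :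
    ∃ q : M.FlatOrbit H, q.flat = ∅ ∧ ∀ q', q' ≠ q → q'.flat.Nonempty := by
  refine ⟨Matroid.FlatOrbit.mk H (Matroid.isFlat_empty h), ?_, ?_⟩
  · obtain ⟨g, -, hg⟩ := Matroid.FlatOrbit.exists_smul_flat_mk H (Matroid.isFlat_empty h)
    simpa [Matroid.FlatOrbit.flat] using hg
  · intro q' hq'
    rw [Set.nonempty_iff_ne_empty]
    intro he
    apply hq'
    rw [← Quotient.out_eq q']
    exact congrArg _ (Subtype.ext he)

theorem Matroid.FlatOrbit.isFlat {M : Matroid α} {H : Subgroup G} (q : M.FlatOrbit H) :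
    M.IsFlat q.flat := (Quotient.out q).2

/-- The part of `zPoly` that comes from the non-empty flats. -/
noncomputable def PolyFamily.rest (P : PolyFamily k G α) (H : Subgroup G) (M : Matroid α)
    (i : ℕ) : VRep k H :=
  ∑ᶠ q : M.FlatOrbit H, open Classical in
    if q.flat.Nonempty then P.flatTerm H M q.flat i else 0

theorem PolyFamily.flatTerm_empty (P : PolyFamily k G α) (H : Subgroup G) (M : Matroid α)
    (i : ℕ) : P.flatTerm H M ∅ i = P H M i := by
  have h0 : M.rkNat ∅ = 0 := by simp [Matroid.rkNat]
  have hs : flatStabilizer H (∅ : Set α) = H := by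
    unfold flatStabilizer
    rw [inf_eq_left]
    intro g _
    simp
  have hM : M ／ (∅ : Set α) = M := Matroid.contract_empty M
  unfold PolyFamily.flatTerm
  rw [if_pos (by omega), h0, hM, Nat.sub_zero]
  have : ∀ (K : Subgroup G) (hK : K ≤ H), K = H →
      VRep.ind (Subgroup.inclusion hK) (P K M i) = P H M i := by
    rintro K hK rfl
    have : Subgroup.inclusion hK = MonoidHom.id K := by ext; rfl
    rw [this, VRep.ind_id]; rfl
  exact this _ _ hs

theorem PolyFamily.zPoly_eq (P : PolyFamily k G α) (H : Subgroup G) (M : Matroid α)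
    (hM : M.Loopless) (i : ℕ) : P.zPoly H M i = P H M i + P.rest H M i := by
  classical
  obtain ⟨q, hq, hq'⟩ := Matroid.exists_orbit_empty hM H
  have : P.zPoly H M i = ∑ᶠ q' : M.FlatOrbit H, ((if q' = q then P H M i else 0) +
      if q'.flat.Nonempty then P.flatTerm H M q'.flat i else 0) := by
    unfold PolyFamily.zPoly
    refine finsum_congr fun q' => ?_
    by_cases h : q' = q
    · subst h
      rw [if_pos rfl, hq, if_neg (by simp), add_zero, PolyFamily.flatTerm_empty]
    · rw [if_neg h, if_pos (hq' _ h), zero_add]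
  rw [this, finsum_add_distrib (Set.toFinite _) (Set.toFinite _)]
  congr 1
  rw [finsum_eq_single _ q (fun x hx => if_neg hx), if_pos rfl]

theorem PolyFamily.rest_congr (P Q : PolyFamily k G α) (H : Subgroup G) (M : Matroid α)
    (h : ∀ F, M.IsFlat F → F.Nonempty → ∀ i, P (flatStabilizer H F) (M ／ F) i =
      Q (flatStabilizer H F) (M ／ F) i) (i : ℕ) : P.rest H M i = Q.rest H M i := by
  unfold PolyFamily.rest
  refine finsum_congr fun q => ?_
  split_ifs with hq
  · unfold PolyFamily.flatTerm
    rw [h _ q.isFlat hq]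
  · rfl

theorem Matroid.ncard_contract_lt {M : Matroid α} {F : Set α} (hF : M.IsFlat F)
    (hne : F.Nonempty) : (M ／ F).E.ncard < M.E.ncard := by
  refine Set.ncard_lt_ncard ?_ (Set.toFinite _)
  rw [Matroid.contract_ground]
  obtain ⟨x, hx⟩ := hne
  exact ⟨Set.sdiff_subset, fun h => (h (hF.subset_ground hx)).2 hx⟩

/-- The conditions determine the polynomials. -/
theorem PolyFamily.IsKL.unique {P Q : PolyFamily k G α} (hP : P.IsKL) (hQ : Q.IsKL)
    (H : Subgroup G) (M : Matroid α) (hM : M.Loopless) (hH : M.PreservedBy H) (i : ℕ) :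
    P H M i = Q H M i := by
  suffices ∀ n, ∀ (H : Subgroup G) (M : Matroid α), M.E.ncard = n → M.Loopless →
      M.PreservedBy H → ∀ i, P H M i = Q H M i from this _ H M rfl hM hH i
  intro n
  induction n using Nat.strong_induction_on with
  | _ n ih =>
    rintro H M rfl hM hH i
    rcases Nat.eq_zero_or_pos M.rankNat with h0 | h0
    · rw [hP.rank_zero H M hM hH h0, hQ.rank_zero H M hM hH h0]
    rcases Nat.lt_or_ge (2 * i) M.rankNat with hi | hi
    · have hr := PolyFamily.rest_congr P Q H M (fun F hF hne i =>
        ih _ (Matroid.ncard_contract_lt hF hne) _ _ rfl hF.loopless_contract (hH.contract hF) i)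
      have e1 := hP.palindromic H M hM hH i (M.rankNat - i) (by omega)
      have e2 := hQ.palindromic H M hM hH i (M.rankNat - i) (by omega)
      rw [P.zPoly_eq H M hM, P.zPoly_eq H M hM, hP.degree_lt H M hM hH h0 _ (by omega : _ ≤ 2 * (M.rankNat - i)), zero_add] at e1
      rw [Q.zPoly_eq H M hM, Q.zPoly_eq H M hM, hQ.degree_lt H M hM hH h0 _ (by omega : _ ≤ 2 * (M.rankNat - i)), zero_add] at e2
      rw [eq_sub_of_add_eq e1, eq_sub_of_add_eq e2, hr, hr]
    · rw [hP.degree_lt H M hM hH h0 i hi, hQ.degree_lt H M hM hH h0 i hi]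

open Classical in
/-- The recursive solution of the conditions, by induction on the size of the ground set. -/
noncomputable def klAux : ℕ → PolyFamily k G α
  | 0 => fun H _ i => if i = 0 then VRep.triv k H else 0
  | n + 1 => fun H M i =>
    if M.rankNat = 0 then (if i = 0 then VRep.triv k H else 0)
    else if 2 * i < M.rankNat then
      (klAux n).rest H M (M.rankNat - i) - (klAux n).rest H M i
    else 0

theorem klAux_eq (n m : ℕ) (H : Subgroup G) (M : Matroid α) (hn : M.E.ncard ≤ n)
    (hm : M.E.ncard ≤ m) (i : ℕ) : klAux (k := k) n H M i = klAux m H M i := by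
  have h0 : M.E.ncard ≤ 0 → M.rankNat = 0 := by
    intro h
    have h1 : M.E = ∅ := (Set.ncard_eq_zero (Set.toFinite _)).1 (by omega)
    rw [Matroid.rankNat, Matroid.eRank_def, h1, Matroid.eRk_empty]; rfl
  induction n generalizing m H M i with
  | zero =>
    cases m with
    | zero => rfl
    | succ m => simp [klAux, h0 hn]
  | succ n ih =>
    cases m with
    | zero => simp [klAux, h0 hm]
    | succ m =>
      have : ∀ i, (klAux (k := k) n).rest H M i = (klAux m).rest H M i := by
        refine PolyFamily.rest_congr _ _ H M fun F hF hne i => ?_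
        have := Matroid.ncard_contract_lt hF hne
        refine ih m _ _ (by omega) (by omega) i fun h => ?_
        have h1 : (M ／ F).E = ∅ := (Set.ncard_eq_zero (Set.toFinite _)).1 (by omega)
        rw [Matroid.rankNat, Matroid.eRank_def, h1, Matroid.eRk_empty]; rfl
      simp only [klAux, this]

/-- The solution of the conditions. -/
noncomputable def klFamily : PolyFamily k G α := fun H M i => klAux M.E.ncard H M i

theorem klFamily_eq (H : Subgroup G) (M : Matroid α) (i : ℕ) :
    klFamily (k := k) H M i = if M.rankNat = 0 then (if i = 0 then VRep.triv k H else 0)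
    else if 2 * i < M.rankNat then
      klFamily.rest H M (M.rankNat - i) - klFamily.rest H M i
    else 0 := by
  have e : klFamily (k := k) H M i = klAux (M.E.ncard + 1) H M i :=
    klAux_eq _ _ _ _ le_rfl (by omega) i
  have : ∀ i, (klAux (k := k) M.E.ncard).rest H M i = klFamily.rest H M i := by
    refine PolyFamily.rest_congr _ _ H M fun F hF hne i => ?_
    have := Matroid.ncard_contract_lt hF hne
    exact klAux_eq _ _ _ _ (by omega) (by omega) i
  rw [e]
  simp only [klAux, this]

theorem klFamily_degree (H : Subgroup G) (M : Matroid α) (h0 : 0 < M.rankNat) (i : ℕ)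
    (hi : M.rankNat ≤ 2 * i) : klFamily (k := k) H M i = 0 := by
  rw [klFamily_eq, if_neg (by omega), if_neg (by omega)]

theorem klFamily_rest_large (H : Subgroup G) (M : Matroid α) (i : ℕ)
    (hi : M.rankNat < i) : (klFamily (k := k)).rest H M i = 0 := by
  unfold PolyFamily.rest
  refine finsum_eq_zero_of_forall_eq_zero fun q => ?_
  split_ifs with hq
  · unfold PolyFamily.flatTerm
    have := M.rkNat_add_rankNat_contract q.flat q.isFlat.subset_ground
    split_ifs with h
    · rcases Nat.eq_zero_or_pos (M ／ q.flat).rankNat with h0 | h0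
      · rw [klFamily_eq, if_pos h0, if_neg (by omega), map_zero]
      · rw [klFamily_degree _ _ h0 _ (by omega), map_zero]
    · rfl
  · rfl

theorem klFamily_rest_top (H : Subgroup G) (M : Matroid α) (hH : M.PreservedBy H)
    (hM : M.Loopless) (h0 : 0 < M.rankNat) :
    (klFamily (k := k)).rest H M M.rankNat = VRep.triv k H := by
  have hE : M.E.Nonempty := by
    rw [Set.nonempty_iff_ne_empty]
    intro h1
    rw [Matroid.rankNat, Matroid.eRank_def, h1, Matroid.eRk_empty] at h0
    exact lt_irrefl _ h0
  have hg : ∀ g ∈ H, g • M.E = M.E := fun g hg =>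
    Set.eq_of_subset_of_ncard_le (hH g hg _ M.ground_isFlat).subset_ground
      (by rw [Set.ncard_smul_set]) (Set.toFinite _)
  have hq : (Matroid.FlatOrbit.mk H M.ground_isFlat).flat = M.E := by
    obtain ⟨g, hgH, e⟩ := Matroid.FlatOrbit.exists_smul_flat_mk H M.ground_isFlat
    exact smul_left_cancel g (e.trans (hg g hgH).symm)
  unfold PolyFamily.rest
  rw [finsum_eq_single _ (Matroid.FlatOrbit.mk H M.ground_isFlat)]
  · rw [hq, if_pos hE]
    have h1 : M.rkNat M.E = M.rankNat := by rw [Matroid.rkNat, Matroid.eRk_ground]; rfl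
    have h2 := M.rkNat_add_rankNat_contract M.E subset_rfl
    have hs : flatStabilizer H M.E = H := by
      unfold flatStabilizer
      rw [inf_eq_left]
      exact hg
    unfold PolyFamily.flatTerm
    rw [if_pos (by omega), h1, Nat.sub_self]
    have : ∀ (K : Subgroup G) (hK : K ≤ H), K = H →
        VRep.ind (Subgroup.inclusion hK) (klFamily K (M ／ M.E) 0) = VRep.triv k H := by
      rintro K hK rfl
      have : Subgroup.inclusion hK = MonoidHom.id K := by ext; rfl
      rw [this, VRep.ind_id, klFamily_eq, if_pos (by omega), if_pos rfl]; rfl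
    exact this _ _ hs
  · intro q hne
    split_ifs with hqn
    · have hlt : 0 < (M ／ q.flat).rankNat := by
        rw [Nat.pos_iff_ne_zero]
        intro hz
        have h3 := hM
        have h4 := q.isFlat.loopless_contract
        have h5 : (M ／ q.flat).eRank = 0 := by
          have : (M ／ q.flat).eRank ≠ ⊤ := by
            rw [Matroid.eRank_def]
            exact ((Matroid.eRk_le_encard _ _).trans_lt (Set.toFinite _).encard_lt_top).ne
          rw [← ENat.natCast_toNat this]
          exact_mod_cast hz
        have h6 := Matroid.eRank_eq_zero_iff.1 h5
        have h7 := h4.loops_eq_empty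
        rw [(Matroid.eq_loopyOn_iff_loops.1 h6).1, Matroid.contract_ground,
          Set.sdiff_eq_empty] at h7
        apply hne
        rw [← Quotient.out_eq q]
        refine congrArg _ (Subtype.ext (q.isFlat.subset_ground.antisymm h7))
      unfold PolyFamily.flatTerm
      have := M.rkNat_add_rankNat_contract q.flat q.isFlat.subset_ground
      rw [if_pos (by omega), klFamily_degree _ _ hlt _ (by omega), map_zero]
    · rfl

theorem klFamily_isKL : (klFamily (k := k) (G := G) (α := α)).IsKL where
  rank_zero H M hM hH h0 i := by rw [klFamily_eq, if_pos h0]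
  degree_lt H M hM hH h0 i hi := klFamily_degree H M h0 i hi
  degree_zPoly H M hM hH := by
    constructor
    · rcases Nat.eq_zero_or_pos M.rankNat with h0 | h0
      · have h5 : M.eRank = 0 := by
          have : M.eRank ≠ ⊤ := by
            rw [Matroid.eRank_def]
            exact ((Matroid.eRk_le_encard _ _).trans_lt (Set.toFinite _).encard_lt_top).ne
          rw [← ENat.natCast_toNat this]
          exact_mod_cast h0
        have h6 := Matroid.eRank_eq_zero_iff.1 h5
        have h7 := hM.loops_eq_empty
        rw [(Matroid.eq_loopyOn_iff_loops.1 h6).1] at h7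
        have h8 : (klFamily (k := k)).rest H M M.rankNat = 0 := by
          unfold PolyFamily.rest
          refine finsum_eq_zero_of_forall_eq_zero fun q => if_neg ?_
          have := q.isFlat.subset_ground
          rw [h7, Set.subset_empty_iff] at this
          simp [this]
        rw [PolyFamily.zPoly_eq _ _ _ hM, h8, klFamily_eq, if_pos h0, if_pos h0, add_zero]
        exact VRep.triv_ne_zero
      · rw [PolyFamily.zPoly_eq _ _ _ hM, klFamily_rest_top _ _ hH hM h0,
          klFamily_degree H M h0 _ (by omega), zero_add]
        exact VRep.triv_ne_zero
    · intro i hi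
      rw [PolyFamily.zPoly_eq _ _ _ hM, klFamily_rest_large _ _ _ hi, add_zero, klFamily_eq]
      split_ifs <;> first | omega | rfl
  palindromic H M hM hH := by
    have key : ∀ i j, i + j = M.rankNat → i ≤ j →
        klFamily.zPoly (k := k) H M i = klFamily.zPoly H M j := by
      intro i j hij hle
      rcases hle.eq_or_lt with rfl | hlt
      · rfl
      rw [PolyFamily.zPoly_eq _ _ _ hM, PolyFamily.zPoly_eq _ _ _ hM,
        klFamily_degree H M (by omega) j (by omega), klFamily_eq, if_neg (by omega),
        if_pos (by omega), show M.rankNat - i = j by omega]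
      abel
    intro i j hij
    rcases le_total i j with h | h
    · exact key i j hij h
    · exact (key j i (by omega) h).symm

theorem exists_isKL : ∃ P : PolyFamily k G α, P.IsKL := ⟨klFamily, klFamily_isKL⟩

variable (k) in
/-- The equivariant Kazhdan-Lusztig polynomial `P_M^H(t)` of a loopless matroid `M` on a subset of
`α`, for the action of a subgroup `H` of `G`: `equivariantKL k H M i` is its coefficient of `t ^ i`.
It is the unique solution of the conditions `PolyFamily.IsKL`. -/
noncomputable def equivariantKL : PolyFamily k G α := Classical.choose exists_isKL

theorem equivariantKL_isKL : (equivariantKL k : PolyFamily k G α).IsKL :=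
  Classical.choose_spec exists_isKL

variable (k) in
/-- The equivariant `Z`-polynomial `Z_M^H(t)`: `equivariantZ k H M i` is its coefficient of
`t ^ i`. -/
noncomputable def equivariantZ : PolyFamily k G α := (equivariantKL k).zPoly

end KL

/-! ### Braid matroids -/

open SimpleGraph in
theorem SimpleGraph.ncard_le_of_acyclic {V : Type*} [Finite V] {A B : SimpleGraph V}
    (hA : A.IsAcyclic) (hB : B.IsAcyclic) (h : ∀ u v, B.Adj u v → A.Reachable u v) :
    B.edgeSet.ncard ≤ A.edgeSet.ncard := by
  classical
  rcases isEmpty_or_nonempty V with hV | hV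
  · have : B.edgeSet = ∅ := by
      ext e; induction e using Sym2.ind with | _ u v => exact (hV.false u).elim
    simp [this]
  have := Fintype.ofFinite V
  obtain ⟨T, hAT, -, hT⟩ := (connected_top (V := V)).exists_isTree_le_of_le_of_isAcyclic
    (le_top : A ≤ ⊤) hA
  have key : ∀ K : Set (Sym2 V), K.Finite → K ⊆ T.edgeSet \ A.edgeSet →
      (B ⊔ fromEdgeSet K).IsAcyclic := by
    intro K hK
    induction K, hK using Set.Finite.induction_on with
    | empty => intro _; simpa using hB
    | @insert e K he _ ih =>
      intro hsub
      induction e using Sym2.ind with | _ u v => ?_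
      have heK : s(u, v) ∈ T.edgeSet \ A.edgeSet := hsub (Set.mem_insert _ _)
      have hKs : K ⊆ T.edgeSet \ A.edgeSet := (Set.subset_insert _ _).trans hsub
      have e1 : ∀ X : SimpleGraph V, X ⊔ fromEdgeSet (insert s(u, v) K) =
          (X ⊔ fromEdgeSet K) ⊔ edge u v := by
        intro X
        rw [sup_assoc]; congr 1
        ext a b; simp [edge_adj, fromEdgeSet_adj]; tauto
      rw [e1]
      apply IsAcyclic.sup_edge_of_not_reachable _ (ih hKs)
      intro hr
      have hr' : (A ⊔ fromEdgeSet K).Reachable u v := by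
        obtain ⟨w⟩ := hr
        clear heK hsub e1 he
        induction w with
        | nil => exact Reachable.refl _
        | cons hadj _ ih2 =>
          refine Reachable.trans ?_ ih2
          rcases hadj with h1 | h1
          · exact (h _ _ h1).mono le_sup_left
          · exact Adj.reachable (Or.inr h1)
      have hac : ((A ⊔ fromEdgeSet K) ⊔ edge u v).IsAcyclic := by
        rw [← e1]
        refine hT.isAcyclic.anti (sup_le hAT ?_)
        intro a b hab
        rw [fromEdgeSet_adj] at hab
        exact (hsub hab.1).1
      rcases (isAcyclic_sup_fromEdgeSet_iff.1 hac).2 hr' with h2 | h2 | h2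
      · subst h2; exact T.loopless.irrefl _ heK.1
      · exact heK.2 h2
      · rw [fromEdgeSet_adj] at h2; exact he h2.1
  set K := T.edgeSet \ A.edgeSet with hKdef
  have hac := key K (Set.toFinite _) subset_rfl
  obtain ⟨T', hT'le, -, hT'⟩ := (connected_top (V := V)).exists_isTree_le_of_le_of_isAcyclic
    (le_top : _ ≤ ⊤) hac
  have hdisj : Disjoint B.edgeSet K := by
    rw [Set.disjoint_left]
    intro e heB heK
    induction e using Sym2.ind with | _ u v => ?_
    have hac2 : (A ⊔ edge u v).IsAcyclic := by
      refine hT.isAcyclic.anti (sup_le hAT ?_)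
      rw [edge_le_iff]; right; exact heK.1
    rcases (isAcyclic_sup_fromEdgeSet_iff.1 hac2).2 (h u v heB) with h2 | h2
    · subst h2; exact B.loopless.irrefl _ heB
    · exact heK.2 h2
  have hKT : K ⊆ T.edgeSet := Set.sdiff_subset
  have c1 : (B.edgeSet ∪ K).ncard ≤ T'.edgeSet.ncard := by
    apply Set.ncard_le_ncard _ (Set.toFinite _)
    have := edgeSet_mono hT'le
    rw [edgeSet_sup, edgeSet_fromEdgeSet] at this
    intro e he
    apply this
    rcases he with he | he
    · exact Or.inl he
    · refine Or.inr ⟨he, ?_⟩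
      exact T.not_isDiag_of_mem_edgeSet (hKT he)
  rw [Set.ncard_union_eq hdisj (Set.toFinite _) (Set.toFinite _)] at c1
  have c2 : T.edgeSet.ncard = A.edgeSet.ncard + K.ncard := by
    rw [add_comm]
    exact (Set.ncard_sdiff_add_ncard_of_subset (edgeSet_mono hAT) (Set.toFinite _)).symm
  have c3 : ∀ S : SimpleGraph V, S.IsTree → S.edgeSet.ncard + 1 = Fintype.card V := by
    intro S hS
    rw [← hS.card_edgeFinset, Set.ncard_eq_toFinset_card', edgeFinset]
  have := c3 T hT
  have := c3 T' hT'
  omega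

open SimpleGraph in
/-- The cycle matroid of a finite simple graph: the ground set is the set of edges, and a set of edges
is independent if it contains no cycle. -/
noncomputable def SimpleGraph.cycleMatroid {V : Type*} [Finite V] (G : SimpleGraph V) :
    Matroid (Sym2 V) :=
  (IndepMatroid.ofFinite (E := G.edgeSet) (Set.toFinite _)
    (fun I => I ⊆ G.edgeSet ∧ (fromEdgeSet I).IsAcyclic)
    ⟨Set.empty_subset _, by simp⟩
    (fun _ _ hJ hIJ => ⟨hIJ.trans hJ.1, hJ.2.anti (fromEdgeSet_mono hIJ)⟩)
    (by
      rintro I J ⟨hIE, hI⟩ ⟨hJE, hJ⟩ hlt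
      by_contra! hcon
      have hE : ∀ S : Set (Sym2 V), S ⊆ G.edgeSet → (fromEdgeSet S).edgeSet = S := by
        intro S hS
        rw [edgeSet_fromEdgeSet]
        ext e
        exact ⟨fun h => h.1, fun h => ⟨h, G.not_isDiag_of_mem_edgeSet (hS h)⟩⟩
      have := ncard_le_of_acyclic hI hJ (by
        intro u v huv
        rw [fromEdgeSet_adj] at huv
        by_cases hmem : s(u, v) ∈ I
        · exact Adj.reachable (by rw [fromEdgeSet_adj]; exact ⟨hmem, huv.2⟩)
        by_contra hr
        refine hcon _ huv.1 hmem (Set.insert_subset (hJE huv.1) hIE) ?_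
        have : fromEdgeSet (insert s(u, v) I) = fromEdgeSet I ⊔ edge u v := by
          ext a b; simp [edge_adj, fromEdgeSet_adj]; tauto
        rw [this]
        exact IsAcyclic.sup_edge_of_not_reachable hr hI)
      rw [hE I hIE, hE J hJE] at this
      omega)
    (fun _ h => h.1)).matroid

/-- The braid matroid `K_n`, the cycle matroid of the complete graph on `n` vertices. -/
noncomputable def braidMatroid (n : ℕ) : Matroid (Sym2 (Fin n)) :=
  (⊤ : SimpleGraph (Fin n)).cycleMatroid

/-- Permutations of the vertices act on unordered pairs of vertices. -/
instance Sym2.permMulAction {V : Type} : MulAction (Equiv.Perm V) (Sym2 V) where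
  smul σ e := e.map σ
  one_smul e := congrFun Sym2.map_id' e
  mul_smul σ τ e := (Sym2.map_map (g := σ) (f := τ) e).symm

/-! ### Quasi series-parallel matroids -/

namespace Matroid
variable {α β : Type}

/-- Series-parallel matroids: those obtained from a single loop or a single coloop by a finite
sequence of parallel extensions (`M` is a parallel extension of `M ＼ {e}` if `e` lies in a circuit of
size two of `M`) and series extensions (`M` is a series extension of `M ／ {e}` if `e` lies in a
cocircuit of size two of `M`). -/
inductive IsSeriesParallel : Matroid α → Prop
  | loop (e : α) : IsSeriesParallel (loopyOn {e})
  | coloop (e : α) : IsSeriesParallel (freeOn {e})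
  | parallel (M : Matroid α) (e f : α) (hef : e ≠ f) (hC : M.IsCircuit {e, f})
      (h : IsSeriesParallel (M ＼ {e})) : IsSeriesParallel M
  | series (M : Matroid α) (e f : α) (hef : e ≠ f) (hC : M.IsCocircuit {e, f})
      (h : IsSeriesParallel (M ／ {e})) : IsSeriesParallel M

/-- The connected component of an element `e` of the ground set: it consists of `e` and of the elements
that lie in a common circuit with `e`. -/
def component (M : Matroid α) (e : α) : Set α :=
  {f | f = e ∨ ∃ C, M.IsCircuit C ∧ e ∈ C ∧ f ∈ C}

/-- A matroid is quasi series-parallel if all its connected components are series-parallel. -/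
def IsQuasiSeriesParallel (M : Matroid α) : Prop :=
  ∀ e ∈ M.E, IsSeriesParallel (M ↾ M.component e)

/-- A matroid is simple if it has no loops and no circuits of size two. -/
def IsSimple (M : Matroid α) : Prop :=
  M.Loopless ∧ ∀ C, M.IsCircuit C → C.ncard ≠ 2

theorem mapEquiv_restrict (M : Matroid α) (σ : α ≃ β) (R : Set α) :
    (M ↾ R).mapEquiv σ = (M.mapEquiv σ) ↾ (σ '' R) := by
  refine ext_indep rfl fun I _ => ?_
  simp only [mapEquiv_indep_iff, restrict_indep_iff]
  rw [Equiv.symm_image_subset]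

theorem mapEquiv_delete (M : Matroid α) (σ : α ≃ β) (R : Set α) :
    (M ＼ R).mapEquiv σ = (M.mapEquiv σ) ＼ (σ '' R) := by
  rw [delete_eq_restrict, delete_eq_restrict, mapEquiv_restrict, mapEquiv_ground_eq,
    Set.image_sdiff σ.injective]

theorem mapEquiv_dual (M : Matroid α) (σ : α ≃ β) : (M.mapEquiv σ)✶ = M✶.mapEquiv σ := by
  rw [mapEquiv_eq_map, mapEquiv_eq_map, map_dual]

theorem mapEquiv_contract (M : Matroid α) (σ : α ≃ β) (R : Set α) :
    (M ／ R).mapEquiv σ = (M.mapEquiv σ) ／ (σ '' R) := by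
  rw [← dual_delete_dual, ← dual_delete_dual, ← mapEquiv_dual, mapEquiv_delete, mapEquiv_dual]

theorem IsCircuit.mapEquiv {M : Matroid α} {C : Set α} (h : M.IsCircuit C) (σ : α ≃ β) :
    (M.mapEquiv σ).IsCircuit (σ '' C) := by
  constructor
  · simpa using h.1
  · intro D hD hDC
    rw [mapEquiv_dep_iff] at hD
    have := h.2 hD ((Equiv.symm_image_subset _ _ _).2 hDC)
    intro x hx
    obtain ⟨y, hy, rfl⟩ := hx
    obtain ⟨z, hz, e⟩ := this hy
    rw [← e]; simpa using hz

theorem mapEquiv_mapEquiv_symm (M : Matroid α) (σ : α ≃ β) : (M.mapEquiv σ).mapEquiv σ.symm = M := by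
  refine ext_indep (by simp) fun I _ => ?_
  simp

theorem IsSeriesParallel.mapEquiv {M : Matroid α} (h : M.IsSeriesParallel) (σ : α ≃ β) :
    (M.mapEquiv σ).IsSeriesParallel := by
  induction h with
  | loop e =>
    have : (loopyOn {e}).mapEquiv σ = loopyOn {σ e} := by
      refine ext_indep (by simp) fun I _ => ?_
      simp
    rw [this]; exact .loop _
  | coloop e =>
    have : (freeOn {e}).mapEquiv σ = freeOn {σ e} := by
      refine ext_indep (by simp) fun I _ => ?_
      rw [mapEquiv_indep_iff, freeOn_indep_iff, freeOn_indep_iff, Equiv.symm_image_subset,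
        Set.image_singleton]
    rw [this]; exact .coloop _
  | parallel M e f hef hC _ ih =>
    refine .parallel _ (σ e) (σ f) (σ.injective.ne hef) ?_ ?_
    · simpa [Set.image_pair] using hC.mapEquiv σ
    · simpa [mapEquiv_delete] using ih
  | series M e f hef hC _ ih =>
    refine .series _ (σ e) (σ f) (σ.injective.ne hef) ?_ ?_
    · rw [IsCocircuit, mapEquiv_dual]
      simpa [Set.image_pair] using IsCircuit.mapEquiv hC σ
    · simpa [mapEquiv_contract] using ih

theorem component_mapEquiv (M : Matroid α) (σ : α ≃ β) (e : α) :
    (M.mapEquiv σ).component (σ e) = σ '' M.component e := by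
  ext x
  obtain ⟨f, rfl⟩ := σ.surjective x
  rw [σ.injective.mem_set_image]
  simp only [component, Set.mem_ofPred_eq, σ.injective.eq_iff]
  refine or_congr Iff.rfl ⟨?_, ?_⟩
  · rintro ⟨C, hC, he, hf⟩
    have := hC.mapEquiv σ.symm
    rw [mapEquiv_mapEquiv_symm] at this
    exact ⟨_, this, ⟨_, he, by simp⟩, ⟨_, hf, by simp⟩⟩
  · rintro ⟨C, hC, he, hf⟩
    exact ⟨_, hC.mapEquiv σ, ⟨_, he, rfl⟩, ⟨_, hf, rfl⟩⟩

theorem IsQuasiSeriesParallel.mapEquiv {M : Matroid α} (h : M.IsQuasiSeriesParallel)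
    (σ : α ≃ β) : (M.mapEquiv σ).IsQuasiSeriesParallel := by
  rintro _ ⟨e, he, rfl⟩
  have := (h e he).mapEquiv σ
  rwa [mapEquiv_restrict, ← component_mapEquiv] at this

theorem IsSimple.mapEquiv {M : Matroid α} (h : M.IsSimple) (σ : α ≃ β) :
    (M.mapEquiv σ).IsSimple := by
  refine ⟨⟨?_⟩, fun C hC hc => ?_⟩
  · rw [mapEquiv_eq_map, map_loops, h.1.loops_eq_empty, Set.image_empty]
  · have := hC.mapEquiv σ.symm
    rw [mapEquiv_mapEquiv_symm] at this
    exact h.2 _ this (by rw [Set.ncard_image_of_injective _ σ.symm.injective, hc])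

/-- Permutations of a type act on the matroids on its subsets by relabelling. -/
instance permMulAction : MulAction (Equiv.Perm α) (Matroid α) where
  smul σ M := M.mapEquiv σ
  one_smul M := by
    change M.mapEquiv 1 = M
    refine ext_indep (by simp) fun I _ => ?_
    rw [mapEquiv_indep_iff]
    simp [← Equiv.Perm.inv_def]
  mul_smul σ τ M := by
    change M.mapEquiv (σ * τ) = (M.mapEquiv τ).mapEquiv σ
    refine ext_indep (by simp [Set.image_image]) fun I _ => ?_
    simp only [mapEquiv_indep_iff, Set.image_image]
    rfl

end Matroid

theorem Matroid.finite_matroid (α : Type) [Finite α] : Finite (Matroid α) := by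
  refine Finite.of_injective (fun M : Matroid α => (M.E, {B | M.IsBase B})) fun M N h => ?_
  rw [Prod.mk.injEq] at h
  exact Matroid.ext_isBase h.1 fun B _ => by
    have := congrArg (B ∈ ·) h.2
    simpa using this

instance Matroid.instFinite (α : Type) [Finite α] : Finite (Matroid α) := Matroid.finite_matroid α


theorem Matroid.rankNat_mapEquiv {α β : Type} (M : Matroid α) (σ : α ≃ β) :
    (M.mapEquiv σ).rankNat = M.rankNat := by
  rw [Matroid.rankNat, Matroid.mapEquiv_eq_map, Matroid.eRank_map]; rfl

/-- The set of all quasi series-parallel matroids of rank `r` with ground set `[m]`, with its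
action of the symmetric group. -/
def quasiSeriesParallelOn (m : ℕ) (r : ℤ) :
    SubMulAction (Equiv.Perm (Fin m)) (Matroid (Fin m)) where
  carrier := {M | M.E = Set.univ ∧ M.IsQuasiSeriesParallel ∧ (M.rankNat : ℤ) = r}
  smul_mem' := by
    rintro σ M ⟨h1, h2, h3⟩
    refine ⟨?_, h2.mapEquiv σ, ?_⟩
    · change σ '' M.E = Set.univ
      rw [h1, Set.image_univ, σ.range_eq_univ]
    · exact (congrArg Nat.cast (M.rankNat_mapEquiv σ)).trans h3

/-- The set of all simple quasi series-parallel matroids of rank `r` with ground set `[m]`, with its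
action of the symmetric group. -/
def simpleQuasiSeriesParallelOn (m : ℕ) (r : ℤ) :
    SubMulAction (Equiv.Perm (Fin m)) (Matroid (Fin m)) where
  carrier := {M | M ∈ quasiSeriesParallelOn m r ∧ M.IsSimple}
  smul_mem' := fun σ _ h => ⟨(quasiSeriesParallelOn m r).smul_mem σ h.1, h.2.mapEquiv σ⟩

/-- The stabilizer of `v` in the symmetric group of `V` acts on the complement of `v`. -/
def stabilizerRestrict {V : Type} (v : V) :
    MulAction.stabilizer (Equiv.Perm V) v →* Equiv.Perm {x : V // x ≠ v} where
  toFun g := g.1.subtypePerm (p := fun x => x ≠ v) (fun x => by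
    have h : g.1 v = v := g.2
    exact not_congr ⟨fun hx => g.1.injective (hx.trans h.symm), fun hx => hx ▸ h⟩)
  map_one' := rfl
  map_mul' := fun _ _ => rfl

theorem stabilizerRestrict_bijective {V : Type} (v : V) :
    Function.Bijective (stabilizerRestrict v) := by
  classical
  constructor
  · intro g g' h
    ext x
    by_cases hx : x = v
    · rw [hx]
      exact (show g.1 v = v from g.2).trans (show g'.1 v = v from g'.2).symm
    · exact congrArg Subtype.val (Equiv.congr_fun h ⟨x, hx⟩)
  · intro σ
    refine ⟨⟨Equiv.Perm.ofSubtype σ, ?_⟩, ?_⟩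
    · exact Equiv.Perm.ofSubtype_apply_of_not_mem σ (by simp)
    · ext x
      exact Equiv.Perm.ofSubtype_apply_coe σ x

/-- The stabilizer of `v` in the symmetric group of `V`, identified with the symmetric group of
`W` by means of a bijection `e` from `V` without `v` to `W`: the permutation `g` corresponds to the
permutation `e ∘ g ∘ e⁻¹` of `W`. -/
noncomputable def stabilizerMulEquivPerm {V W : Type} (v : V) (e : {x : V // x ≠ v} ≃ W) :
    MulAction.stabilizer (Equiv.Perm V) v ≃* Equiv.Perm W :=
  (MulEquiv.ofBijective (stabilizerRestrict v) (stabilizerRestrict_bijective v)).trans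
    e.permCongrHom

theorem stabilizerMulEquivPerm_apply {V W : Type} (v : V) (e : {x : V // x ≠ v} ≃ W)
    (g : MulAction.stabilizer (Equiv.Perm V) v) (x : {x : V // x ≠ v}) :
    ((e.symm (stabilizerMulEquivPerm v e g (e x)) : {x : V // x ≠ v}) : V) = g.1 x := by
  simp [stabilizerMulEquivPerm, Equiv.permCongrHom, stabilizerRestrict]
  rfl

/-!
The flats of `K_n` are the set partitions of `[n]`. A quasi series-parallel matroid on `[n] \ {v}`
gives such a partition: its loops form a block together with `v`, and its parallel classes are the
other blocks. Conversely, it is determined by this partition and a simple quasi series-parallel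
matroid on the set of the blocks that do not contain `v`. So the permutation representation on all
quasi series-parallel matroids is the sum, over orbits of flats `F`, of representations induced from
the permutation representations on the simple ones on the blocks of `F`. This is the formula for the
`Z`-polynomial in terms of the Kazhdan-Lusztig polynomials of the contractions `K_n / F`, whose
simplification is the braid matroid on the blocks of `F`.

It remains to verify the conditions that characterize Kazhdan-Lusztig polynomials. The class of
quasi series-parallel matroids is closed under duality, so the `Z`-polynomials are palindromic. A
nonempty simple quasi series-parallel matroid has fewer than twice as many elements as its rank, so
the corank `i` is less than half the number of elements, which is the rank of `K_n / F`; this is the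
degree bound. The conditions determine the polynomials on any class of matroids with group action
that is closed under contraction of flats, such as the contractions `K_n / F` with a group that
preserves `F` and fixes `v`.

To avoid a change of ground set, a matroid on the blocks of `F` other than that of `v` is encoded as
a matroid on all vertices, in which `v` is a loop and the elements of a block of `F` are parallel to
each other or all loops (`IsPointed`). It is the pullback of its restriction to a set of
representatives, and duality is defined through this restriction (`dualAt`); it does not depend on
the representatives, and is therefore equivariant (`IsPointed.dualAt_smul`). The partition of a
pointed matroid is recovered as a flat of `K_n` by `edgeFlat`.

On the side of matroids, the quasi series-parallel ones are those that reduce to the empty matroid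
by removing loops, coloops, and elements of parallel or series pairs
(`Matroid.isQuasiSeriesParallel_iff`). Unlike the description by connected components, this is
visibly closed under duality. Induction on reductions gives closure under minors and the bound
`Matroid.SPReducible.ncard_lt`. The decomposition of permutation representations is
`VRep.permOn_eq_finsum_flatOrbit`, its consequence for the candidate polynomials is
`candidateKL_zPoly`, and the uniqueness statement is `PolyFamily.IsKL.eq_of_forall_mem`.
-/

/-! ### Permutation representations -/

namespace VRep
open Representation

section
variable {k : Type u} [Field k] {G H H' : Type} [Group G] [Group H] [Group H']

theorem perm_congr {φ : G →* H} {ψ : G →* H'} {X Y : Type} [MulAction H X] [Finite X]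
    [MulAction H' Y] [Finite Y] (e : X ≃ Y) (he : ∀ g x, e (φ g • x) = ψ g • e x) :
    perm k φ X = perm k ψ Y := by
  refine of_equiv (Representation.Equiv.mk (LinearEquiv.ofLinearMap
    (MonoidAlgebra.mapDomainLinearMap k k e) (MonoidAlgebra.mapDomainLinearMap k k e.symm)
    ?_ ?_) ?_)
  · ext; simp
  · ext; simp
  · intro g
    ext; simp [he]

theorem perm_of_isEmpty (φ : G →* H) (X : Type) [MulAction H X] [Finite X] [IsEmpty X] :
    perm k φ X = 0 := by
  let W : FinRep k G := ⟨_, MonoidHom.comp (ofMulAction k H X) φ⟩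
  have : Subsingleton W.V :=
    (MonoidAlgebra.coeffLinearEquiv (S := k) k).toEquiv.subsingleton (α := MonoidAlgebra k X)
  -- `W` is isomorphic to `W × W`, so its class is twice itself
  refine left_eq_add.1 (of_eq_add (U := W) (V := W) (W := W) ⟨?_⟩)
  exact Representation.Equiv.mk (LinearEquiv.ofLinearMap 0 0
    (LinearMap.ext fun x => Subsingleton.elim _ _) (LinearMap.ext fun x => Subsingleton.elim _ _))
    fun g => LinearMap.ext fun x => Subsingleton.elim _ _

theorem perm_of_unique (φ : G →* H) (X : Type) [MulAction H X] [Finite X] [Unique X] :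
    perm k φ X = triv k G := by
  refine of_equiv (Representation.Equiv.mk (LinearEquiv.ofLinearMap
    ((Finsupp.lift _ _ _ fun _ : X => (1 : k)) ∘ₗ
        (MonoidAlgebra.coeffLinearEquiv k).toLinearMap)
    (LinearMap.toSpanSingleton k _ (MonoidAlgebra.single default 1)) ?_ ?_) ?_)
  · ext; simp
  · ext x; simp [Unique.eq_default]
  · intro g
    ext; simp

theorem perm_sum {φ : G →* H} {X Y Z : Type} [MulAction H X] [Finite X]
    [MulAction H Y] [Finite Y] [MulAction H Z] [Finite Z] (e : Y ⊕ Z ≃ X)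
    (hl : ∀ (g : H) y, e (.inl (g • y)) = g • e (.inl y))
    (hr : ∀ (g : H) z, e (.inr (g • z)) = g • e (.inr z)) :
    perm k φ X = perm k φ Y + perm k φ Z := by
  refine of_eq_add (U := ⟨_, _⟩) (V := ⟨_, _⟩) (W := ⟨_, _⟩) ⟨Representation.Equiv.symm ?_⟩
  refine Representation.Equiv.mk (LinearEquiv.ofLinearMap
    ((MonoidAlgebra.mapDomainLinearMap k k fun y => e (.inl y)).coprod
      (MonoidAlgebra.mapDomainLinearMap k k fun z => e (.inr z)))
    ((Finsupp.lift _ _ _ fun x => Sum.elim (fun y => (MonoidAlgebra.single y (1 : k), 0))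
      (fun z => (0, MonoidAlgebra.single z (1 : k))) (e.symm x)) ∘ₗ
        (MonoidAlgebra.coeffLinearEquiv k).toLinearMap) ?_ ?_) ?_
  · ext x
    obtain ⟨y | z, rfl⟩ := e.surjective x <;> simp
  · ext x <;> simp
  · intro g
    ext x <;> simp [hl, hr]

/-- The representation induced from a permutation representation `Y` of `G` is the permutation
representation on any `H`-set `Z ≅ H ×_G Y`: `Y` sits in `Z`, meets every orbit, and two points of
`Y` are related by an element of `H` only if this element comes from `G`. -/
theorem ind_perm [Finite H] {φ : G →* H} {Y Z : Type} [MulAction G Y] [Finite Y]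
    [MulAction H Z] [Finite Z] (j : Y → Z) (hj : Function.Injective j)
    (hφ : ∀ g y, j (g • y) = φ g • j y) (hsurj : ∀ z, ∃ h : H, ∃ y, h • j y = z)
    (hstab : ∀ (h : H) y y', h • j y = j y' → ∃ g, φ g = h) :
    ind φ (perm k (MonoidHom.id G) Y) = perm k (MonoidHom.id H) Z := by
  have hfin : Module.Finite k (IndV φ (MonoidHom.comp (ofMulAction k G Y) (MonoidHom.id G))) :=
    finite_ind φ _
  rw [perm, ind_of]
  choose t y hty using hsurj
  refine of_equiv (Representation.Equiv.mk (LinearEquiv.ofLinearMap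
    (Coinvariants.lift _ (TensorProduct.lift <| (Finsupp.lift _ _ _ fun h : H =>
        MonoidAlgebra.mapDomainLinearMap k k fun y => h⁻¹ • j y) ∘ₗ
        (MonoidAlgebra.coeffLinearEquiv k).toLinearMap) ?_)
    ((Finsupp.lift _ _ _ fun z => IndV.mk φ _ (t z)⁻¹ (MonoidAlgebra.single (y z) (1 : k))) ∘ₗ
        (MonoidAlgebra.coeffLinearEquiv k).toLinearMap) ?_ ?_) ?_)
  · intro g
    ext h x
    simp [hφ, mul_smul]
  · ext z
    simp [hty]
  · -- `h ⊗ x` agrees in the coinvariants with the tensor chosen for the point `h⁻¹ • j x`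
    refine IndV.hom_ext _ _ fun h => MonoidAlgebra.lhom_ext' fun x => LinearMap.ext_ring ?_
    have h1 := hty (h⁻¹ • j x)
    obtain ⟨g, hg⟩ := hstab (h * t (h⁻¹ • j x)) (y (h⁻¹ • j x)) x (by rw [mul_smul, h1]; simp)
    have h2 : g • y (h⁻¹ • j x) = x := by
      apply hj
      rw [hφ, hg, mul_smul, h1, smul_inv_smul]
    have h3 : (t (h⁻¹ • j x))⁻¹ = (φ g)⁻¹ * h := by rw [hg]; simp
    have h4 : y (h⁻¹ • j x) = g⁻¹ • x := by rw [← h2, inv_smul_smul, h2]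
    have h5 := Coinvariants.mk_self_apply (Representation.tprod ((leftRegular k H).comp φ)
      (MonoidHom.comp (ofMulAction k G Y) (MonoidHom.id G))) g⁻¹
      (TensorProduct.tmul k (MonoidAlgebra.single h (1 : k)) (MonoidAlgebra.single x (1 : k)))
    simp at h5
    simp [h3, h4, h5]
  · intro h
    refine IndV.hom_ext _ _ fun h' => MonoidAlgebra.lhom_ext' fun x => LinearMap.ext_ring ?_
    simp [mul_smul]

end

section permOn
variable (k : Type u) [Field k] {G Ω Q : Type} [Group G] [MulAction G Ω]

/-- The largest `K`-invariant subset of `X`, with its action of `K`; this is `X` itself if `X` is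
`K`-invariant. -/
def invariantCore (K : Subgroup G) (X : Set Ω) : SubMulAction K Ω where
  carrier := {x | ∀ h : K, h • x ∈ X}
  smul_mem' := fun g x hx h => by
    rw [← mul_smul]
    exact hx _

theorem mem_invariantCore {K : Subgroup G} {X : Set Ω} (hX : ∀ g ∈ K, ∀ x ∈ X, g • x ∈ X) {x : Ω} :
    x ∈ invariantCore K X ↔ x ∈ X :=
  ⟨fun h => by simpa using h 1, fun h g => hX g g.2 x h⟩

/-- The class of the permutation representation of the subgroup `K` on a `K`-invariant subset `X` of
a `G`-set. (For a set `X` that is not `K`-invariant, its largest invariant subset is used.) -/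
noncomputable def permOn [Finite Ω] (K : Subgroup G) (X : Set Ω) : VRep k K :=
  perm k (MonoidHom.id K) (invariantCore K X)

variable {k} [Finite Ω]

theorem permOn_congr {Ω' : Type} [MulAction G Ω'] [Finite Ω'] {K : Subgroup G} {X : Set Ω}
    {Y : Set Ω'} (hX : ∀ g ∈ K, ∀ x ∈ X, g • x ∈ X) (hY : ∀ g ∈ K, ∀ x ∈ Y, g • x ∈ Y) (f : Ω → Ω')
    (hf : Set.BijOn f X Y) (heq : ∀ g ∈ K, ∀ x ∈ X, f (g • x) = g • f x) :
    permOn k K X = permOn k K Y := by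
  let e : invariantCore K X ≃ invariantCore K Y :=
    Equiv.ofBijective (fun x => ⟨f x.1, (mem_invariantCore hY).2
      (hf.mapsTo ((mem_invariantCore hX).1 x.2))⟩) <| by
      refine ⟨fun x y h => ?_, fun y => ?_⟩
      · exact Subtype.ext (hf.injOn ((mem_invariantCore hX).1 x.2) ((mem_invariantCore hX).1 y.2)
          (congrArg Subtype.val h))
      · obtain ⟨x, hx, e⟩ := hf.surjOn ((mem_invariantCore hY).1 y.2)
        exact ⟨⟨x, (mem_invariantCore hX).2 hx⟩, Subtype.ext e⟩
  exact perm_congr e fun g x => Subtype.ext (heq g g.2 x ((mem_invariantCore hX).1 x.2))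

theorem permOn_empty (K : Subgroup G) : permOn k K (∅ : Set Ω) = 0 := by
  have : IsEmpty (invariantCore K (∅ : Set Ω)) := ⟨fun x => x.2 1⟩
  exact perm_of_isEmpty _ _

theorem permOn_singleton (K : Subgroup G) (x : Ω) (hx : ∀ g ∈ K, g • x = x) :
    permOn k K {x} = triv k K := by
  have hX : ∀ g ∈ K, ∀ y ∈ ({x} : Set Ω), g • y ∈ ({x} : Set Ω) := by
    rintro g hg y rfl; exact hx g hg
  let : Unique (invariantCore K {x}) :=
    { default := ⟨x, (mem_invariantCore hX).2 rfl⟩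
      uniq := fun y => Subtype.ext ((mem_invariantCore hX).1 y.2) }
  exact perm_of_unique _ _

theorem permOn_union {K : Subgroup G} {X Y : Set Ω} (hX : ∀ g ∈ K, ∀ x ∈ X, g • x ∈ X)
    (hY : ∀ g ∈ K, ∀ x ∈ Y, g • x ∈ Y) (hXY : Disjoint X Y) :
    permOn k K (X ∪ Y) = permOn k K X + permOn k K Y := by
  have hU : ∀ g ∈ K, ∀ x ∈ X ∪ Y, g • x ∈ X ∪ Y := fun g hg x hx =>
    hx.imp (hX g hg x) (hY g hg x)
  let e : invariantCore K X ⊕ invariantCore K Y ≃ invariantCore K (X ∪ Y) :=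
    Equiv.ofBijective (Sum.elim
      (fun x => ⟨x.1, (mem_invariantCore hU).2 (.inl ((mem_invariantCore hX).1 x.2))⟩)
      (fun x => ⟨x.1, (mem_invariantCore hU).2 (.inr ((mem_invariantCore hY).1 x.2))⟩)) <| by
      constructor
      · rintro (x | x) (y | y) h
        · exact congrArg _ (Subtype.ext (congrArg Subtype.val h :))
        · refine (Set.disjoint_left.1 hXY ((mem_invariantCore hX).1 x.2) ?_).elim
          rw [show x.1 = y.1 from congrArg Subtype.val h]
          exact (mem_invariantCore hY).1 y.2
        · refine (Set.disjoint_left.1 hXY ((mem_invariantCore hX).1 y.2) ?_).elim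
          rw [show y.1 = x.1 from (congrArg Subtype.val h).symm]
          exact (mem_invariantCore hY).1 x.2
        · exact congrArg _ (Subtype.ext (congrArg Subtype.val h :))
      · rintro ⟨x, hx⟩
        rcases (mem_invariantCore hU).1 hx with h | h
        · exact ⟨.inl ⟨x, (mem_invariantCore hX).2 h⟩, rfl⟩
        · exact ⟨.inr ⟨x, (mem_invariantCore hY).2 h⟩, rfl⟩
  exact perm_sum e (fun _ _ => rfl) (fun _ _ => rfl)

theorem permOn_eq_finsum_fiber [Finite Q] {K : Subgroup G} {X : Set Ω}
    (hX : ∀ g ∈ K, ∀ x ∈ X, g • x ∈ X) (c : Ω → Q) (hc : ∀ g ∈ K, ∀ x ∈ X, c (g • x) = c x) :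
    permOn k K X = ∑ᶠ q, permOn k K {x ∈ X | c x = q} := by
  classical
  have := Fintype.ofFinite Q
  rw [finsum_eq_sum_of_fintype]
  have key : ∀ s : Finset Q, permOn k K {x ∈ X | c x ∈ s} =
      ∑ q ∈ s, permOn k K {x ∈ X | c x = q} := by
    intro s
    induction s using Finset.induction_on with
    | empty => simpa using permOn_empty K
    | insert q s hq ih =>
      rw [Finset.sum_insert hq, ← ih, ← permOn_union]
      · congr 1
        ext x
        simp only [Finset.mem_insert, Set.mem_ofPred_eq, Set.mem_union]
        tauto
      · exact fun g hg x hx => ⟨hX g hg x hx.1, (hc g hg x hx.1).trans hx.2⟩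
      · exact fun g hg x hx => ⟨hX g hg x hx.1, by rw [hc g hg x hx.1]; exact hx.2⟩
      · rw [Set.disjoint_left]
        rintro x ⟨-, rfl⟩ ⟨-, hx⟩
        exact hq hx
  simpa using key Finset.univ

/-- If `Y ⊆ X` meets every `K`-orbit of `X`, and an element of `K` that moves some point of `Y` to a
point of `Y` lies in `L`, then `X` is the `K`-set induced from the `L`-set `Y`. -/
theorem ind_permOn [Finite G] {K L : Subgroup G} (hL : L ≤ K) {X Y : Set Ω}
    (hX : ∀ g ∈ K, ∀ x ∈ X, g • x ∈ X) (hYX : Y ⊆ X) (hY : ∀ g ∈ L, ∀ x ∈ Y, g • x ∈ Y)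
    (hXY : ∀ x ∈ X, ∃ g ∈ K, ∃ y ∈ Y, g • y = x) (hK : ∀ g ∈ K, ∀ y ∈ Y, g • y ∈ Y → g ∈ L) :
    ind (Subgroup.inclusion hL) (permOn k L Y) = permOn k K X := by
  refine ind_perm (fun y => ⟨y.1, (mem_invariantCore hX).2 (hYX ((mem_invariantCore hY).1 y.2))⟩)
    ?_ ?_ ?_ ?_
  · intro y y' h
    exact Subtype.ext (congrArg Subtype.val h :)
  · intro g y; rfl
  · rintro ⟨x, hx⟩
    obtain ⟨g, hg, y, hy, e⟩ := hXY x ((mem_invariantCore hX).1 hx)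
    exact ⟨⟨g, hg⟩, ⟨y, (mem_invariantCore hY).2 hy⟩, Subtype.ext e⟩
  · intro h y y' e
    refine ⟨⟨h.1, hK h h.2 y.1 ((mem_invariantCore hY).1 y.2) ?_⟩, rfl⟩
    rw [show h.1 • y.1 = y'.1 from congrArg Subtype.val e]
    exact (mem_invariantCore hY).1 y'.2

/-- An invariant set `X` that maps equivariantly to the flats of `M` decomposes into pieces induced
from the stabilizers of flats. -/
theorem permOn_eq_finsum_flatOrbit [Finite G] {α : Type} [MulAction G α] [Finite α]
    {M : Matroid α} {K : Subgroup G} {X : Set Ω} (hX : ∀ g ∈ K, ∀ x ∈ X, g • x ∈ X)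
    (p : Ω → Set α) (hflat : ∀ x ∈ X, M.IsFlat (p x))
    (hp : ∀ g ∈ K, ∀ x ∈ X, p (g • x) = g • p x) :
    permOn k K X = ∑ᶠ q : M.FlatOrbit K,
      ind (Subgroup.inclusion (flatStabilizer_le K q.flat))
        (permOn k (flatStabilizer K q.flat) {x ∈ X | p x = q.flat}) := by
  classical
  have hE : M.IsFlat M.E := M.ground_isFlat
  -- the orbit of `p x`; the value at points outside `X` plays no role
  let c : Ω → M.FlatOrbit K := fun x =>
    if h : M.IsFlat (p x) then Matroid.FlatOrbit.mk K h else Matroid.FlatOrbit.mk K hE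
  have hc : ∀ x ∈ X, ∀ q : M.FlatOrbit K, c x = q ↔ ∃ g ∈ K, g • q.flat = p x := by
    intro x hx q
    have h1 : c x = Matroid.FlatOrbit.mk K (hflat x hx) := dif_pos (hflat x hx)
    rw [h1]
    constructor
    · rintro rfl
      exact Matroid.FlatOrbit.exists_smul_flat_mk K (hflat x hx)
    · rintro ⟨g, hg, e⟩
      rw [← Quotient.out_eq q]
      exact Quotient.sound ⟨g⁻¹, K.inv_mem hg, by
        change g⁻¹ • p x = q.flat; rw [← e, inv_smul_smul]⟩
  have hcK : ∀ g ∈ K, ∀ x ∈ X, c (g • x) = c x := by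
    intro g hg x hx
    rw [hc _ (hX g hg x hx)]
    obtain ⟨g', hg', e⟩ := (hc x hx _).1 rfl
    exact ⟨g * g', K.mul_mem hg hg', by rw [mul_smul, e, hp g hg x hx]⟩
  rw [permOn_eq_finsum_fiber hX c hcK]
  refine finsum_congr fun q => (ind_permOn _ ?_ ?_ ?_ ?_ ?_).symm
  · exact fun g hg x hx => ⟨hX g hg x hx.1, (hcK g hg x hx.1).trans hx.2⟩
  · rintro x ⟨hx, e⟩
    exact ⟨hx, (hc x hx q).2 ⟨1, K.one_mem, by rw [one_smul, e]⟩⟩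
  · rintro g ⟨hg, hgF⟩ x ⟨hx, e⟩
    exact ⟨hX g hg x hx, by rw [hp g hg x hx, e]; exact hgF⟩
  · rintro x ⟨hx, e⟩
    obtain ⟨g, hg, e'⟩ := (hc x hx q).1 e
    refine ⟨g, hg, g⁻¹ • x, ⟨hX _ (K.inv_mem hg) x hx, ?_⟩, smul_inv_smul _ _⟩
    rw [hp _ (K.inv_mem hg) x hx, ← e', inv_smul_smul]
  · rintro g hg y ⟨hy, e⟩ ⟨hy', e'⟩
    refine ⟨hg, ?_⟩
    rw [hp g hg y hy, e] at e'
    exact e'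

end permOn
end VRep

/-! ### Uniqueness of Kazhdan-Lusztig polynomials on a class closed under contraction -/

section
variable {k : Type u} [Field k] {G α : Type} [Group G] [Finite G] [MulAction G α] [Finite α]

/-- The `Z`-polynomial of `M` depends only on the polynomials of the contractions of `M`. -/
theorem PolyFamily.zPoly_congr (P Q : PolyFamily k G α) (H : Subgroup G) (M : Matroid α)
    (h : ∀ F, M.IsFlat F → ∀ i, P (flatStabilizer H F) (M ／ F) i =
      Q (flatStabilizer H F) (M ／ F) i) (i : ℕ) : P.zPoly H M i = Q.zPoly H M i := by
  refine finsum_congr fun q => ?_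
  unfold PolyFamily.flatTerm
  rw [h _ q.isFlat]

/-- The conditions of `PolyFamily.IsKL` determine the polynomials on any class of matroids with
group action that is closed under contraction of flats, even if they are only known on that class. -/
theorem PolyFamily.IsKL.eq_of_forall_mem {P Q : PolyFamily k G α} (hP : P.IsKL)
    (𝒞 : Subgroup G → Matroid α → Prop) (hl : ∀ H M, 𝒞 H M → M.Loopless)
    (hp : ∀ H M, 𝒞 H M → M.PreservedBy H)
    (hc : ∀ H M, 𝒞 H M → ∀ F, M.IsFlat F → 𝒞 (flatStabilizer H F) (M ／ F))
    (rank_zero : ∀ H M, 𝒞 H M → M.rankNat = 0 → ∀ i, Q H M i = if i = 0 then VRep.triv k H else 0)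
    (degree_lt : ∀ H M, 𝒞 H M → 0 < M.rankNat → ∀ i, M.rankNat ≤ 2 * i → Q H M i = 0)
    (palindromic : ∀ H M, 𝒞 H M → ∀ i j, i + j = M.rankNat → Q.zPoly H M i = Q.zPoly H M j)
    (H : Subgroup G) (M : Matroid α) (hM : 𝒞 H M) (i : ℕ) : P H M i = Q H M i := by
  induction hn : M.E.ncard using Nat.strong_induction_on generalizing H M i with
  | _ n ih =>
    subst hn
    rcases Nat.eq_zero_or_pos M.rankNat with h0 | h0
    · rw [hP.rank_zero H M (hl _ _ hM) (hp _ _ hM) h0, rank_zero H M hM h0]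
    rcases Nat.lt_or_ge (2 * i) M.rankNat with hi | hi
    · -- in complementary degrees, the polynomial of `M` contributes to only one coefficient of the
      -- palindromic `Z`-polynomial, and all other terms belong to proper contractions
      have hr := PolyFamily.rest_congr P Q H M (fun F hF hne i =>
        ih _ (Matroid.ncard_contract_lt hF hne) _ _ (hc _ _ hM F hF) i rfl)
      have e1 := hP.palindromic H M (hl _ _ hM) (hp _ _ hM) i (M.rankNat - i) (by omega)
      have e2 := palindromic H M hM i (M.rankNat - i) (by omega)
      rw [P.zPoly_eq H M (hl _ _ hM), P.zPoly_eq H M (hl _ _ hM), hP.degree_lt H M (hl _ _ hM)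
        (hp _ _ hM) h0 _ (by omega : _ ≤ 2 * (M.rankNat - i)), zero_add] at e1
      rw [Q.zPoly_eq H M (hl _ _ hM), Q.zPoly_eq H M (hl _ _ hM), degree_lt H M hM h0 _
        (by omega : _ ≤ 2 * (M.rankNat - i)), zero_add] at e2
      rw [eq_sub_of_add_eq e1, eq_sub_of_add_eq e2, hr, hr]
    · rw [hP.degree_lt H M (hl _ _ hM) (hp _ _ hM) h0 i hi, degree_lt H M hM h0 i hi]

end

/-! ### Series-parallel reductions and minors -/

namespace Matroid
variable {α β : Type} {M N : Matroid α} {e f x y : α} {C K X : Set α}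

/-- The matroids that can be reduced to the empty matroid by deleting loops and coloops, deleting an
element of a parallel pair, and contracting an element of a series pair. These are the quasi
series-parallel matroids on a finite ground set, see `isQuasiSeriesParallel_iff`. -/
inductive SPReducible {α : Type} : Matroid α → Prop
  | empty : SPReducible (emptyOn α)
  | loop (M : Matroid α) (e : α) (he : M.IsLoop e) (h : SPReducible (M ＼ {e})) : SPReducible M
  | coloop (M : Matroid α) (e : α) (he : M.IsColoop e) (h : SPReducible (M ＼ {e})) : SPReducible M
  | parallel (M : Matroid α) (e f : α) (hef : e ≠ f) (hC : M.IsCircuit {e, f})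
      (h : SPReducible (M ＼ {e})) : SPReducible M
  | series (M : Matroid α) (e f : α) (hef : e ≠ f) (hC : M.IsCocircuit {e, f})
      (h : SPReducible (M ／ {e})) : SPReducible M

theorem IsLoop.contract_eq_delete (he : M.IsLoop e) : M ／ {e} = M ＼ {e} :=
  contract_eq_delete_of_subset_loops (Set.singleton_subset_iff.2 he)

theorem IsColoop.contract_eq_delete (he : M.IsColoop e) : M ／ {e} = M ＼ {e} :=
  contract_eq_delete_of_subset_coloops (Set.singleton_subset_iff.2 he)

theorem SPReducible.dual (h : M.SPReducible) : M✶.SPReducible := by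
  induction h with
  | empty => rw [emptyOn_dual_eq]; exact .empty
  | loop M e he _ ih =>
    refine .coloop _ e he.dual_isColoop ?_
    rwa [← he.dual_isColoop.contract_eq_delete, ← dual_delete]
  | coloop M e he _ ih =>
    refine .loop _ e he.dual_isLoop ?_
    rwa [← he.dual_isLoop.contract_eq_delete, ← dual_delete]
  | parallel M e f hef hC _ ih =>
    refine .series _ e f hef hC.isCocircuit ?_
    rwa [← dual_delete]
  | series M e f hef hC _ ih =>
    refine .parallel _ e f hef hC ?_
    rwa [← dual_contract]

theorem isCircuit_pair_iff (hef : e ≠ f) :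
    M.IsCircuit {e, f} ↔ M.IsNonloop e ∧ M.closure {e} = M.closure {f} := by
  constructor
  · intro h
    have he := h.isNonloop_of_mem (Set.nontrivial_pair hef) (Set.mem_insert _ _)
    exact ⟨he, (he.closure_eq_closure_iff_isCircuit_of_ne hef).2 h⟩
  · rintro ⟨he, h⟩
    exact (he.closure_eq_closure_iff_isCircuit_of_ne hef).1 h

/-- Parallel elements may be exchanged. -/
theorem IsCircuit.mapEquiv_swap [DecidableEq α] (hef : e ≠ f) (hC : M.IsCircuit {e, f}) :
    M.mapEquiv (Equiv.swap e f) = M := by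
  have key : ∀ I, M.Indep I → M.Indep (Equiv.swap e f '' I) := by
    intro I hI
    obtain ⟨he, hcl⟩ := (isCircuit_pair_iff hef).1 hC
    have aux : ∀ a b : α, a ≠ b → M.closure {a} = M.closure {b} → M.IsNonloop a → M.IsNonloop b →
        a ∈ I → M.Indep (Equiv.swap a b '' I) := by
      intro a b hab hcl ha hb hI'
      have hbI : b ∉ I := by
        intro hb'
        refine ((isCircuit_pair_iff hab).2 ⟨ha, hcl⟩).not_indep (hI.subset ?_)
        rintro x (rfl | rfl) <;> assumption
      have e1 : Equiv.swap a b '' I = insert b (I \ {a}) := by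
        ext x
        rw [Equiv.image_eq_preimage_symm, Set.mem_preimage, Equiv.symm_swap]
        rcases eq_or_ne x a with rfl | hxa
        · simp [hbI, hab]
        rcases eq_or_ne x b with rfl | hxb
        · simp [hI']
        · rw [Equiv.swap_apply_of_ne_of_ne hxa hxb]; simp [hxa, hxb]
      rw [e1]
      have h2 : b ∉ M.closure (I \ {a}) := by
        intro hb'
        have h3 : a ∈ M.closure {b} := by
          rw [← hcl]; exact M.mem_closure_of_mem' rfl ha.mem_ground
        have h4 : a ∈ M.closure (I \ {a}) :=
          M.closure_subset_closure_of_subset_closure (Set.singleton_subset_iff.2 hb') h3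
        exact (hI.notMem_closure_sdiff_of_mem hI') h4
      exact ((hI.sdiff {a}).insert_indep_iff_of_notMem (by simp [hbI])).2 ⟨hb.mem_ground, h2⟩
    have hf : M.IsNonloop f := hC.isNonloop_of_mem (Set.nontrivial_pair hef) (by simp)
    by_cases heI : e ∈ I
    · exact aux e f hef hcl he hf heI
    by_cases hfI : f ∈ I
    · rw [Equiv.swap_comm]
      exact aux f e hef.symm hcl.symm hf he hfI
    · have : Equiv.swap e f '' I = I := by
        ext x
        rw [Equiv.image_eq_preimage_symm, Set.mem_preimage, Equiv.symm_swap]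
        rcases eq_or_ne x e with rfl | hxa
        · simp [heI, hfI]
        rcases eq_or_ne x f with rfl | hxb
        · simp [heI, hfI]
        rw [Equiv.swap_apply_of_ne_of_ne hxa hxb]
      rwa [this]
  have hE := hC.subset_ground
  refine ext_indep ?_ fun I _ => ?_
  · rw [mapEquiv_ground_eq]
    ext x
    rw [Equiv.image_eq_preimage_symm, Set.mem_preimage, Equiv.symm_swap]
    have he : e ∈ M.E := hE (by simp)
    have hf : f ∈ M.E := hE (by simp)
    rcases eq_or_ne x e with rfl | hxa
    · simp [he, hf]
    rcases eq_or_ne x f with rfl | hxb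
    · simp [he, hf]
    rw [Equiv.swap_apply_of_ne_of_ne hxa hxb]
  · rw [mapEquiv_indep_iff, Equiv.symm_swap]
    refine ⟨fun h => ?_, key I⟩
    have := key _ h
    rwa [Set.image_image, show (fun x => Equiv.swap e f (Equiv.swap e f x)) = id by ext; simp,
      Set.image_id] at this

section map
variable {g : α → β}

theorem map_delete (hg : Set.InjOn g M.E) (hX : X ⊆ M.E) :
    (M ＼ X).map g (hg.mono Set.sdiff_subset) = (M.map g hg) ＼ (g '' X) := by
  refine ext_indep ?_ fun I _ => ?_
  · simp only [map_ground, delete_ground]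
    exact (hg.image_sdiff_subset hX)
  · simp only [map_indep_iff, delete_indep_iff]
    constructor
    · rintro ⟨J, ⟨hJ, hd⟩, rfl⟩
      refine ⟨⟨J, hJ, rfl⟩, ?_⟩
      rw [Set.disjoint_left] at hd ⊢
      rintro _ ⟨a, ha, rfl⟩ ⟨b, hb, e⟩
      exact hd ha (hg (hX hb) (hJ.subset_ground ha) e ▸ hb)
    · rintro ⟨⟨J, hJ, rfl⟩, hd⟩
      exact ⟨J, ⟨hJ, hd.of_image⟩, rfl⟩

theorem map_contract (hg : Set.InjOn g M.E) (hX : X ⊆ M.E) :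
    (M ／ X).map g (hg.mono Set.sdiff_subset) = (M.map g hg) ／ (g '' X) := by
  have h := congrArg dual (map_delete (M := M✶) hg hX)
  rw [map_dual, ← map_dual (M := M)] at h
  exact h

theorem IsCircuit.map (hg : Set.InjOn g M.E) (hC : M.IsCircuit C) :
    (M.map g hg).IsCircuit (g '' C) := by
  rw [isCircuit_iff_forall_ssubset]
  constructor
  · rw [map_dep_iff]
    exact ⟨C, hC.dep, rfl⟩
  · intro I hI
    obtain ⟨J, hJ, rfl⟩ := Set.subset_image_iff.1 hI.subset
    refine (hC.ssubset_indep (hJ.ssubset_of_ne ?_)).map _ _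
    rintro rfl
    exact hI.ne rfl

theorem SPReducible.map (h : M.SPReducible) (hg : Set.InjOn g M.E) :
    (M.map g hg).SPReducible := by
  induction h with
  | empty => simpa using .empty
  | loop M e he _ ih =>
    refine .loop _ (g e) ((map_isLoop_iff he.mem_ground).2 he) ?_
    simpa [map_delete hg (Set.singleton_subset_iff.2 he.mem_ground)] using
      ih (hg.mono Set.sdiff_subset)
  | coloop M e he _ ih =>
    refine .coloop _ (g e) ?_ ?_
    · rw [← dual_isLoop_iff_isColoop, map_dual]
      exact (map_isLoop_iff (M := M✶) (hf := hg) he.mem_ground).2 he.dual_isLoop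
    simpa [map_delete hg (Set.singleton_subset_iff.2 he.mem_ground)] using
      ih (hg.mono Set.sdiff_subset)
  | parallel M e f hef hC _ ih =>
    have he : e ∈ M.E := hC.subset_ground (by simp)
    have hf : f ∈ M.E := hC.subset_ground (by simp)
    refine .parallel _ (g e) (g f) (hg.ne he hf hef) ?_ ?_
    · simpa [Set.image_pair] using hC.map hg
    simpa [map_delete hg (Set.singleton_subset_iff.2 he)] using
      ih (hg.mono Set.sdiff_subset)
  | series M e f hef hC _ ih =>
    have he : e ∈ M.E := hC.subset_ground (by simp)
    have hf : f ∈ M.E := hC.subset_ground (by simp)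
    refine .series _ (g e) (g f) (hg.ne he hf hef) ?_ ?_
    · rw [IsCocircuit, map_dual]
      simpa [Set.image_pair] using IsCircuit.map (M := M✶) hg hC
    simpa [map_contract hg (Set.singleton_subset_iff.2 he)] using
      ih (hg.mono Set.sdiff_subset)

end map

theorem SPReducible.mapEquiv (h : M.SPReducible) (σ : α ≃ β) : (M.mapEquiv σ).SPReducible :=
  h.map σ.injective.injOn

/-- The step for a loop in the proof of `SPReducible.delete_contract_singleton`. -/
theorem IsLoop.spReducible_minors (he : M.IsLoop e) (h : (M ＼ {e}).SPReducible)
    (ih : ∀ x, (M ＼ {e} ＼ {x}).SPReducible ∧ (M ＼ {e} ／ {x}).SPReducible) (x : α) :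
    (M ＼ {x}).SPReducible ∧ (M ／ {x}).SPReducible := by
  rcases eq_or_ne x e with rfl | hxe
  · rw [he.contract_eq_delete]
    exact ⟨h, h⟩
  · constructor
    · refine .loop _ e (delete_isLoop_iff.2 ⟨he, by simpa using hxe.symm⟩) ?_
      rw [delete_comm]
      exact (ih x).1
    · refine .loop _ e (contract_isLoop_iff_mem_closure.2
        ⟨he.mem_closure _, by simpa using hxe.symm⟩) ?_
      rw [contract_delete_comm _ (by simpa using hxe)]
      exact (ih x).2

/-- The step for a parallel pair `{e, f}` in the proof of `SPReducible.delete_contract_singleton`. -/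
theorem IsCircuit.spReducible_minors (hef : e ≠ f) (hC : M.IsCircuit {e, f})
    (h : (M ＼ {e}).SPReducible)
    (ih : ∀ x, (M ＼ {e} ＼ {x}).SPReducible ∧ (M ＼ {e} ／ {x}).SPReducible) (x : α) :
    (M ＼ {x}).SPReducible ∧ (M ／ {x}).SPReducible := by
  classical
  have he : e ∈ M.E := hC.subset_ground (by simp)
  have hf : f ∈ M.E := hC.subset_ground (by simp)
  obtain ⟨hne, hcl⟩ := (isCircuit_pair_iff hef).1 hC
  have hef' : e ∈ M.closure {f} := by rw [← hcl]; exact M.mem_closure_of_mem' rfl he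
  have hfe' : f ∈ M.closure {e} := by rw [hcl]; exact M.mem_closure_of_mem' rfl hf
  have l1 : (M ／ {e}).IsLoop f := contract_isLoop_iff_mem_closure.2 ⟨hfe', by simpa using hef.symm⟩
  have l2 : (M ／ {f}).IsLoop e := contract_isLoop_iff_mem_closure.2 ⟨hef', by simpa using hef⟩
  rcases eq_or_ne x e with rfl | hxe
  · refine ⟨h, .loop _ f l1 ?_⟩
    rw [← l1.contract_eq_delete, contract_comm, l2.contract_eq_delete,
      contract_delete_comm _ (by simpa using hef.symm)]
    exact (ih f).2
  rcases eq_or_ne x f with rfl | hxf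
  · constructor
    · have := h.mapEquiv (Equiv.swap e x)
      rw [mapEquiv_delete, hC.mapEquiv_swap hef] at this
      simpa using this
    · refine .loop _ e l2 ?_
      rw [contract_delete_comm _ (by simpa using hef.symm)]
      exact (ih x).2
  · constructor
    · refine .parallel _ e f hef ?_ ?_
      · rw [delete_isCircuit_iff]
        exact ⟨hC, by simp [hxe, hxf]⟩
      · rw [delete_comm]
        exact (ih x).1
    · have hd : (M ／ {x} ＼ {e}).SPReducible := by
        rw [contract_delete_comm _ (by simpa using hxe)]
        exact (ih x).2
      by_cases hex : e ∈ M.closure {x}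
      · exact .loop _ e (contract_isLoop_iff_mem_closure.2 ⟨hex, by simpa using hxe.symm⟩) hd
      · refine .parallel _ e f hef ?_ hd
        rw [isCircuit_pair_iff hef]
        refine ⟨contract_isNonloop_iff.2 ⟨he, hex⟩, ?_⟩
        have : ∀ z, M.closure ({z} ∪ {x}) = M.closure (M.closure {z} ∪ {x}) := by
          intro z; rw [closure_union_closure_left_eq]
        rw [contract_closure_eq, contract_closure_eq, this e, this f, hcl]

/-- Reducibility passes to minors. The steps for coloops and series pairs are dual to those for loops
and parallel pairs. -/
theorem SPReducible.delete_contract_singleton (h : M.SPReducible) (x : α) :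
    (M ＼ {x}).SPReducible ∧ (M ／ {x}).SPReducible := by
  have hdual : ∀ {N : Matroid α}, (∀ x, (N✶ ＼ {x}).SPReducible ∧ (N✶ ／ {x}).SPReducible) →
      ∀ x, (N ＼ {x}).SPReducible ∧ (N ／ {x}).SPReducible := by
    intro N hN x
    have h1 := (hN x).1.dual
    have h2 := (hN x).2.dual
    rw [dual_delete, dual_dual] at h1
    rw [dual_contract, dual_dual] at h2
    exact ⟨h2, h1⟩
  have hdual' : ∀ {N : Matroid α}, (∀ x, (N ＼ {x}).SPReducible ∧ (N ／ {x}).SPReducible) →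
      ∀ x, (N✶ ＼ {x}).SPReducible ∧ (N✶ ／ {x}).SPReducible := by
    intro N hN
    exact hdual (by simpa using hN)
  induction h generalizing x with
  | empty =>
    rw [deleteElem_eq_self (by simp), contractElem_eq_self (by simp)]
    exact ⟨.empty, .empty⟩
  | loop M e he h ih => exact he.spReducible_minors h ih x
  | coloop M e he h ih =>
    refine hdual (fun x => he.dual_isLoop.spReducible_minors ?_ ?_ x) x
    · rw [← dual_contract, he.contract_eq_delete]
      exact h.dual
    · rw [← dual_contract, he.contract_eq_delete]
      exact hdual' ih
  | parallel M e f hef hC h ih => exact hC.spReducible_minors hef h ih x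
  | series M e f hef hC h ih =>
    refine hdual (fun x => hC.isCircuit.spReducible_minors hef ?_ ?_ x) x
    · rw [← dual_contract]
      exact h.dual
    · rw [← dual_contract]
      exact hdual' ih

theorem SPReducible.delete (h : M.SPReducible) (hX : X.Finite) : (M ＼ X).SPReducible := by
  induction X, hX using Set.Finite.induction_on with
  | empty => simpa using h
  | @insert a s _ _ ih =>
    rw [Set.insert_eq, Set.union_comm, ← delete_delete]
    exact (ih.delete_contract_singleton a).1

theorem SPReducible.restrict [Finite α] (h : M.SPReducible) (hX : X ⊆ M.E) :
    (M ↾ X).SPReducible := by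
  rw [← delete_compl hX]
  exact h.delete (Set.toFinite _)

/-- Elements that are loops or parallel to a remaining element may be put back. -/
theorem SPReducible.of_delete {D : Set α} (hD : D.Finite)
    (h : ∀ e ∈ D, M.IsLoop e ∨ ∃ f ∉ D, M.IsCircuit {e, f}) (hM : (M ＼ D).SPReducible) :
    M.SPReducible := by
  induction D, hD using Set.Finite.induction_on generalizing M with
  | empty => simpa using hM
  | @insert a s ha _ ih =>
    have h1 : (M ＼ {a}).SPReducible := by
      refine ih (fun e he => ?_) (by rwa [delete_delete, ← Set.insert_eq])
      have hea : e ≠ a := fun h => ha (h ▸ he)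
      rcases h e (Set.mem_insert_of_mem _ he) with h2 | ⟨f, hf, h2⟩
      · exact Or.inl (delete_isLoop_iff.2 ⟨h2, hea⟩)
      · refine Or.inr ⟨f, fun h => hf (Set.mem_insert_of_mem _ h), ?_⟩
        rw [delete_isCircuit_iff]
        refine ⟨h2, ?_⟩
        have : f ≠ a := fun h => hf (h ▸ Set.mem_insert _ _)
        simp [hea, this, Ne.symm]
    rcases h a (Set.mem_insert _ _) with h2 | ⟨f, hf, h2⟩
    · exact .loop _ a h2 h1
    · exact .parallel _ a f (fun h => hf (h ▸ Set.mem_insert _ _)) h2 h1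

end Matroid

/-! ### Quasi series-parallel matroids are the reducible ones -/

namespace Matroid
variable {α β : Type} {M N : Matroid α} {e f x y : α} {C K X : Set α}

/-- Two elements form a series pair if and only if they lie in the same circuits, and in at least
one. -/
theorem isCocircuit_pair_iff (hef : e ≠ f) :
    M.IsCocircuit {e, f} ↔ (∃ C, M.IsCircuit C ∧ e ∈ C) ∧ ∀ C, M.IsCircuit C → (e ∈ C ↔ f ∈ C) := by
  constructor
  · intro h
    have hn : M✶.IsNonloop e :=
      IsCircuit.isNonloop_of_mem (M := M✶) h (Set.nontrivial_pair hef) (by simp)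
    constructor
    · obtain ⟨C, hC, he⟩ := exists_mem_isCircuit_of_not_isColoop (M := M) hn.mem_ground
        (fun hc => hc.dual_isLoop.not_isNonloop hn)
      exact ⟨C, hC, he⟩
    · intro C hC
      constructor
      · intro he
        by_contra hf
        refine hC.inter_isCocircuit_ne_singleton h (e := e) ?_
        ext x
        simp only [Set.mem_inter_iff, Set.mem_insert_iff, Set.mem_singleton_iff]
        constructor
        · rintro ⟨hx, rfl | rfl⟩
          · rfl
          · exact (hf hx).elim
        · rintro rfl; exact ⟨he, Or.inl rfl⟩
      · intro hf
        by_contra he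
        refine hC.inter_isCocircuit_ne_singleton h (e := f) ?_
        ext x
        simp only [Set.mem_inter_iff, Set.mem_insert_iff, Set.mem_singleton_iff]
        constructor
        · rintro ⟨hx, rfl | rfl⟩
          · exact (he hx).elim
          · rfl
        · rintro rfl; exact ⟨hf, Or.inr rfl⟩
  · rintro ⟨⟨C, hC, heC⟩, h⟩
    have hfC := (h C hC).1 heC
    have he : e ∈ M.E := hC.subset_ground heC
    have hf : f ∈ M.E := hC.subset_ground hfC
    have hne : M✶.IsNonloop e := by
      rw [← not_isLoop_iff (M := M✶) he, dual_isLoop_iff_isColoop]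
      exact hC.not_isColoop_of_mem heC
    have hnf : M✶.IsNonloop f := by
      rw [← not_isLoop_iff (M := M✶) hf, dual_isLoop_iff_isColoop]
      exact hC.not_isColoop_of_mem hfC
    rw [IsCocircuit, isCircuit_iff_dep_forall_sdiff_singleton_indep]
    have hsub : ({e, f} : Set α) ⊆ M.E := by rintro x (rfl | rfl) <;> assumption
    refine ⟨⟨fun hi => ?_, hsub⟩, ?_⟩
    · obtain ⟨B, hB, hBd⟩ := hi.exists_isBase_superset
      have hB' := hB.compl_isBase_of_dual
      have heB : e ∉ M.E \ B := fun h => h.2 (hBd (by simp))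
      have h1 := hB'.fundCircuit_isCircuit he heB
      have h2 := (h _ h1).1 (mem_fundCircuit _ _ _)
      rcases fundCircuit_subset_insert _ _ _ h2 with h3 | h3
      · exact hef h3.symm
      · exact h3.2 (hBd (by simp))
    · rintro x (rfl | rfl)
      · rw [Set.pair_sdiff_left hef]; exact hnf.indep
      · rw [Set.pair_sdiff_right hef]; exact hne.indep

theorem self_mem_component : e ∈ M.component e := Or.inl rfl

theorem mem_component_comm : e ∈ M.component f ↔ f ∈ M.component e :=
  or_congr eq_comm (exists_congr fun _ => and_congr_right fun _ => and_comm)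

theorem component_subset_ground (he : e ∈ M.E) : M.component e ⊆ M.E := by
  rintro x (rfl | ⟨C, hC, -, hx⟩)
  · exact he
  · exact hC.subset_ground hx

theorem component_congr (h : ∀ C, x ∈ C → (M.IsCircuit C ↔ N.IsCircuit C)) :
    M.component x = N.component x := by
  ext y
  refine or_congr Iff.rfl (exists_congr fun C => ?_)
  constructor
  · rintro ⟨h1, h2, h3⟩; exact ⟨(h C h2).1 h1, h2, h3⟩
  · rintro ⟨h1, h2, h3⟩; exact ⟨(h C h2).2 h1, h2, h3⟩

theorem restrict_delete_of_notMem (hK : K ⊆ M.E) (he : e ∉ K) : M ＼ {e} ↾ K = M ↾ K := by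
  rw [delete_eq_restrict, restrict_restrict_eq]
  exact fun x hx => ⟨hK hx, fun h => he (h ▸ hx)⟩

theorem IsCocircuit.isCircuit_contract_of_mem (hef : e ≠ f) (h : M.IsCocircuit {e, f})
    (hC : M.IsCircuit C) (he : e ∈ C) : (M ／ {e}).IsCircuit (C \ {e}) :=
  hC.contractElem_isCircuit ⟨e, he, f, (((isCocircuit_pair_iff hef).1 h).2 C hC).1 he, hef⟩ he

theorem IsCircuit.exists_isCircuit_of_contract_singleton (hC : (M ／ {e}).IsCircuit C) :
    ∃ C', M.IsCircuit C' ∧ C ⊆ C' ∧ C' ⊆ insert e C := by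
  obtain ⟨C', h1, h2, h3⟩ := hC.exists_subset_isCircuit_of_contract
  refine ⟨C', h1, h2, ?_⟩
  rwa [Set.union_singleton] at h3

theorem IsCocircuit.isCircuit_contract_of_notMem (hef : e ≠ f) (h : M.IsCocircuit {e, f})
    (hC : M.IsCircuit C) (he : e ∉ C) : (M ／ {e}).IsCircuit C := by
  have h1 : (M ／ {e}).Dep C := hC.contract_dep (by simpa using he)
  obtain ⟨D, hDC, hD⟩ := h1.exists_isCircuit_subset
  obtain ⟨C', hC', h2, h3⟩ := hD.exists_isCircuit_of_contract_singleton
  have h4 := ((isCocircuit_pair_iff hef).1 h).2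
  have heC' : e ∉ C' := by
    intro he'
    rcases h3 ((h4 _ hC').1 he') with h5 | h5
    · exact hef h5.symm
    · exact he ((h4 _ hC).2 (hDC h5))
  have h5 : C' ⊆ D := fun x hx => (h3 hx).resolve_left fun h => heC' (h ▸ hx)
  have h6 : C' = C := hC'.eq_of_subset_isCircuit hC (h5.trans hDC)
  rwa [← hDC.antisymm (h6 ▸ h5)]

/-- The components of `M` in terms of those of the contraction of an element of a series pair. -/
theorem IsCocircuit.mem_component_iff (hef : e ≠ f) (h : M.IsCocircuit {e, f}) (hx : x ≠ e)
    (hy : y ≠ e) : y ∈ M.component x ↔ y ∈ (M ／ {e}).component x := by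
  refine or_congr Iff.rfl ⟨?_, ?_⟩
  · rintro ⟨C, hC, hxC, hyC⟩
    by_cases he : e ∈ C
    · exact ⟨_, h.isCircuit_contract_of_mem hef hC he, ⟨hxC, hx⟩, ⟨hyC, hy⟩⟩
    · exact ⟨_, h.isCircuit_contract_of_notMem hef hC he, hxC, hyC⟩
  · rintro ⟨C, hC, hxC, hyC⟩
    obtain ⟨C', hC', h2, -⟩ := hC.exists_isCircuit_of_contract_singleton
    exact ⟨C', hC', h2 hxC, h2 hyC⟩

theorem IsCocircuit.mem_component_left_iff (hef : e ≠ f) (h : M.IsCocircuit {e, f}) (hx : x ≠ e) :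
    e ∈ M.component x ↔ f ∈ (M ／ {e}).component x := by
  rw [← h.mem_component_iff hef hx hef.symm]
  obtain ⟨⟨D, hD, heD⟩, h4⟩ := (isCocircuit_pair_iff hef).1 h
  constructor
  · rintro (rfl | ⟨C, hC, hxC, hyC⟩)
    · exact (hx rfl).elim
    · exact Or.inr ⟨C, hC, hxC, (h4 C hC).1 hyC⟩
  · rintro (rfl | ⟨C, hC, hxC, hyC⟩)
    · exact Or.inr ⟨D, hD, (h4 D hD).1 heD, heD⟩
    · exact Or.inr ⟨C, hC, hxC, (h4 C hC).2 hyC⟩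

/-- A component of `M` is a component of `M ／ {e}`, or a series extension of the one that contains the
other element `f` of the series pair. -/
theorem IsQuasiSeriesParallel.of_contract (hef : e ≠ f) (h : M.IsCocircuit {e, f})
    (hM : (M ／ {e}).IsQuasiSeriesParallel) : M.IsQuasiSeriesParallel := by
  obtain ⟨⟨D, hD, heD⟩, h4⟩ := (isCocircuit_pair_iff hef).1 h
  have he : e ∈ M.E := h.subset_ground (by simp)
  have hf : f ∈ M.E := h.subset_ground (by simp)
  have key : ∀ x ∈ M.E, x ≠ e → (M ↾ M.component x).IsSeriesParallel := by
    intro x hx hxe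
    have hsp := hM x ⟨hx, hxe⟩
    have hKE := component_subset_ground hx
    have heK : e ∉ (M ／ {e}).component x := fun h' =>
      (component_subset_ground (M := M ／ {e}) (e := x) ⟨hx, hxe⟩ h').2 rfl
    by_cases hfK : f ∈ (M ／ {e}).component x
    · have e1 : M.component x \ {e} = (M ／ {e}).component x := by
        ext y
        by_cases hy : y = e
        · subst hy; simp [heK]
        · rw [← h.mem_component_iff hef hxe hy]; simp [hy]
      have heM := (h.mem_component_left_iff hef hxe).2 hfK
      have hfM := (h.mem_component_iff hef hxe hef.symm).2 hfK
      refine .series _ e f hef ?_ ?_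
      · rw [isCocircuit_pair_iff hef]
        constructor
        · have : ∃ C, M.IsCircuit C ∧ x ∈ C ∧ e ∈ C := by
            rcases heM with rfl | hC
            · exact (hxe rfl).elim
            · exact hC
          obtain ⟨C, hC, hxC, heC⟩ := this
          refine ⟨C, ?_, heC⟩
          rw [restrict_isCircuit_iff hKE]
          exact ⟨hC, fun y hy => Or.inr ⟨C, hC, hxC, hy⟩⟩
        · intro C hC
          rw [restrict_isCircuit_iff hKE] at hC
          exact h4 C hC.1
      · rw [restrict_contract_eq_contract_restrict _ (Set.singleton_subset_iff.2 heM), e1]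
        exact hsp
    · have e1 : M.component x = (M ／ {e}).component x := by
        ext y
        by_cases hy : y = e
        · subst hy
          rw [h.mem_component_left_iff hef hxe]
          simp [heK, hfK]
        · exact h.mem_component_iff hef hxe hy
      rw [e1] at hKE ⊢
      have e2 : M ↾ (M ／ {e}).component x = (M ／ {e}) ↾ (M ／ {e}).component x := by
        refine ext_indep rfl fun I hI => ?_
        have hI : I ⊆ (M ／ {e}).component x := hI
        simp only [restrict_indep_iff, hI, and_true]
        have hne : M.IsNonloop e := hD.isNonloop_of_mem ⟨e, heD, f, (h4 D hD).1 heD, hef⟩ heD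
        rw [hne.contractElem_indep_iff]
        refine ⟨fun hi => ⟨fun h' => heK (hI h'), ?_⟩, fun hi => hi.2.subset (Set.subset_insert _ _)⟩
        by_contra hdep
        obtain ⟨C, hCI, hC⟩ := Dep.exists_isCircuit_subset (M := M) (X := insert e I)
          ⟨hdep, Set.insert_subset he (hI.trans hKE)⟩
        have heC : e ∈ C := by
          by_contra heC
          exact hC.not_indep (hi.subset fun y hy => (hCI hy).resolve_left fun h => heC (h ▸ hy))
        rcases hCI ((h4 C hC).1 heC) with h5 | h5
        · exact hef h5.symm
        · exact hfK (hI h5)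
      rw [e2]
      exact hsp
  intro x hx
  rcases eq_or_ne x e with rfl | hxe
  · have : M.component x = M.component f := by
      have hfx : f ∈ M.component x := Or.inr ⟨D, hD, heD, (h4 D hD).1 heD⟩
      have hxf : x ∈ M.component f := mem_component_comm.1 hfx
      ext y
      constructor
      · rintro (rfl | ⟨C, hC, h1, h2⟩)
        · exact hxf
        · exact Or.inr ⟨C, hC, (h4 C hC).1 h1, h2⟩
      · rintro (rfl | ⟨C, hC, h1, h2⟩)
        · exact hfx
        · exact Or.inr ⟨C, hC, (h4 C hC).2 h1, h2⟩
    rw [this]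
    exact key f hf hef.symm
  · exact key x hx hxe

/-- The components of `M` in terms of those of the deletion of an element of a parallel pair. -/
theorem IsCircuit.mem_component_iff (hef : e ≠ f) (h : M.IsCircuit {e, f}) (hx : x ≠ e)
    (hy : y ≠ e) : y ∈ M.component x ↔ y ∈ (M ＼ {e}).component x := by
  classical
  refine or_congr_right' fun hyx => ⟨?_, ?_⟩
  · rintro ⟨C, hC, hxC, hyC⟩
    by_cases he : e ∈ C
    · by_cases hf : f ∈ C
      · have hCe : {e, f} = C := h.eq_of_subset_isCircuit hC
          (by rintro z (rfl | rfl) <;> assumption)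
        subst hCe
        exact (hyx ((hyC.resolve_left hy).trans (hxC.resolve_left hx).symm)).elim
      · have hxf : x ≠ f := fun h => hf (h ▸ hxC)
        have hyf : y ≠ f := fun h => hf (h ▸ hyC)
        have := hC.mapEquiv (Equiv.swap e f)
        rw [h.mapEquiv_swap hef] at this
        refine ⟨_, delete_isCircuit_iff.2 ⟨this, ?_⟩, ⟨x, hxC, Equiv.swap_apply_of_ne_of_ne hx hxf⟩,
          ⟨y, hyC, Equiv.swap_apply_of_ne_of_ne hy hyf⟩⟩
        rw [Set.disjoint_singleton_right]
        rintro ⟨z, hz, hze⟩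
        rw [Equiv.swap_apply_eq_iff, Equiv.swap_apply_left] at hze
        exact hf (hze ▸ hz)
    · exact ⟨C, delete_isCircuit_iff.2 ⟨hC, by simpa using he⟩, hxC, hyC⟩
  · rintro ⟨C, hC, hxC, hyC⟩
    exact ⟨C, hC.of_delete, hxC, hyC⟩

theorem IsCircuit.mem_component_left_iff (hef : e ≠ f) (h : M.IsCircuit {e, f}) (hx : x ≠ e) :
    e ∈ M.component x ↔ f ∈ (M ＼ {e}).component x := by
  classical
  rw [← h.mem_component_iff hef hx hef.symm]
  rcases eq_or_ne x f with rfl | hxf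
  · exact iff_of_true (Or.inr ⟨_, h, by simp, by simp⟩) self_mem_component
  have := component_mapEquiv M (Equiv.swap e f) x
  rw [h.mapEquiv_swap hef, Equiv.swap_apply_of_ne_of_ne hx hxf] at this
  conv_rhs => rw [this]
  rw [Equiv.image_eq_preimage_symm]
  simp

/-- A component of `M` is a component of `M ＼ {e}`, or a parallel extension of the one that contains
the other element `f` of the parallel pair. -/
theorem IsQuasiSeriesParallel.of_delete (hef : e ≠ f) (h : M.IsCircuit {e, f})
    (hM : (M ＼ {e}).IsQuasiSeriesParallel) : M.IsQuasiSeriesParallel := by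
  classical
  have he : e ∈ M.E := h.subset_ground (by simp)
  have hf : f ∈ M.E := h.subset_ground (by simp)
  have key : ∀ x ∈ M.E, x ≠ e → (M ↾ M.component x).IsSeriesParallel := by
    intro x hx hxe
    have hsp := hM x ⟨hx, hxe⟩
    have hKE := component_subset_ground hx
    have heK : e ∉ (M ＼ {e}).component x := fun h' =>
      (component_subset_ground (M := M ＼ {e}) (e := x) ⟨hx, hxe⟩ h').2 rfl
    have e1 : M.component x \ {e} = (M ＼ {e}).component x := by
      ext y
      by_cases hy : y = e
      · subst hy; simp [heK]
      · rw [← h.mem_component_iff hef hxe hy]; simp [hy]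
    have e2 : M ＼ {e} ↾ (M ＼ {e}).component x = M ↾ (M ＼ {e}).component x :=
      restrict_delete_of_notMem (e1 ▸ Set.sdiff_subset.trans hKE) heK
    rw [e2] at hsp
    by_cases hfK : f ∈ (M ＼ {e}).component x
    · have heM := (h.mem_component_left_iff hef hxe).2 hfK
      have hfM := (h.mem_component_iff hef hxe hef.symm).2 hfK
      refine .parallel _ e f hef ?_ ?_
      · rw [restrict_isCircuit_iff hKE]
        exact ⟨h, by rintro z (rfl | rfl) <;> assumption⟩
      · rwa [delete_eq_restrict, restrict_ground_eq, restrict_restrict_eq _ Set.sdiff_subset, e1]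
    · have heM : e ∉ M.component x := fun h' => hfK ((h.mem_component_left_iff hef hxe).1 h')
      rwa [← e1, Set.sdiff_singleton_eq_self heM] at hsp
  intro x hx
  rcases eq_or_ne x e with rfl | hxe
  · have : M.component x = M.component f := by
      have hfx : f ∈ M.component x := Or.inr ⟨_, h, by simp, by simp⟩
      have hxf : x ∈ M.component f := mem_component_comm.1 hfx
      have := component_mapEquiv M (Equiv.swap x f) f
      rw [h.mapEquiv_swap hef, Equiv.swap_apply_right] at this
      rw [this]
      ext y
      rw [Equiv.image_eq_preimage_symm, Set.mem_preimage, Equiv.symm_swap]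
      rcases eq_or_ne y x with rfl | hyx
      · simp [self_mem_component, hxf]
      rcases eq_or_ne y f with rfl | hyf
      · simp [self_mem_component, hxf]
      rw [Equiv.swap_apply_of_ne_of_ne hyx hyf]
    rw [this]
    exact key f hf hef.symm
  · exact key x hx hxe

theorem SPReducible.isQuasiSeriesParallel (h : M.SPReducible) : M.IsQuasiSeriesParallel := by
  -- an element that is a component by itself may be added
  have aux : ∀ (M : Matroid α) (e : α), (∀ C, M.IsCircuit C → e ∈ C → C = {e}) →
      (M ↾ {e}).IsSeriesParallel → (M ＼ {e}).IsQuasiSeriesParallel →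
      M.IsQuasiSeriesParallel := by
    intro M e hC he hM x hx
    rcases eq_or_ne x e with rfl | hxe
    · have : M.component x = {x} := by
        refine Set.Subset.antisymm ?_ (by simpa using self_mem_component)
        rintro y (rfl | ⟨C, hC', h1, h2⟩)
        · rfl
        · rwa [hC C hC' h1] at h2
      rwa [this]
    · have h1 : M.component x = (M ＼ {e}).component x := by
        refine component_congr fun C hxC => ?_
        rw [delete_isCircuit_iff, Set.disjoint_singleton_right]
        refine ⟨fun h => ⟨h, fun heC => hxe ?_⟩, And.left⟩
        rwa [hC C h heC] at hxC
      have heK : e ∉ M.component x := by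
        rw [h1]
        exact fun h' => (component_subset_ground (M := M ＼ {e}) (e := x) ⟨hx, hxe⟩ h').2 rfl
      have := hM x ⟨hx, hxe⟩
      rwa [← h1, restrict_delete_of_notMem (component_subset_ground hx) heK] at this
  induction h with
  | empty => exact fun e he => he.elim
  | loop M e he _ ih =>
    refine aux M e (fun C hC h => he.eq_of_isCircuit_mem hC h) ?_ ih
    rw [restrict_subset_loops_eq (Set.singleton_subset_iff.2 he)]
    exact .loop e
  | coloop M e he _ ih =>
    refine aux M e (fun C hC h => (he.notMem_isCircuit hC h).elim) ?_ ih
    rw [he.isNonloop.indep.restrict_eq_freeOn]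
    exact .coloop e
  | parallel M e f hef hC _ ih => exact .of_delete hef hC ih
  | series M e f hef hC _ ih => exact .of_contract hef hC ih

/-- Series-parallel matroids are connected. -/
theorem IsSeriesParallel.mem_component (h : M.IsSeriesParallel) (hx : x ∈ M.E) (hy : y ∈ M.E) :
    y ∈ M.component x := by
  induction h generalizing x y with
  | loop e => exact Or.inl (Eq.trans hy (Eq.symm hx))
  | coloop e => exact Or.inl (Eq.trans hy (Eq.symm hx))
  | parallel M e f hef hC _ ih =>
    have hf : f ∈ M.E := hC.subset_ground (by simp)
    have key : ∀ z ∈ M.E, z ≠ e → e ∈ M.component z := fun z hz hze =>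
      (hC.mem_component_left_iff hef hze).2 (ih ⟨hz, hze⟩ ⟨hf, hef.symm⟩)
    rcases eq_or_ne x e with rfl | hxe
    · rcases eq_or_ne y x with rfl | hyx
      · exact self_mem_component
      · exact mem_component_comm.1 (key y hy hyx)
    rcases eq_or_ne y e with rfl | hye
    · exact key x hx hxe
    exact (hC.mem_component_iff hef hxe hye).2 (ih ⟨hx, hxe⟩ ⟨hy, hye⟩)
  | series M e f hef hC _ ih =>
    have hf : f ∈ M.E := hC.subset_ground (by simp)
    have key : ∀ z ∈ M.E, z ≠ e → e ∈ M.component z := fun z hz hze =>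
      (hC.mem_component_left_iff hef hze).2 (ih ⟨hz, hze⟩ ⟨hf, hef.symm⟩)
    rcases eq_or_ne x e with rfl | hxe
    · rcases eq_or_ne y x with rfl | hyx
      · exact self_mem_component
      · exact mem_component_comm.1 (key y hy hyx)
    rcases eq_or_ne y e with rfl | hye
    · exact key x hx hxe
    exact (hC.mem_component_iff hef hxe hye).2 (ih ⟨hx, hxe⟩ ⟨hy, hye⟩)

/-- A matroid is reducible if a series-parallel direct summand and its complement are. -/
theorem IsSeriesParallel.spReducible_of_separator (hN : N.IsSeriesParallel) (hE : N.E ⊆ M.E)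
    (hM : M ↾ N.E = N) (hsep : ∀ C, M.IsCircuit C → C ⊆ N.E ∨ Disjoint C N.E)
    (h : (M ＼ N.E).SPReducible) : M.SPReducible := by
  induction hN generalizing M with
  | loop e =>
    refine .loop _ e ?_ h
    have : (M ↾ {e}).IsLoop e := by
      rw [show M ↾ {e} = loopyOn {e} from hM]; simp
    exact this.of_isRestriction (restrict_isRestriction M _ hE)
  | coloop e =>
    have he : e ∈ M.E := hE rfl
    refine .coloop _ e ?_ h
    rw [isColoop_iff_forall_notMem_isCircuit he]
    intro C hC heC
    have h1 : C ⊆ {e} := (hsep C hC).resolve_right fun hd => Set.disjoint_left.1 hd heC rfl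
    have h2 : (M ↾ {e}).Indep {e} := by
      rw [show M ↾ {e} = freeOn {e} from hM]; simp
    exact hC.not_indep (h2.of_restrict.subset h1)
  | parallel N e f hef hC _ ih =>
    have heN : e ∈ N.E := hC.subset_ground (by simp)
    have hCM : M.IsCircuit {e, f} := by
      rw [← hM, restrict_isCircuit_iff hE] at hC
      exact hC.1
    refine .parallel _ e f hef hCM (ih ?_ ?_ ?_ ?_)
    · exact Set.sdiff_subset_sdiff_left hE
    · conv_rhs => rw [← hM]
      rw [delete_ground, delete_eq_restrict, delete_eq_restrict, restrict_ground_eq,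
        restrict_restrict_eq _ (Set.sdiff_subset_sdiff_left hE),
        restrict_restrict_eq _ Set.sdiff_subset]
    · intro C hC
      rw [delete_isCircuit_iff, Set.disjoint_singleton_right] at hC
      refine (hsep C hC.1).imp (fun h x hx => ⟨h hx, fun h' => hC.2 (h' ▸ hx)⟩) fun h => ?_
      exact h.mono_right Set.sdiff_subset
    · rw [delete_ground, delete_delete, Set.union_sdiff_cancel (Set.singleton_subset_iff.2 heN)]
      exact h
  | series N e f hef hC _ ih =>
    have heN : e ∈ N.E := hC.subset_ground (by simp)
    have hfN : f ∈ N.E := hC.subset_ground (by simp)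
    obtain ⟨⟨D, hD, heD⟩, h4⟩ := (isCocircuit_pair_iff hef).1 hC
    have h4' : ∀ C, M.IsCircuit C → (e ∈ C ↔ f ∈ C) := by
      intro C hC
      rcases hsep C hC with h1 | h1
      · exact h4 C (by rw [← hM, restrict_isCircuit_iff hE]; exact ⟨hC, h1⟩)
      · exact iff_of_false (fun h => Set.disjoint_left.1 h1 h heN)
          (fun h => Set.disjoint_left.1 h1 h hfN)
    have hCM : M.IsCocircuit {e, f} := by
      rw [isCocircuit_pair_iff hef]
      refine ⟨⟨D, ?_, heD⟩, h4'⟩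
      rw [← hM, restrict_isCircuit_iff hE] at hD
      exact hD.1
    refine .series _ e f hef hCM (ih ?_ ?_ ?_ ?_)
    · exact Set.sdiff_subset_sdiff_left hE
    · conv_rhs => rw [← hM]
      rw [contract_ground, restrict_contract_eq_contract_restrict _
        (Set.singleton_subset_iff.2 heN)]
    · intro C hC
      obtain ⟨C', hC', h1, h2⟩ := hC.exists_isCircuit_of_contract_singleton
      refine (hsep C' hC').imp (fun h x hx => ⟨h (h1 hx), (hC.subset_ground hx).2⟩) fun h => ?_
      exact h.mono h1 Set.sdiff_subset
    · have hcol : (M ＼ (N.E \ {e})).IsColoop e := by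
        have heE : e ∈ (M ＼ (N.E \ {e})).E := ⟨hE heN, fun h => h.2 rfl⟩
        rw [isColoop_iff_forall_notMem_isCircuit heE]
        intro C hC heC
        rw [delete_isCircuit_iff] at hC
        exact Set.disjoint_left.1 hC.2 ((h4' C hC.1).1 heC) ⟨hfN, hef.symm⟩
      rw [contract_ground, contract_delete_comm _ Set.disjoint_sdiff_right,
        hcol.contract_eq_delete, delete_delete,
        Set.sdiff_union_of_subset (Set.singleton_subset_iff.2 heN)]
      exact h

theorem IsQuasiSeriesParallel.spReducible [Finite α] (hM : M.IsQuasiSeriesParallel) :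
    M.SPReducible := by
  induction hn : M.E.ncard using Nat.strong_induction_on generalizing M with
  | _ n ih =>
    subst hn
    rcases M.E.eq_empty_or_nonempty with h0 | ⟨e, he⟩
    · rw [ground_eq_empty_iff] at h0
      subst h0
      exact .empty
    have hKE := component_subset_ground he
    -- components are classes of an equivalence relation, as series-parallel matroids are connected
    have hsep : ∀ C, M.IsCircuit C → C ⊆ M.component e ∨ Disjoint C (M.component e) := by
      intro C hC
      rw [or_iff_not_imp_right]
      intro hd y hy
      obtain ⟨z, hzC, hze⟩ := Set.not_disjoint_iff.1 hd
      have hzE := hC.subset_ground hzC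
      have h1 : e ∈ M.component z := mem_component_comm.1 hze
      have h2 : y ∈ M.component z := Or.inr ⟨C, hC, hzC, hy⟩
      rcases (hM z hzE).mem_component h1 h2 with rfl | ⟨D, hD, heD, hyD⟩
      · exact self_mem_component
      · rw [restrict_isCircuit_iff (component_subset_ground hzE)] at hD
        exact Or.inr ⟨D, hD.1, heD, hyD⟩
    refine (hM e he).spReducible_of_separator hKE rfl hsep (ih _ ?_ ?_ rfl)
    · refine Set.ncard_lt_ncard ?_ (Set.toFinite _)
      exact ⟨Set.sdiff_subset, fun h => (h he).2 self_mem_component⟩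
    · rintro x ⟨hx, hxe⟩
      have hxe : x ∉ M.component e := hxe
      have h1 : M.component x = (M ＼ M.component e).component x := by
        refine component_congr fun C hxC => ?_
        rw [delete_isCircuit_iff]
        exact ⟨fun h => ⟨h, (hsep C h).resolve_left fun h' => hxe (h' hxC)⟩, And.left⟩
      have h2 : (M ＼ M.component e).component x ⊆ M.E \ M.component e :=
        component_subset_ground (M := M ＼ M.component e) ⟨hx, hxe⟩
      change ((M ＼ M.component e) ↾ (M ＼ M.component e).component x).IsSeriesParallel
      rw [← h1] at h2 ⊢
      rw [delete_eq_restrict, restrict_restrict_eq _ h2]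
      exact hM x hx

theorem isQuasiSeriesParallel_iff [Finite α] : M.IsQuasiSeriesParallel ↔ M.SPReducible :=
  ⟨fun h => h.spReducible, fun h => h.isQuasiSeriesParallel⟩

theorem rankNat_contract_of_isNonloop [Finite α] (he : M.IsNonloop e) :
    1 + (M ／ {e}).rankNat = M.rankNat := by
  rw [← M.rkNat_add_rankNat_contract {e} (Set.singleton_subset_iff.2 he.mem_ground)]
  congr 1
  rw [rkNat, he.indep.eRk_eq_encard]
  simp

/-- A nonempty simple quasi series-parallel matroid has fewer than twice as many elements as its
rank. -/
theorem SPReducible.ncard_lt [Finite α] (hM : M.SPReducible)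
    (hs : ∀ C, M.IsCircuit C → 2 < C.ncard) (hne : M.E.Nonempty) : M.E.ncard < 2 * M.rankNat := by
  induction hn : M.E.ncard using Nat.strong_induction_on generalizing M with
  | _ n ih =>
    subst hn
    have h3 : ∀ (e f : α), ({e, f} : Set α).ncard ≤ 2 := fun e f => by
      simpa using Set.ncard_insert_le e {f}
    cases hM with
    | empty => simp at hne
    | loop _ e he h =>
      have := hs _ (singleton_isCircuit.2 he)
      simp at this
    | coloop _ e he h =>
      have h1 := rankNat_contract_of_isNonloop he.isNonloop
      rw [he.contract_eq_delete] at h1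
      have h2 := Set.ncard_sdiff_singleton_add_one he.mem_ground
      rcases (M.E \ {e}).eq_empty_or_nonempty with h0 | h0
      · rw [h0, Set.ncard_empty] at h2
        omega
      · have := ih _ (by rw [delete_ground]; omega) h
          (fun C hC => hs C hC.of_delete) h0 rfl
        rw [delete_ground] at this
        omega
    | parallel _ e f hef hC h =>
      have := hs _ hC
      have := h3 e f
      omega
    | series _ e f hef hC h =>
      obtain ⟨⟨D, hD, heD⟩, h4⟩ := (isCocircuit_pair_iff hef).1 hC
      have heE := hD.subset_ground heD
      have hfE := hD.subset_ground ((h4 D hD).1 heD)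
      have hnl : M.IsNonloop e := hD.isNonloop_of_mem ⟨e, heD, f, (h4 D hD).1 heD, hef⟩ heD
      have h1 := rankNat_contract_of_isNonloop hnl
      have h2 := Set.ncard_sdiff_singleton_add_one heE
      have h2' := Set.ncard_sdiff_singleton_add_one (s := M.E \ {e}) ⟨hfE, hef.symm⟩
      -- `M ／ {e}` need not be simple, but its circuits that avoid `f` are circuits of `M`
      have hcirc : ∀ C, (M ／ {e} ＼ {f}).IsCircuit C → 2 < C.ncard := by
        intro C hC
        rw [delete_isCircuit_iff, Set.disjoint_singleton_right] at hC
        obtain ⟨C', hC', h5, h6⟩ := hC.1.exists_isCircuit_of_contract_singleton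
        have heC' : e ∉ C' := by
          intro he'
          rcases h6 ((h4 _ hC').1 he') with h7 | h7
          · exact hef h7.symm
          · exact hC.2 h7
        rw [h5.antisymm fun x hx => (h6 hx).resolve_left fun h => heC' (h ▸ hx)]
        exact hs _ hC'
      have hrk : (M ／ {e} ＼ {f}).rankNat ≤ (M ／ {e}).rankNat := by
        refine ENat.toNat_le_toNat ?_ ?_
        · rw [delete_eq_restrict, eRank_restrict]
          exact eRk_le_eRank _ _
        · rw [eRank_def]
          exact ((eRk_le_encard _ _).trans_lt (Set.toFinite _).encard_lt_top).ne
      rcases ((M.E \ {e}) \ {f}).eq_empty_or_nonempty with h0 | h0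
      · -- here `M.E = {e, f}`, and this set would be a circuit
        have h5 : M.E ⊆ {e, f} := by
          intro x hx
          by_contra hx'
          simp only [Set.mem_insert_iff, Set.mem_singleton_iff, not_or] at hx'
          have : x ∈ (M.E \ {e}) \ {f} := ⟨⟨hx, hx'.1⟩, hx'.2⟩
          rw [h0] at this
          exact this
        have h6 := hs D hD
        have h7 := Set.ncard_le_ncard (hD.subset_ground.trans h5) (Set.toFinite _)
        have := h3 e f
        omega
      · have := ih _ (by rw [delete_ground, contract_ground]; omega)
          (h.delete_contract_singleton f).1 hcirc h0 rfl
        rw [delete_ground, contract_ground] at this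
        omega

end Matroid

/-! ### Flats of the braid matroid -/

open SimpleGraph Matroid

section braid
variable {n : ℕ} {F X : Set (Sym2 (Fin n))} {a b c : Fin n}

theorem braidMatroid_ground : (braidMatroid n).E = {z | ¬ z.IsDiag} := by
  change (⊤ : SimpleGraph (Fin n)).edgeSet = _
  rw [edgeSet_top]; rfl

theorem mk_mem_braidMatroid_ground : s(a, b) ∈ (braidMatroid n).E ↔ a ≠ b := by
  rw [braidMatroid_ground]; simp

theorem braidMatroid_indep_iff : (braidMatroid n).Indep X ↔
    X ⊆ (braidMatroid n).E ∧ (fromEdgeSet X).IsAcyclic := Iff.rfl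

/-- The closure in the braid matroid is given by reachability. -/
theorem mk_mem_braidMatroid_closure (hX : X ⊆ (braidMatroid n).E) :
    s(a, b) ∈ (braidMatroid n).closure X ↔ a ≠ b ∧ (fromEdgeSet X).Reachable a b := by
  obtain ⟨I, hI⟩ := (braidMatroid n).exists_isBasis X
  have hIac := (braidMatroid_indep_iff.1 hI.indep).2
  have hIE := (braidMatroid_indep_iff.1 hI.indep).1
  have key : ∀ a b, s(a, b) ∈ (braidMatroid n).closure I ↔
      a ≠ b ∧ (fromEdgeSet I).Reachable a b := by
    intro a b
    rw [hI.indep.mem_closure_iff', mk_mem_braidMatroid_ground]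
    refine and_congr_right fun hab => ?_
    rw [braidMatroid_indep_iff, Set.insert_subset_iff, mk_mem_braidMatroid_ground]
    have e1 : fromEdgeSet (insert s(a, b) I) = fromEdgeSet I ⊔ edge a b := by
      ext x y; simp [edge_adj, fromEdgeSet_adj]; tauto
    rw [e1, isAcyclic_sup_fromEdgeSet_iff]
    simp only [hab, ne_eq, not_false_eq_true, hIE, hIac, true_and, false_or, fromEdgeSet_adj,
      and_true]
    constructor
    · intro h
      by_contra hr
      exact hr (Adj.reachable (by rw [fromEdgeSet_adj]; exact ⟨h fun h' => (hr h').elim, hab⟩))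
    · exact fun hr h => h hr
  rw [← hI.closure_eq_closure, key]
  refine and_congr_right fun hab => ⟨fun h => h.mono (fromEdgeSet_mono hI.subset), ?_⟩
  rintro ⟨w⟩
  clear hab
  induction w with
  | nil => exact Reachable.refl _
  | cons hadj _ ih =>
    refine Reachable.trans ?_ ih
    rw [fromEdgeSet_adj] at hadj
    exact ((key _ _).1 (hI.subset_closure hadj.1)).2

theorem braidMatroid_loopless : (braidMatroid n).Loopless := by
  refine ⟨Set.eq_empty_iff_forall_notMem.2 fun z hz => ?_⟩
  induction z using Sym2.ind with
  | _ a b =>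
    rw [← closure_empty, mk_mem_braidMatroid_closure (Set.empty_subset _)] at hz
    refine hz.1 ?_
    simpa using hz.2

/-- The relation on vertices given by a set of edges; it is an equivalence relation for flats. -/
def edgeRel (F : Set (Sym2 (Fin n))) (a b : Fin n) : Prop := a = b ∨ s(a, b) ∈ F

/-- Reachability stays inside the classes of an equivalence relation containing the edges. -/
theorem reachable_imp_of_equivalence {r : Fin n → Fin n → Prop} (hr : Equivalence r)
    (h : ∀ a b, s(a, b) ∈ X → r a b) (hab : (fromEdgeSet X).Reachable a b) : r a b := by
  obtain ⟨w⟩ := hab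
  induction w with
  | nil => exact hr.refl _
  | cons hadj _ ih =>
    rw [fromEdgeSet_adj] at hadj
    exact hr.trans (h _ _ hadj.1) ih

theorem edgeRel_equivalence (hF : (braidMatroid n).IsFlat F) : Equivalence (edgeRel F) := by
  have hFE := hF.subset_ground
  have key : ∀ a b, edgeRel F a b ↔ (fromEdgeSet F).Reachable a b := by
    intro a b
    by_cases hab : a = b
    · subst hab; exact iff_of_true (Or.inl rfl) (Reachable.refl _)
    · rw [edgeRel, ← hF.closure, mk_mem_braidMatroid_closure hFE]
      rw [hF.closure]
      simp [hab]
  refine ⟨fun a => Or.inl rfl, fun h => ?_, fun h h' => ?_⟩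
  · rw [key] at h ⊢; exact h.symm
  · rw [key] at h h' ⊢; exact h.trans h'

theorem braidMatroid_isFlat_of_equivalence {r : Fin n → Fin n → Prop} (hr : Equivalence r)
    (h : ∀ a b, s(a, b) ∈ F ↔ a ≠ b ∧ r a b) : (braidMatroid n).IsFlat F := by
  have hFE : F ⊆ (braidMatroid n).E := by
    intro z hz
    induction z using Sym2.ind with
    | _ a b => exact mk_mem_braidMatroid_ground.2 ((h a b).1 hz).1
  rw [isFlat_iff_closure_eq]
  refine Set.Subset.antisymm (fun z hz => ?_) ((braidMatroid n).subset_closure F hFE)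
  induction z using Sym2.ind with
  | _ a b =>
    rw [mk_mem_braidMatroid_closure hFE] at hz
    exact (h a b).2 ⟨hz.1, reachable_imp_of_equivalence hr (fun a b h' => ((h a b).1 h').2) hz.2⟩

theorem mk_mem_smul_set (g : Equiv.Perm (Fin n)) :
    s(a, b) ∈ g • F ↔ s(g.symm a, g.symm b) ∈ F := by
  rw [Set.mem_smul_set_iff_inv_smul_mem]; rfl

theorem braidMatroid_preservedBy (H : Subgroup (Equiv.Perm (Fin n))) :
    (braidMatroid n).PreservedBy H := by
  intro g _ F hF
  have hr := edgeRel_equivalence hF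
  have hFE := hF.subset_ground
  refine braidMatroid_isFlat_of_equivalence (r := fun a b => edgeRel F (g.symm a) (g.symm b))
    ⟨fun a => hr.refl _, fun h => hr.symm h, fun h h' => hr.trans h h'⟩ fun a b => ?_
  rw [mk_mem_smul_set, edgeRel, g.symm.injective.eq_iff]
  constructor
  · intro h
    have := hFE h
    rw [mk_mem_braidMatroid_ground, g.symm.injective.ne_iff] at this
    exact ⟨this, Or.inr h⟩
  · rintro ⟨h1, h2⟩
    exact h2.resolve_left h1

/-- A map `s` picking a representative in each class of the equivalence relation of a flat `F`. -/
structure IsSection (F : Set (Sym2 (Fin n))) (s : Fin n → Fin n) : Prop where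
  rel : ∀ a, edgeRel F a (s a)
  eq_iff : ∀ a b, s a = s b ↔ edgeRel F a b

theorem exists_isSection (hF : (braidMatroid n).IsFlat F) : ∃ s, IsSection F s := by
  let S : Setoid (Fin n) := ⟨edgeRel F, edgeRel_equivalence hF⟩
  have h1 : ∀ a, edgeRel F ((Quotient.mk S a).out) a := fun a => Quotient.mk_out a
  refine ⟨fun a => (Quotient.mk S a).out, fun a => S.symm (h1 a),
    fun a b => ⟨fun h => ?_, fun h => ?_⟩⟩
  · have h : (Quotient.mk S a).out = (Quotient.mk S b).out := h
    exact S.trans (S.symm (h1 a)) (h ▸ h1 b)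
  · exact congrArg _ (Quotient.sound h)

theorem IsSection.apply_apply {s : Fin n → Fin n} (hs : IsSection F s) (a : Fin n) :
    s (s a) = s a := ((hs.eq_iff _ _).2 (hs.rel a)).symm

/-- Representatives of the classes that do not contain `v`. -/
def transversal (s : Fin n → Fin n) (v : Fin n) : Set (Fin n) := Set.range s \ {s v}

theorem IsSection.apply_of_mem_transversal {s : Fin n → Fin n} (hs : IsSection F s) {v t : Fin n}
    (ht : t ∈ transversal s v) : s t = t := by
  obtain ⟨⟨a, rfl⟩, -⟩ := ht
  exact hs.apply_apply a

/-- The edges joining the class of `v` to the other classes form a base of `K_n / F`. -/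
theorem rankNat_braidMatroid_contract (hF : (braidMatroid n).IsFlat F) {s : Fin n → Fin n}
    (hs : IsSection F s) (v : Fin n) :
    (braidMatroid n ／ F).rankNat = (transversal s v).ncard := by
  set T := transversal s v with hT
  have hsT : ∀ t ∈ T, s t = t := fun t ht => hs.apply_of_mem_transversal ht
  have hTv : ∀ t ∈ T, t ≠ s v := fun t ht => ht.2
  let S : Set (Sym2 (Fin n)) := (fun t => s(s v, t)) '' T
  have hFE := hF.subset_ground
  have hSE : S ⊆ (braidMatroid n).E := by
    rintro _ ⟨t, ht, rfl⟩
    exact mk_mem_braidMatroid_ground.2 (hTv t ht).symm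
  have hSF : Disjoint S F := by
    rw [Set.disjoint_left]
    rintro _ ⟨t, ht, rfl⟩ h
    have := (hs.eq_iff _ _).2 (Or.inr h : edgeRel F (s v) t)
    rw [hs.apply_apply, hsT t ht] at this
    exact hTv t ht this.symm
  have hSE' : S ⊆ (braidMatroid n ／ F).E := fun z hz =>
    ⟨hSE hz, fun h => Set.disjoint_left.1 hSF hz h⟩
  have hUE : S ∪ F ⊆ (braidMatroid n).E := Set.union_subset hSE hFE
  have hspan : (braidMatroid n ／ F).Spanning S := by
    rw [contract_spanning_iff hFE]
    refine ⟨?_, hSF⟩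
    rw [spanning_iff_ground_subset_closure hUE]
    have h1 : ∀ a, (fromEdgeSet (S ∪ F)).Reachable a (s a) := by
      intro a
      rcases hs.rel a with h | h
      · rw [← h]
      · by_cases h' : a = s a
        · rw [← h']
        · exact Adj.reachable (by rw [fromEdgeSet_adj]; exact ⟨Or.inr h, h'⟩)
    have h2 : ∀ a, (fromEdgeSet (S ∪ F)).Reachable a (s v) := by
      intro a
      refine (h1 a).trans ?_
      by_cases h : s a = s v
      · rw [h]
      · refine Adj.reachable ?_
        rw [fromEdgeSet_adj]
        refine ⟨Or.inl ⟨s a, ⟨⟨a, rfl⟩, h⟩, Sym2.eq_swap⟩, h⟩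
    intro z hz
    induction z using Sym2.ind with
    | _ a b =>
      rw [mk_mem_braidMatroid_closure hUE]
      exact ⟨mk_mem_braidMatroid_ground.1 hz, (h2 a).trans (h2 b).symm⟩
  have hind : (braidMatroid n ／ F).Indep S := by
    rw [indep_iff_forall_notMem_closure_sdiff hSE']
    rintro _ ⟨t, ht, rfl⟩ hcl
    rw [contract_closure_eq] at hcl
    have hcl := hcl.1
    rw [mk_mem_braidMatroid_closure ((Set.union_subset_union_left _ Set.sdiff_subset).trans hUE)]
      at hcl
    -- without the edge to `t`, the class of `t` is not joined to any other class
    have := reachable_imp_of_equivalence (r := fun a b => s a = t ↔ s b = t)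
      ⟨fun _ => Iff.rfl, fun h => h.symm, fun h h' => h.trans h'⟩ ?_ hcl.2
    · rw [hs.apply_apply, hsT t ht] at this
      exact hTv t ht (this.2 rfl).symm
    · have key : ∀ u ∈ T, u ≠ t → ¬ (s u = t) ∧ ¬ (s (s v) = t) := by
        intro u hu hut
        rw [hsT u hu, hs.apply_apply]
        exact ⟨hut, (hTv t ht).symm⟩
      rintro a b (⟨⟨u, hu, e⟩, hne⟩ | h)
      · have hut : u ≠ t := by
          rintro rfl
          exact hne e.symm
        have := key u hu hut
        rcases Sym2.eq_iff.1 e with ⟨rfl, rfl⟩ | ⟨rfl, rfl⟩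
        · exact iff_of_false this.2 this.1
        · exact iff_of_false this.1 this.2
      · rw [(hs.eq_iff a b).2 (Or.inr h)]
  have hbase := hind.isBase_of_spanning hspan
  rw [rankNat, ← hbase.encard_eq_eRank]
  change S.ncard = _
  refine Set.InjOn.ncard_image fun a ha b hb h => ?_
  rcases Sym2.eq_iff.1 h with ⟨-, h⟩ | ⟨h, h'⟩
  · exact h
  · exact h'.trans h

end braid

/-! ### Matroids on the vertices, and duality relative to a flat -/

theorem Matroid.rankNat_add_rankNat_dual {α : Type} [Finite α] (M : Matroid α) :
    M.rankNat + M✶.rankNat = M.E.ncard := by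
  have h := M.eRank_add_eRank_dual
  have fin : ∀ N : Matroid α, N.eRank ≠ ⊤ := fun N => by
    rw [eRank_def]; exact ((eRk_le_encard _ _).trans_lt (Set.toFinite _).encard_lt_top).ne
  rw [rankNat, rankNat, ← ENat.toNat_add (fin _) (fin _), h, Set.ncard]

theorem Matroid.smul_closure {α : Type} (g : Equiv.Perm α) (N : Matroid α) (X : Set α) :
    (g • N).closure X = g '' N.closure (g ⁻¹' X) := by
  change (N.mapEquiv g).closure X = _
  rw [mapEquiv_eq_map, map_closure_eq]

section
variable {n : ℕ} {v : Fin n} {F : Set (Sym2 (Fin n))} {N R : Matroid (Fin n)}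
  {s : Fin n → Fin n} {a b : Fin n} {I X : Set (Fin n)}

/-- The pairs of distinct vertices with the same closure: the two vertices are parallel, or both are
loops. -/
def edgeFlat (N : Matroid (Fin n)) : Set (Sym2 (Fin n)) :=
  {z | ¬ z.IsDiag ∧ ∀ a ∈ z, ∀ b ∈ z, N.closure {a} = N.closure {b}}

theorem mk_mem_edgeFlat : s(a, b) ∈ edgeFlat N ↔ a ≠ b ∧ N.closure {a} = N.closure {b} := by
  simp only [edgeFlat, Set.mem_ofPred_eq, Sym2.mk_isDiag_iff, Sym2.mem_iff, forall_eq_or_imp,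
    forall_eq, true_and, ne_eq]
  exact and_congr_right fun _ => ⟨fun h => h.1, fun h => ⟨h, h.symm, trivial⟩⟩

theorem edgeRel_edgeFlat : edgeRel (edgeFlat N) a b ↔ N.closure {a} = N.closure {b} := by
  rw [edgeRel, mk_mem_edgeFlat]
  by_cases h : a = b
  · simp [h]
  · simp [h]

theorem edgeFlat_isFlat (N : Matroid (Fin n)) : (braidMatroid n).IsFlat (edgeFlat N) :=
  braidMatroid_isFlat_of_equivalence (r := fun a b => N.closure {a} = N.closure {b})
    ⟨fun _ => rfl, fun h => h.symm, fun h h' => h.trans h'⟩ fun _ _ => mk_mem_edgeFlat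

theorem edgeFlat_smul (g : Equiv.Perm (Fin n)) (N : Matroid (Fin n)) :
    edgeFlat (g • N) = g • edgeFlat N := by
  have h : ∀ a, g ⁻¹' {a} = {g.symm a} := fun a => by
    rw [← Equiv.image_symm_eq_preimage, Set.image_singleton]
  ext z
  induction z using Sym2.ind with
  | _ a b =>
    rw [mk_mem_smul_set, mk_mem_edgeFlat, mk_mem_edgeFlat, smul_closure, smul_closure, h, h,
      g.injective.image_injective.eq_iff, g.symm.injective.ne_iff]

/-- `N` is a matroid on all vertices, in which `v` is a loop, and the edges of `F` join vertices with
the same closure. Such matroids correspond to the matroids whose ground set is the set of classes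
of the equivalence relation of `F` that do not contain `v`. -/
structure IsPointed (v : Fin n) (F : Set (Sym2 (Fin n))) (N : Matroid (Fin n)) : Prop where
  ground : N.E = Set.univ
  isLoop : N.IsLoop v
  subset : F ⊆ edgeFlat N

theorem IsPointed.smul {g : Equiv.Perm (Fin n)} (hv : g v = v) (hF : g • F = F)
    (h : IsPointed v F N) : IsPointed v F (g • N) where
  ground := by
    change g '' N.E = _
    rw [h.ground, Set.image_univ, g.range_eq_univ]
  isLoop := by
    have : (g • N).IsLoop (g v) :=
      (map_isLoop_iff (f := g) (hf := g.injective.injOn) h.isLoop.mem_ground).2 h.isLoop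
    rwa [hv] at this
  subset := by
    rw [edgeFlat_smul, ← hF]
    exact Set.smul_set_mono h.subset

theorem IsPointed.mono {F' : Set (Sym2 (Fin n))} (h : IsPointed v F N) (hF : F' ⊆ F) :
    IsPointed v F' N := ⟨h.ground, h.isLoop, hF.trans h.subset⟩

theorem IsPointed.closure_apply (h : IsPointed v F N) (hs : IsSection F s) (a : Fin n) :
    N.closure {s a} = N.closure {a} := by
  rcases hs.rel a with h' | h'
  · rw [← h']
  · exact (mk_mem_edgeFlat.1 (h.subset h')).2.symm

theorem IsPointed.isLoop_apply (h : IsPointed v F N) (hs : IsSection F s) : N.IsLoop (s v) := by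
  have h1 := h.closure_apply hs v
  rw [h.isLoop.closure] at h1
  exact (isLoop_iff_closure_eq_loops (by rw [h.ground]; trivial)).2 h1

theorem IsPointed.isLoop_of_notMem_transversal (h : IsPointed v F N) (hs : IsSection F s)
    (ha : s a ∉ transversal s v) : N.IsLoop (s a) := by
  have : s a = s v := by
    by_contra h'
    exact ha ⟨⟨a, rfl⟩, h'⟩
  rw [this]
  exact h.isLoop_apply hs

theorem IsPointed.mem_closure_apply_iff (h : IsPointed v F N) (hs : IsSection F s) :
    s a ∈ N.closure X ↔ a ∈ N.closure X := by
  have hX : ∀ b, b ∈ N.closure X ↔ N.closure {b} ⊆ N.closure X := fun b => by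
    have hb : ({b} : Set (Fin n)) ⊆ N.E := by rw [h.ground]; exact Set.subset_univ _
    rw [closure_subset_closure_iff_subset_closure hb, Set.singleton_subset_iff]
  rw [hX, hX, h.closure_apply hs]

theorem IsPointed.closure_image (h : IsPointed v F N) (hs : IsSection F s) :
    N.closure (s '' X) = N.closure X := by
  have hE : ∀ Y : Set (Fin n), Y ⊆ N.E := fun Y => by rw [h.ground]; exact Set.subset_univ _
  refine Set.Subset.antisymm ?_ ?_
  · rw [closure_subset_closure_iff_subset_closure (hE _)]
    rintro _ ⟨a, ha, rfl⟩
    exact (h.mem_closure_apply_iff hs).2 (N.mem_closure_of_mem ha (hE _))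
  · rw [closure_subset_closure_iff_subset_closure (hE _)]
    intro a ha
    exact (h.mem_closure_apply_iff hs).1 (N.mem_closure_of_mem ⟨a, ha, rfl⟩ (hE _))

theorem IsPointed.injOn_of_indep (h : IsPointed v F N) (hs : IsSection F s) (hI : N.Indep I) :
    Set.InjOn s I := by
  intro a ha b hb hab
  by_contra hne
  refine hI.notMem_closure_sdiff_of_mem ha ?_
  rw [← h.mem_closure_apply_iff hs, hab, h.mem_closure_apply_iff hs]
  exact N.mem_closure_of_mem ⟨hb, fun h => hne h.symm⟩ (by rw [h.ground]; exact Set.subset_univ _)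

theorem IsPointed.indep_image_iff (h : IsPointed v F N) (hs : IsSection F s) (hI : Set.InjOn s I) :
    N.Indep (s '' I) ↔ N.Indep I := by
  have hE : ∀ Y : Set (Fin n), Y ⊆ N.E := fun Y => by rw [h.ground]; exact Set.subset_univ _
  rw [indep_iff_forall_notMem_closure_sdiff (hE _), indep_iff_forall_notMem_closure_sdiff (hE _)]
  rw [Set.forall_mem_image]
  refine forall₂_congr fun a ha => not_congr ?_
  have : s '' I \ {s a} = s '' (I \ {a}) := by
    rw [hI.image_sdiff_subset (Set.singleton_subset_iff.2 ha), Set.image_singleton]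
  rw [this, h.closure_image hs, h.mem_closure_apply_iff hs]

/-- The matroid on all vertices obtained from a matroid `R` on representatives of classes by making
the other elements parallel to their representatives, or loops. -/
def pullback (s : Fin n → Fin n) (R : Matroid (Fin n)) : Matroid (Fin n) :=
  (R ↾ Set.univ).comap s

theorem pullback_indep_iff : (pullback s R).Indep I ↔ R.Indep (s '' I) ∧ Set.InjOn s I := by
  simp [pullback]

/-- A pointed matroid is determined by its restriction to representatives. -/
theorem IsPointed.pullback_restrict (h : IsPointed v F N) (hs : IsSection F s) :
    pullback s (N ↾ transversal s v) = N := by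
  refine ext_indep (by rw [h.ground]; rfl) fun I _ => ?_
  rw [pullback_indep_iff, restrict_indep_iff]
  constructor
  · rintro ⟨⟨h1, -⟩, h2⟩
    exact (h.indep_image_iff hs h2).1 h1
  · intro hI
    have h2 := h.injOn_of_indep hs hI
    have h1 := (h.indep_image_iff hs h2).2 hI
    refine ⟨⟨h1, ?_⟩, h2⟩
    rintro _ ⟨a, ha, rfl⟩
    by_contra h3
    exact (h.isLoop_of_notMem_transversal hs h3).not_indep_of_mem (Set.mem_image_of_mem s ha) h1

theorem restrict_pullback (hs : IsSection F s) (hR : R.E = transversal s v) :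
    (pullback s R) ↾ transversal s v = R := by
  refine ext_indep hR.symm fun I hI => ?_
  have hI : I ⊆ transversal s v := hI
  have h1 : Set.EqOn s id I := fun a ha => hs.apply_of_mem_transversal (hI ha)
  rw [restrict_indep_iff, pullback_indep_iff, h1.image_eq, Set.image_id]
  have h2 : Set.InjOn s I := h1.injOn_iff.2 (Set.injOn_id I)
  exact ⟨fun h => h.1.1, fun h => ⟨⟨h, h2⟩, hI⟩⟩

theorem isPointed_pullback (hF : F ⊆ (braidMatroid n).E) (hs : IsSection F s)
    (hR : R.E = transversal s v) : IsPointed v F (pullback s R) where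
  ground := rfl
  isLoop := by
    rw [pullback, comap_isLoop_iff, restrict_isLoop_iff]
    exact ⟨trivial, Or.inr (by rw [hR]; exact fun h => h.2 rfl)⟩
  subset := by
    intro z hz
    induction z using Sym2.ind with
    | _ a b =>
      refine mk_mem_edgeFlat.2 ⟨mk_mem_braidMatroid_ground.1 (hF hz), ?_⟩
      rw [pullback, comap_closure_eq, comap_closure_eq, Set.image_singleton, Set.image_singleton,
        (hs.eq_iff a b).2 (Or.inr hz)]

theorem IsPointed.spanning_transversal (h : IsPointed v F N) (hs : IsSection F s) :
    N.Spanning (transversal s v) := by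
  have hE : ∀ Y : Set (Fin n), Y ⊆ N.E := fun Y => by rw [h.ground]; exact Set.subset_univ _
  rw [spanning_iff_ground_subset_closure (hE _)]
  intro a _
  rw [← h.mem_closure_apply_iff hs]
  by_cases ha : s a ∈ transversal s v
  · exact N.mem_closure_of_mem ha (hE _)
  · exact (h.isLoop_of_notMem_transversal hs ha).mem_closure _

theorem IsPointed.rankNat_restrict (h : IsPointed v F N) (hs : IsSection F s) :
    (N ↾ transversal s v).rankNat = N.rankNat := by
  rw [rankNat, rankNat, eRank_restrict, (h.spanning_transversal hs).eRk_eq]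

theorem IsPointed.rankNat_le (h : IsPointed v F N) (hs : IsSection F s) :
    N.rankNat ≤ (transversal s v).ncard := by
  rw [← h.rankNat_restrict hs]
  have := (N ↾ transversal s v).rankNat_add_rankNat_dual
  rw [restrict_ground_eq] at this
  omega

/-- All vertices outside a transversal are loops or parallel to their representatives. -/
theorem IsPointed.spReducible_restrict_iff (h : IsPointed v F N) (hs : IsSection F s) :
    (N ↾ transversal s v).SPReducible ↔ N.SPReducible := by
  have hE : ∀ Y : Set (Fin n), Y ⊆ N.E := fun Y => by rw [h.ground]; exact Set.subset_univ _
  refine ⟨fun hN => ?_, fun hN => hN.restrict (hE _)⟩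
  rw [← delete_compl (hE _)] at hN
  refine hN.of_delete (Set.toFinite _) fun a ha => ?_
  rw [or_iff_not_imp_left, not_isLoop_iff (hE Set.univ trivial)]
  intro hnl
  have h1 : s a ∈ transversal s v := by
    by_contra h1
    refine (h.isLoop_of_notMem_transversal hs h1).not_isNonloop ?_
    rw [← not_isLoop_iff (hE Set.univ trivial)] at hnl ⊢
    rwa [isLoop_iff, ← closure_empty, h.mem_closure_apply_iff hs]
  refine ⟨s a, fun h' => h'.2 h1, ?_⟩
  rw [isCircuit_pair_iff]
  · exact ⟨hnl, (h.closure_apply hs a).symm⟩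
  · exact fun h' => ha.2 (h' ▸ h1)

/-- The matroid on representatives is simple if and only if `F` contains all pairs of vertices with
the same closure. -/
theorem IsPointed.edgeFlat_eq_iff (h : IsPointed v F N) (hs : IsSection F s) :
    edgeFlat N = F ↔ ∀ C, (N ↾ transversal s v).IsCircuit C → 2 < C.ncard := by
  have hE : ∀ Y : Set (Fin n), Y ⊆ N.E := fun Y => by rw [h.ground]; exact Set.subset_univ _
  have hloop : N.closure {s v} = N.loops := (h.isLoop_apply hs).closure
  constructor
  · rintro rfl C hC
    rw [restrict_isCircuit_iff (hE _)] at hC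
    have heq : ∀ a ∈ transversal s v, ∀ b, N.closure {a} = N.closure {b} → a = s b := by
      intro a ha b hab
      rw [← hs.apply_of_mem_transversal ha]
      exact (hs.eq_iff _ _).2 (edgeRel_edgeFlat.2 hab)
    by_contra hlt
    have h0 : C.ncard ≠ 0 := by
      rw [Ne, Set.ncard_eq_zero (Set.toFinite _)]
      exact hC.1.nonempty.ne_empty
    rcases (by omega : C.ncard = 1 ∨ C.ncard = 2) with h1 | h2
    · obtain ⟨a, rfl⟩ := Set.ncard_eq_one.1 h1
      have ha := hC.2 rfl
      refine ha.2 (heq a ha v ?_)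
      rw [(singleton_isCircuit.1 hC.1).closure, h.isLoop.closure]
    · obtain ⟨a, b, hab, rfl⟩ := Set.ncard_eq_two.1 h2
      have h3 := ((isCircuit_pair_iff hab).1 hC.1).2
      refine hab ?_
      rw [heq a (hC.2 (by simp)) b h3, hs.apply_of_mem_transversal (hC.2 (by simp))]
  · intro hC
    refine Set.Subset.antisymm (fun z hz => ?_) h.subset
    induction z using Sym2.ind with
    | _ a b =>
      obtain ⟨hab, hcl⟩ := mk_mem_edgeFlat.1 hz
      by_contra hF
      have hne : s a ≠ s b := fun h' => ((hs.eq_iff a b).1 h').elim hab hF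
      rw [← h.closure_apply hs a, ← h.closure_apply hs b] at hcl
      have hl : ∀ c, s c ∈ transversal s v → ¬ N.IsLoop (s c) := by
        intro c hc hl
        have := hC {s c} (by
          rw [restrict_isCircuit_iff (hE _)]
          exact ⟨singleton_isCircuit.2 hl, Set.singleton_subset_iff.2 hc⟩)
        simp at this
      have hiff : N.IsLoop (s a) ↔ N.IsLoop (s b) := by
        rw [isLoop_iff_closure_eq_loops (hE Set.univ trivial),
          isLoop_iff_closure_eq_loops (hE Set.univ trivial), hcl]
      have hTa : s a ∈ transversal s v := by
        by_contra hTa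
        have hla := h.isLoop_of_notMem_transversal hs hTa
        refine hl b ⟨⟨b, rfl⟩, fun h' => ?_⟩ (hiff.1 hla)
        have h' : s b = s v := h'
        exact hTa ⟨⟨a, rfl⟩, fun h'' => hne (Eq.trans h'' h'.symm)⟩
      have hTb : s b ∈ transversal s v := by
        by_contra hTb
        exact hl a hTa (hiff.2 (h.isLoop_of_notMem_transversal hs hTb))
      have := hC {s a, s b} (by
        rw [restrict_isCircuit_iff (hE _), isCircuit_pair_iff hne]
        refine ⟨⟨(not_isLoop_iff (hE Set.univ trivial)).1 (hl a hTa), hcl⟩, ?_⟩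
        rintro x (rfl | rfl) <;> assumption)
      rw [Set.ncard_pair hne] at this
      omega

/-- Duality for pointed matroids: the dual matroid on the set of classes that do not contain `v`. -/
def dualAt (s : Fin n → Fin n) (v : Fin n) (N : Matroid (Fin n)) : Matroid (Fin n) :=
  pullback s (N ↾ transversal s v)✶

theorem isPointed_dualAt (hF : F ⊆ (braidMatroid n).E) (hs : IsSection F s) :
    IsPointed v F (dualAt s v N) :=
  isPointed_pullback hF hs rfl

theorem IsPointed.dualAt_dualAt (h : IsPointed v F N) (hs : IsSection F s) :
    dualAt s v (dualAt s v N) = N := by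
  rw [dualAt, dualAt, restrict_pullback hs (by rfl), dual_dual, h.pullback_restrict hs]

theorem IsPointed.rankNat_dualAt (hF : F ⊆ (braidMatroid n).E) (h : IsPointed v F N)
    (hs : IsSection F s) : N.rankNat + (dualAt s v N).rankNat = (transversal s v).ncard := by
  rw [← (isPointed_dualAt (v := v) (N := N) hF hs).rankNat_restrict hs, dualAt,
    restrict_pullback hs (by rfl), ← h.rankNat_restrict hs, rankNat_add_rankNat_dual]
  rfl

theorem IsPointed.spReducible_dualAt (hF : F ⊆ (braidMatroid n).E) (h : IsPointed v F N)
    (hs : IsSection F s) (hN : N.SPReducible) : (dualAt s v N).SPReducible := by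
  rw [← (isPointed_dualAt (v := v) (N := N) hF hs).spReducible_restrict_iff hs, dualAt,
    restrict_pullback hs (by rfl)]
  exact ((h.spReducible_restrict_iff hs).2 hN).dual

/-- A description of the dual that does not depend on the choice of representatives. -/
theorem IsPointed.dualAt_indep_iff (h : IsPointed v F N) (hs : IsSection F s) :
    (dualAt s v N).Indep I ↔ Set.InjOn s I ∧ (∀ a ∈ I, s a ≠ s v) ∧
      N.closure {x | ∀ a ∈ I, s x ≠ s a} = Set.univ := by
  have hE : ∀ Y : Set (Fin n), Y ⊆ N.E := fun Y => by rw [h.ground]; exact Set.subset_univ _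
  have hT : (∀ a ∈ I, s a ≠ s v) ↔ s '' I ⊆ transversal s v := by
    rw [Set.image_subset_iff]
    exact forall₂_congr fun a _ => ⟨fun h => ⟨⟨a, rfl⟩, h⟩, fun h => h.2⟩
  rw [dualAt, pullback_indep_iff, and_comm, hT]
  refine and_congr_right fun _ => ?_
  constructor
  · intro hI
    have hsub : s '' I ⊆ transversal s v := hI.subset_ground
    refine ⟨hsub, ?_⟩
    have h1 := Coindep.compl_spanning hI
    rw [restrict_ground_eq, restrict_spanning_iff Set.sdiff_subset (hE _)] at h1
    have h2 : transversal s v \ s '' I ⊆ {x | ∀ a ∈ I, s x ≠ s a} := by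
      rintro x ⟨hx, hxI⟩ a ha e
      rw [hs.apply_of_mem_transversal hx] at e
      exact hxI ⟨a, ha, e.symm⟩
    have h3 := h1.trans (N.closure_subset_closure h2)
    rw [← closure_subset_closure_iff_subset_closure (hE _),
      (h.spanning_transversal hs).closure_eq, h.ground] at h3
    exact Set.univ_subset_iff.1 h3
  · rintro ⟨hsub, hcl⟩
    change (N ↾ transversal s v).Coindep (s '' I)
    rw [coindep_iff_compl_spanning (by exact hsub), restrict_ground_eq,
      restrict_spanning_iff Set.sdiff_subset (hE _)]
    refine (Set.subset_univ _).trans ?_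
    rw [← hcl, closure_subset_closure_iff_subset_closure (hE _)]
    intro x hx
    rw [← h.mem_closure_apply_iff hs]
    by_cases hxT : s x ∈ transversal s v
    · refine N.mem_closure_of_mem ⟨hxT, ?_⟩ (hE _)
      rintro ⟨a, ha, e⟩
      exact hx a ha e.symm
    · exact (h.isLoop_of_notMem_transversal hs hxT).mem_closure _

/-- Duality of pointed matroids is equivariant, although permutations need not preserve the chosen
representatives. -/
theorem IsPointed.dualAt_smul (h : IsPointed v F N) (hs : IsSection F s) {g : Equiv.Perm (Fin n)}
    (hv : g v = v) (hF : g • F = F) : dualAt s v (g • N) = g • dualAt s v N := by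
  have hg : ∀ a b, s (g a) = s (g b) ↔ s a = s b := by
    intro a b
    rw [hs.eq_iff, hs.eq_iff, edgeRel, edgeRel, g.injective.eq_iff]
    conv_lhs => rw [← hF]
    rw [mk_mem_smul_set, Equiv.symm_apply_apply, Equiv.symm_apply_apply]
  have hg' : ∀ a b, s (g.symm a) = s b ↔ s a = s (g b) := by
    intro a b
    rw [← hg, Equiv.apply_symm_apply]
  refine ext_indep ?_ fun I _ => ?_
  · change Set.univ = g '' Set.univ
    rw [Set.image_univ, g.range_eq_univ]
  · rw [(h.smul hv hF).dualAt_indep_iff hs]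
    change _ ↔ ((dualAt s v N).mapEquiv g).Indep I
    rw [mapEquiv_indep_iff, h.dualAt_indep_iff hs, smul_closure]
    refine and_congr ?_ (and_congr ?_ ?_)
    · constructor
      · rintro hI _ ⟨a, ha, rfl⟩ _ ⟨b, hb, rfl⟩ e
        rw [hg', Equiv.apply_symm_apply] at e
        rw [hI ha hb e]
      · intro hI a ha b hb e
        refine g.symm.injective (hI ⟨a, ha, rfl⟩ ⟨b, hb, rfl⟩ ?_)
        rw [hg', Equiv.apply_symm_apply, e]
    · rw [Set.forall_mem_image]
      refine forall₂_congr fun a _ => not_congr ?_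
      rw [hg', hv]
    · have e1 : g ⁻¹' {x | ∀ a ∈ I, s x ≠ s a} = {x | ∀ a ∈ g.symm '' I, s x ≠ s a} := by
        ext x
        simp only [Set.mem_preimage, Set.mem_ofPred_eq, Set.forall_mem_image]
        refine forall₂_congr fun a _ => not_congr ?_
        rw [eq_comm, ← hg', eq_comm]
      rw [e1]
      constructor
      · intro h'
        rw [← g.range_eq_univ, ← Set.image_univ] at h'
        exact g.injective.image_injective h'
      · intro h'
        rw [h', Set.image_univ, g.range_eq_univ]

end

/-! ### The Kazhdan-Lusztig polynomials of contractions of the braid matroid -/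

section
variable {k : Type u} [Field k] {n : ℕ} {v : Fin n} {F : Set (Sym2 (Fin n))}
  {H : Subgroup (Equiv.Perm (Fin n))} {M : Matroid (Sym2 (Fin n))} {i : ℕ}

theorem Matroid.rankNat_smul {α : Type} (g : Equiv.Perm α) (N : Matroid α) :
    (g • N).rankNat = N.rankNat := N.rankNat_mapEquiv g

/-- The quasi series-parallel matroids on the classes of `F` not containing `v`, encoded as pointed
matroids on the vertices, of corank `i` (where `r` is the number of these classes). -/
def pointedQSP (v : Fin n) (F : Set (Sym2 (Fin n))) (r i : ℕ) : Set (Matroid (Fin n)) :=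
  {N | IsPointed v F N ∧ N.SPReducible ∧ N.rankNat + i = r}

theorem smul_mem_pointedQSP {r : ℕ} {g : Equiv.Perm (Fin n)} (hv : g v = v) (hF : g • F = F)
    {N : Matroid (Fin n)} (hN : N ∈ pointedQSP v F r i) : g • N ∈ pointedQSP v F r i :=
  ⟨hN.1.smul hv hF, hN.2.1.mapEquiv g, by rw [rankNat_smul]; exact hN.2.2⟩

variable (k v) in
/-- The candidate for the Kazhdan-Lusztig polynomials: the coefficient of `t ^ i` for the matroid
`K_n / F` is the permutation representation on the pointed quasi series-parallel matroids `N` of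
corank `i` with `edgeFlat N = F`. The flat `F` is recovered from the matroid `K_n / F`. -/
noncomputable def candidateKL : PolyFamily k (Equiv.Perm (Fin n)) (Sym2 (Fin n)) := fun H M i =>
  VRep.permOn k H {N ∈ pointedQSP v ∅ M.rankNat i | braidMatroid n ／ edgeFlat N = M}

/-- `M` is the contraction of the braid matroid by a flat that is preserved by the group `H`, which
fixes the vertex `v`. -/
def IsBraidContraction (v : Fin n) (H : Subgroup (Equiv.Perm (Fin n)))
    (M : Matroid (Sym2 (Fin n))) : Prop :=
  ∃ F, (braidMatroid n).IsFlat F ∧ (∀ g ∈ H, g v = v ∧ g • F = F) ∧ M = braidMatroid n ／ F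

theorem contract_braidMatroid_inj {F' : Set (Sym2 (Fin n))} (hF : (braidMatroid n).IsFlat F)
    (hF' : (braidMatroid n).IsFlat F') (h : braidMatroid n ／ F = braidMatroid n ／ F') : F = F' := by
  rw [contract_eq_contract_iff, Set.inter_eq_left.2 hF.subset_ground,
    Set.inter_eq_left.2 hF'.subset_ground] at h
  exact h

theorem IsBraidContraction.loopless (h : IsBraidContraction v H M) : M.Loopless := by
  obtain ⟨F, hF, -, rfl⟩ := h
  exact hF.loopless_contract

theorem IsBraidContraction.preservedBy (h : IsBraidContraction v H M) : M.PreservedBy H := by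
  obtain ⟨F, hF, hH, rfl⟩ := h
  have := (braidMatroid_preservedBy H).contract hF
  have e : flatStabilizer H F = H := inf_eq_left.2 fun g hg => (hH g hg).2
  rwa [e] at this

theorem isFlat_union_of_contract {F' : Set (Sym2 (Fin n))} (hF : (braidMatroid n).IsFlat F)
    (hF' : (braidMatroid n ／ F).IsFlat F') : (braidMatroid n).IsFlat (F ∪ F') := by
  rw [Set.union_comm]
  exact ((isFlat_contract_iff _ _ _ hF).1 hF').1

theorem IsBraidContraction.contract (h : IsBraidContraction v H M) {F' : Set (Sym2 (Fin n))}
    (hF' : M.IsFlat F') : IsBraidContraction v (flatStabilizer H F') (M ／ F') := by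
  obtain ⟨F, hF, hH, rfl⟩ := h
  refine ⟨F ∪ F', isFlat_union_of_contract hF hF', ?_, contract_contract _ _ _⟩
  rintro g ⟨hg, hg'⟩
  have hg' : g • F' = F' := hg'
  exact ⟨(hH g hg).1, by rw [Set.smul_set_union, (hH g hg).2, hg']⟩

theorem mem_candidate_iff (hF : (braidMatroid n).IsFlat F) {N : Matroid (Fin n)} {r : ℕ} :
    N ∈ {N ∈ pointedQSP v ∅ r i | braidMatroid n ／ edgeFlat N = braidMatroid n ／ F} ↔
      N ∈ pointedQSP v F r i ∧ edgeFlat N = F := by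
  constructor
  · rintro ⟨h, h'⟩
    have e := contract_braidMatroid_inj (edgeFlat_isFlat N) hF h'
    exact ⟨⟨⟨h.1.ground, h.1.isLoop, e.ge⟩, h.2⟩, e⟩
  · rintro ⟨h, h'⟩
    exact ⟨⟨h.1.mono (Set.empty_subset _), h.2⟩, by rw [h']⟩

/-- If there is only one class, the only pointed matroid is the one all of whose elements are loops. -/
theorem candidateKL_rank_zero (h : IsBraidContraction v H M) (h0 : M.rankNat = 0) (i : ℕ) :
    candidateKL k v H M i = if i = 0 then VRep.triv k H else 0 := by
  obtain ⟨F, hF, hH, rfl⟩ := h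
  obtain ⟨s, hs⟩ := exists_isSection hF
  have hr := rankNat_braidMatroid_contract hF hs v
  have hT : transversal s v = ∅ := by
    rw [← Set.ncard_eq_zero (Set.toFinite _), ← hr, h0]
  unfold candidateKL
  split_ifs with hi
  · subst hi
    rw [← VRep.permOn_singleton (k := k) H (loopyOn (Set.univ : Set (Fin n)))]
    · congr 1
      ext N
      rw [mem_candidate_iff hF, Set.mem_singleton_iff]
      constructor
      · rintro ⟨h, -⟩
        have := h.1.spanning_transversal hs
        rw [hT] at this
        have := this.closure_eq
        rw [closure_empty_eq_ground_iff, h.1.ground] at this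
        exact this
      · rintro rfl
        have hall : ∀ a, s a = s v := fun a => by
          by_contra ha
          have : s a ∈ transversal s v := ⟨⟨a, rfl⟩, ha⟩
          rw [hT] at this
          exact this
        have hflat : edgeFlat (loopyOn (Set.univ : Set (Fin n))) = F := by
          ext z
          induction z using Sym2.ind with
          | _ a b =>
            rw [mk_mem_edgeFlat, loopyOn_closure_eq, loopyOn_closure_eq]
            constructor
            · rintro ⟨hab, -⟩
              exact ((hs.eq_iff a b).1 ((hall a).trans (hall b).symm)).resolve_left hab
            · intro hz
              exact ⟨mk_mem_braidMatroid_ground.1 (hF.subset_ground hz), rfl⟩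
        refine ⟨⟨⟨rfl, by simp, hflat.ge⟩, ?_, ?_⟩, hflat⟩
        · refine SPReducible.of_delete (Set.toFinite Set.univ) (fun e _ => Or.inl (by simp)) ?_
          have : loopyOn (Set.univ : Set (Fin n)) ＼ Set.univ = emptyOn (Fin n) := by
            rw [← ground_eq_empty_iff]; simp
          rw [this]
          exact .empty
        · rw [h0, rankNat, eRank_loopyOn]
          rfl
    · intro g _
      change (loopyOn Set.univ).mapEquiv g = _
      refine ext_indep ?_ fun I _ => ?_
      · simp
      · simp
  · convert VRep.permOn_empty (k := k) (Ω := Matroid (Fin n)) H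
    rw [Set.eq_empty_iff_forall_notMem]
    intro N hN
    have := hN.1.2.2
    omega

/-- The bound on the number of elements of simple quasi series-parallel matroids bounds the degree. -/
theorem candidateKL_degree_lt (h : IsBraidContraction v H M) (h0 : 0 < M.rankNat) (i : ℕ)
    (hi : M.rankNat ≤ 2 * i) : candidateKL k v H M i = 0 := by
  obtain ⟨F, hF, hH, rfl⟩ := h
  obtain ⟨s, hs⟩ := exists_isSection hF
  have hr := rankNat_braidMatroid_contract hF hs v
  unfold candidateKL
  convert VRep.permOn_empty (k := k) (Ω := Matroid (Fin n)) H
  rw [Set.eq_empty_iff_forall_notMem]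
  intro N hN
  obtain ⟨⟨h1, h2, h3⟩, h4⟩ := (mem_candidate_iff hF).1 hN
  have h5 := ((h1.spReducible_restrict_iff hs).2 h2).ncard_lt ((h1.edgeFlat_eq_iff hs).1 h4) (by
    rw [restrict_ground_eq, ← Set.ncard_pos (Set.toFinite _), ← hr]
    exact h0)
  rw [h1.rankNat_restrict hs, restrict_ground_eq, ← hr] at h5
  omega

/-- The `Z`-polynomial of the candidate: all pointed quasi series-parallel matroids are counted,
sorted by their loops and parallel classes. -/
theorem candidateKL_zPoly (hF : (braidMatroid n).IsFlat F) (hH : ∀ g ∈ H, g v = v ∧ g • F = F)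
    (i : ℕ) : (candidateKL k v).zPoly H (braidMatroid n ／ F) i =
      VRep.permOn k H (pointedQSP v F (braidMatroid n ／ F).rankNat i) := by
  have hinv : ∀ g ∈ H, ∀ N ∈ pointedQSP v F (braidMatroid n ／ F).rankNat i,
      g • N ∈ pointedQSP v F (braidMatroid n ／ F).rankNat i :=
    fun g hg N hN => smul_mem_pointedQSP (hH g hg).1 (hH g hg).2 hN
  have huni : ∀ N ∈ pointedQSP v F (braidMatroid n ／ F).rankNat i,
      edgeFlat N \ F ∪ F = edgeFlat N := fun N hN =>
    Set.sdiff_union_of_subset hN.1.subset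
  rw [VRep.permOn_eq_finsum_flatOrbit (M := braidMatroid n ／ F) hinv (fun N => edgeFlat N \ F)
    (fun N hN => (isFlat_contract_iff _ _ _ hF).2
      ⟨by rw [huni N hN]; exact edgeFlat_isFlat N, Set.disjoint_sdiff_left⟩)
    (fun g hg N _ => by rw [edgeFlat_smul, Set.smul_set_sdiff, (hH g hg).2])]
  refine finsum_congr fun q => ?_
  obtain ⟨hqF, hqd⟩ := (isFlat_contract_iff _ _ _ hF).1 q.isFlat
  have hadd := rkNat_add_rankNat_contract _ _ q.isFlat.subset_ground
  have hflat : ∀ N, edgeFlat N = F ∪ q.flat → edgeFlat N \ F = q.flat := by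
    rintro N h
    rw [h, Set.union_sdiff_left, hqd.sdiff_eq_left]
  rw [Set.union_comm] at hqF
  -- in particular no `N` contributes to a flat whose rank exceeds `i`
  have hle : ∀ N ∈ pointedQSP v F (braidMatroid n ／ F).rankNat i, edgeFlat N \ F = q.flat →
      edgeFlat N = F ∪ q.flat ∧ N.rankNat ≤ (braidMatroid n ／ F ／ q.flat).rankNat := by
    intro N hN hNq
    have e : edgeFlat N = F ∪ q.flat := by rw [← huni N hN, hNq, Set.union_comm]
    obtain ⟨s, hs⟩ := exists_isSection hqF
    refine ⟨e, ?_⟩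
    rw [contract_contract, rankNat_braidMatroid_contract hqF hs v]
    exact IsPointed.rankNat_le ⟨hN.1.ground, hN.1.isLoop, e.ge⟩ hs
  unfold PolyFamily.flatTerm
  split_ifs with hi
  · congr 1
    unfold candidateKL
    congr 1
    ext N
    constructor
    · intro hN
      rw [contract_contract, mem_candidate_iff hqF] at hN
      obtain ⟨⟨h1, h2, h3⟩, h4⟩ := hN
      refine ⟨⟨h1.mono Set.subset_union_left, h2, ?_⟩, hflat N h4⟩
      rw [← contract_contract] at h3
      omega
    · rintro ⟨hN, hNq⟩
      obtain ⟨e, h1⟩ := hle N hN hNq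
      rw [contract_contract, mem_candidate_iff hqF, ← contract_contract]
      refine ⟨⟨⟨hN.1.ground, hN.1.isLoop, e.ge⟩, hN.2.1, ?_⟩, e⟩
      have := hN.2.2
      omega
  · have : {N ∈ pointedQSP v F (braidMatroid n ／ F).rankNat i | edgeFlat N \ F = q.flat} = ∅ := by
      rw [Set.eq_empty_iff_forall_notMem]
      rintro N ⟨hN, hNq⟩
      have := (hle N hN hNq).2
      have := hN.2.2
      omega
    rw [this, VRep.permOn_empty, map_zero]

/-- Matroid duality makes the `Z`-polynomials of the candidate palindromic. -/
theorem candidateKL_palindromic (h : IsBraidContraction v H M) (i j : ℕ)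
    (hij : i + j = M.rankNat) :
    (candidateKL k v).zPoly H M i = (candidateKL k v).zPoly H M j := by
  obtain ⟨F, hF, hH, rfl⟩ := h
  obtain ⟨s, hs⟩ := exists_isSection hF
  have hr := rankNat_braidMatroid_contract hF hs v
  have hFE := hF.subset_ground
  rw [candidateKL_zPoly hF hH, candidateKL_zPoly hF hH]
  have hmaps : ∀ i j, i + j = (braidMatroid n ／ F).rankNat → Set.MapsTo (dualAt s v)
      (pointedQSP v F (braidMatroid n ／ F).rankNat i)
      (pointedQSP v F (braidMatroid n ／ F).rankNat j) := by
    intro i j hij N hN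
    refine ⟨isPointed_dualAt hFE hs, hN.1.spReducible_dualAt hFE hs hN.2.1, ?_⟩
    have h1 := hN.1.rankNat_dualAt hFE hs
    have h2 := hN.2.2
    omega
  refine VRep.permOn_congr
    (fun g hg N hN => smul_mem_pointedQSP (hH g hg).1 (hH g hg).2 hN)
    (fun g hg N hN => smul_mem_pointedQSP (hH g hg).1 (hH g hg).2 hN) (dualAt s v)
    ⟨hmaps i j hij, ?_, ?_⟩ fun g hg N hN => hN.1.dualAt_smul hs (hH g hg).1 (hH g hg).2
  · intro N hN N' hN' e
    rw [← hN.1.dualAt_dualAt hs, e, hN'.1.dualAt_dualAt hs]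
  · intro N hN
    exact ⟨_, hmaps j i (by omega) hN, hN.1.dualAt_dualAt hs⟩

theorem equivariantKL_eq_candidateKL (h : IsBraidContraction v H M) (i : ℕ) :
    equivariantKL k H M i = candidateKL k v H M i :=
  equivariantKL_isKL.eq_of_forall_mem (IsBraidContraction v) (fun _ _ h => h.loopless)
    (fun _ _ h => h.preservedBy) (fun _ _ h _ hF => h.contract hF)
    (fun _ _ h h0 i => candidateKL_rank_zero h h0 i)
    (fun _ _ h h0 i hi => candidateKL_degree_lt h h0 i hi)
    (fun _ _ h i j hij => candidateKL_palindromic h i j hij) H M h i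

theorem equivariantZ_eq_candidateKL_zPoly (h : IsBraidContraction v H M) (i : ℕ) :
    equivariantZ k H M i = (candidateKL k v).zPoly H M i :=
  PolyFamily.zPoly_congr _ _ _ _ (fun _ hF i => equivariantKL_eq_candidateKL (h.contract hF) i) i

end

/-! ### Comparison with matroids on the remaining vertices -/

theorem Matroid.isSimple_iff {α : Type} [Finite α] {M : Matroid α} :
    M.IsSimple ↔ ∀ C, M.IsCircuit C → 2 < C.ncard := by
  constructor
  · rintro ⟨h1, h2⟩ C hC
    have h3 := h2 C hC
    have h4 := loopless_iff_forall_isCircuit.1 h1 C hC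
    rw [← Set.one_lt_ncard_iff_nontrivial] at h4
    omega
  · intro h
    refine ⟨loopless_iff_forall_isCircuit.2 fun C hC => ?_, fun C hC => (h C hC).ne'⟩
    rw [← Set.one_lt_ncard_iff_nontrivial]
    exact (h C hC).trans' one_lt_two

section transport
variable {α β : Type} {g : α → β} {N : Matroid α}

theorem Matroid.map_isCircuit_image_iff (hg : g.Injective) {C : Set α} :
    (N.map g hg.injOn).IsCircuit (g '' C) ↔ N.IsCircuit C := by
  refine ⟨fun h => ?_, fun h => h.map _⟩
  rw [isCircuit_iff_forall_ssubset]
  constructor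
  · obtain ⟨D, hD, e⟩ := map_dep_iff.1 h.dep
    rwa [hg.image_injective e]
  · intro I hI
    have := h.ssubset_indep (((hg.injOn (s := Set.univ)).image_ssubset_image_iff
      (Set.subset_univ _) (Set.subset_univ _)).2 hI)
    obtain ⟨J, hJ, e⟩ := map_indep_iff.1 this
    rwa [hg.image_injective e]

theorem Matroid.forall_isCircuit_map_iff (hg : g.Injective) :
    (∀ C, (N.map g hg.injOn).IsCircuit C → 2 < C.ncard) ↔
      ∀ C, N.IsCircuit C → 2 < C.ncard := by
  constructor
  · intro h C hC
    have := h _ (hC.map hg.injOn)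
    rwa [Set.ncard_image_of_injective _ hg] at this
  · intro h C hC
    have hCE := hC.subset_ground
    rw [map_ground, Set.subset_image_iff] at hCE
    obtain ⟨D, -, rfl⟩ := hCE
    rw [Set.ncard_image_of_injective _ hg]
    exact h D ((map_isCircuit_image_iff hg).1 hC)

theorem Matroid.spReducible_map_iff (hg : g.Injective) :
    (N.map g hg.injOn).SPReducible ↔ N.SPReducible := by
  refine ⟨fun h => ?_, fun h => h.map _⟩
  rcases isEmpty_or_nonempty α with hα | hα
  · have : N = emptyOn α := by
      rw [← ground_eq_empty_iff]; exact Set.eq_empty_of_isEmpty _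
    rw [this]
    exact .empty
  have hinv := Function.leftInverse_invFun hg
  have := h.map (g := Function.invFun g) (by
    rw [map_ground]
    rintro _ ⟨a, -, rfl⟩ _ ⟨b, -, rfl⟩ e
    rw [hinv, hinv] at e
    rw [e])
  convert this
  refine ext_indep ?_ fun I _ => ?_
  · simp [Set.image_image, hinv _]
  · simp only [map_indep_iff]
    constructor
    · intro hI
      exact ⟨_, ⟨I, hI, rfl⟩, by simp [Set.image_image, hinv _]⟩
    · rintro ⟨_, ⟨J, hJ, rfl⟩, rfl⟩
      simpa [Set.image_image, hinv _] using hJ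

end transport

theorem VRep.perm_eq_permOn {k : Type u} [Field k] {G G' Ω Ω' : Type} [Group G] [Group G']
    [MulAction G Ω] [Finite Ω] [MulAction G' Ω'] [Finite Ω'] {K : Subgroup G} (φ : K →* G')
    (S : SubMulAction G' Ω') {X : Set Ω} (hX : ∀ g ∈ K, ∀ x ∈ X, g • x ∈ X) (f : Ω' → Ω)
    (hf : Set.BijOn f S X) (heq : ∀ g x, f (φ g • x) = g.1 • f x) :
    perm k φ S = permOn k K X := by
  let e : S ≃ invariantCore K X :=
    Equiv.ofBijective (fun x => ⟨f x.1, (mem_invariantCore hX).2 (hf.mapsTo x.2)⟩) <| by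
      refine ⟨fun x y h => ?_, fun y => ?_⟩
      · exact Subtype.ext (hf.injOn x.2 y.2 (congrArg Subtype.val h))
      · obtain ⟨x, hx, e⟩ := hf.surjOn ((mem_invariantCore hX).1 y.2)
        exact ⟨⟨x, hx⟩, Subtype.ext e⟩
  exact perm_congr e fun g x => Subtype.ext (heq g x.1)

section
variable {n m : ℕ} {v : Fin n} {ι : Fin m → Fin n}

theorem isSection_id : IsSection (∅ : Set (Sym2 (Fin n))) id :=
  ⟨fun _ => Or.inl rfl, fun a b => by simp [edgeRel]⟩

/-- A matroid on the vertices other than `v`, numbered by the injection `ι` with range `{v}ᶜ`, extended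
by the loop `v`. -/
def addLoop (ι : Fin m → Fin n) (hι : ι.Injective) (N : Matroid (Fin m)) : Matroid (Fin n) :=
  pullback id (N.map ι hι.injOn)

theorem addLoop_indep_iff (hι : ι.Injective) {N : Matroid (Fin m)} {I : Set (Fin n)} :
    (addLoop ι hι N).Indep I ↔ ∃ J, N.Indep J ∧ I = ι '' J := by
  simp [addLoop, pullback_indep_iff, Set.injOn_id]

theorem transversal_id (hv : Set.range ι = {v}ᶜ) : transversal id v = ι '' Set.univ := by
  rw [Set.image_univ, hv, transversal, Set.range_id, Set.compl_eq_univ_sdiff]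
  rfl

theorem addLoop_mem_pointedQSP_iff (hι : ι.Injective) (hv : Set.range ι = {v}ᶜ)
    {N : Matroid (Fin m)} (hE : N.E = Set.univ) {r i : ℕ} :
    addLoop ι hι N ∈ pointedQSP v ∅ r i ↔ N.IsQuasiSeriesParallel ∧ N.rankNat + i = r := by
  have hE' : (N.map ι hι.injOn).E = transversal id v := by
    rw [map_ground, hE, transversal_id hv]
  have hp := isPointed_pullback (Set.empty_subset _) isSection_id hE'
  have hres := restrict_pullback isSection_id hE'
  have hsp := hp.spReducible_restrict_iff isSection_id
  have hrk := hp.rankNat_restrict isSection_id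
  rw [hres] at hsp hrk
  have hrk' : (N.map ι hι.injOn).rankNat = N.rankNat := by rw [rankNat, rankNat, eRank_map]
  rw [isQuasiSeriesParallel_iff, ← spReducible_map_iff hι, hsp, ← hrk', hrk]
  exact ⟨fun h => h.2, fun h => ⟨hp, h⟩⟩

/-- The flat of a matroid on the vertices other than `v` is trivial if and only if there are neither
loops, which would be joined to `v`, nor parallel elements. -/
theorem edgeFlat_addLoop_iff (hι : ι.Injective) (hv : Set.range ι = {v}ᶜ)
    {N : Matroid (Fin m)} (hE : N.E = Set.univ) :
    edgeFlat (addLoop ι hι N) = ∅ ↔ N.IsSimple := by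
  have hE' : (N.map ι hι.injOn).E = transversal id v := by
    rw [map_ground, hE, transversal_id hv]
  have hp := isPointed_pullback (Set.empty_subset _) isSection_id hE'
  have := hp.edgeFlat_eq_iff isSection_id
  rw [restrict_pullback isSection_id hE', forall_isCircuit_map_iff hι, ← isSimple_iff] at this
  exact this

theorem exists_addLoop_eq (hι : ι.Injective) (hv : Set.range ι = {v}ᶜ) {N : Matroid (Fin n)}
    (hN : IsPointed v ∅ N) : ∃ N' : Matroid (Fin m), N'.E = Set.univ ∧ addLoop ι hι N' = N := by
  refine ⟨(N ↾ transversal id v).comap ι, ?_, ?_⟩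
  · rw [comap_ground_eq, restrict_ground_eq, transversal_id hv, Set.preimage_image_eq _ hι]
  · have hrange : (N ↾ transversal id v).E ⊆ Set.range ι := by
      rw [restrict_ground_eq, transversal_id hv, Set.image_univ]
    exact (congrArg (pullback id) (map_comap hrange hι.injOn)).trans
      (hN.pullback_restrict isSection_id)

theorem addLoop_injective (hι : ι.Injective) {N N' : Matroid (Fin m)} (hE : N.E = N'.E)
    (h : addLoop ι hι N = addLoop ι hι N') : N = N' := by
  refine ext_indep hE fun I _ => ?_
  have h1 : ∀ N : Matroid (Fin m), N.Indep I ↔ (addLoop ι hι N).Indep (ι '' I) := by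
    intro N
    rw [addLoop_indep_iff]
    exact ⟨fun h => ⟨I, h, rfl⟩, fun ⟨J, hJ, e⟩ => by rwa [hι.image_injective e]⟩
  rw [h1, h, ← h1]

theorem addLoop_smul (hι : ι.Injective) (N : Matroid (Fin m)) (σ : Equiv.Perm (Fin m))
    (g : Equiv.Perm (Fin n)) (h : ∀ x, ι (σ x) = g (ι x)) :
    addLoop ι hι (σ • N) = g • addLoop ι hι N := by
  have h2 : ∀ x, ι (σ.symm x) = g.symm (ι x) := fun x => by
    rw [Equiv.eq_symm_apply, ← h, Equiv.apply_symm_apply]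
  refine ext_indep ?_ fun I _ => ?_
  · change Set.univ = g '' Set.univ
    rw [Set.image_univ, g.range_eq_univ]
  · change _ ↔ ((addLoop ι hι N).mapEquiv g).Indep I
    rw [mapEquiv_indep_iff, addLoop_indep_iff, addLoop_indep_iff]
    change (∃ J, (N.mapEquiv σ).Indep J ∧ I = ι '' J) ↔ _
    constructor
    · rintro ⟨J, hJ, rfl⟩
      refine ⟨_, mapEquiv_indep_iff.1 hJ, ?_⟩
      simp [Set.image_image, h2]
    · rintro ⟨J, hJ, e⟩
      refine ⟨σ '' J, mapEquiv_indep_iff.2 (by simpa [Set.image_image] using hJ), ?_⟩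
      rw [Set.image_image]
      simp only [h]
      rw [← Set.image_image (g := g) (f := ι), ← e]
      simp [Set.image_image]

end

theorem theorem1p2 (k : Type u) [Field k] [CharZero k] (n : ℕ) (v : Fin n)
    (e : {x : Fin n // x ≠ v} ≃ Fin (n - 1)) (i : ℕ) :
    equivariantKL k (MulAction.stabilizer (Equiv.Perm (Fin n)) v) (braidMatroid n) i =
        VRep.perm k (stabilizerMulEquivPerm v e).toMonoidHom
          (simpleQuasiSeriesParallelOn (n - 1) ((n : ℤ) - 1 - i)) ∧
      equivariantZ k (MulAction.stabilizer (Equiv.Perm (Fin n)) v) (braidMatroid n) i =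
        VRep.perm k (stabilizerMulEquivPerm v e).toMonoidHom
          (quasiSeriesParallelOn (n - 1) ((n : ℤ) - 1 - i)) := by
  have hn : 0 < n := v.pos
  let ι : Fin (n - 1) → Fin n := fun x => (e.symm x).1
  have hι : ι.Injective := Subtype.val_injective.comp e.symm.injective
  have hv : Set.range ι = {v}ᶜ := by
    ext x
    constructor
    · rintro ⟨y, rfl⟩
      exact (e.symm y).2
    · intro hx
      exact ⟨e ⟨x, hx⟩, by simp [ι]⟩
  have hF : (braidMatroid n).IsFlat ∅ := isFlat_empty braidMatroid_loopless
  have hH : ∀ g ∈ MulAction.stabilizer (Equiv.Perm (Fin n)) v,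
      g v = v ∧ g • (∅ : Set (Sym2 (Fin n))) = ∅ := fun g hg => ⟨hg, Set.smul_set_empty⟩
  have hK : braidMatroid n = braidMatroid n ／ ∅ := (contract_empty _).symm
  have hr : (braidMatroid n).rankNat = n - 1 := by
    have := rankNat_braidMatroid_contract hF isSection_id v
    rw [contract_empty, transversal_id hv, Set.ncard_image_of_injective _ hι, Set.ncard_univ] at this
    simpa using this
  have hC : IsBraidContraction v (MulAction.stabilizer (Equiv.Perm (Fin n)) v) (braidMatroid n) :=
    ⟨∅, hF, hH, hK⟩
  have heq : ∀ (g : MulAction.stabilizer (Equiv.Perm (Fin n)) v) (N : Matroid (Fin (n - 1))),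
      addLoop ι hι ((stabilizerMulEquivPerm v e).toMonoidHom g • N) = g.1 • addLoop ι hι N := by
    intro g N
    refine addLoop_smul hι N _ _ fun x => ?_
    have := stabilizerMulEquivPerm_apply v e g (e.symm x)
    rw [Equiv.apply_symm_apply] at this
    exact this
  -- as `0 < n`, no subtraction is truncated; for `n - 1 < i` no `N` satisfies either side
  have hrank : ∀ N : Matroid (Fin (n - 1)),
      N.rankNat + i = n - 1 ↔ (N.rankNat : ℤ) = (n : ℤ) - 1 - i := by
    intro N; omega
  have hinv : ∀ g ∈ MulAction.stabilizer (Equiv.Perm (Fin n)) v, ∀ N ∈ pointedQSP v ∅ (n - 1) i,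
      g • N ∈ pointedQSP v ∅ (n - 1) i :=
    fun g hg N hN => smul_mem_pointedQSP (hH g hg).1 (hH g hg).2 hN
  constructor
  · rw [equivariantKL_eq_candidateKL hC, candidateKL, hr]
    have hset : {N ∈ pointedQSP v ∅ (n - 1) i | braidMatroid n ／ edgeFlat N = braidMatroid n} =
        {N ∈ pointedQSP v ∅ (n - 1) i | edgeFlat N = ∅} := by
      ext N
      have := mem_candidate_iff (v := v) (i := i) (r := n - 1) (N := N) hF
      rwa [contract_empty] at this
    rw [hset]
    refine (VRep.perm_eq_permOn _ _ ?_ (addLoop ι hι) ⟨?_, ?_, ?_⟩ heq).symm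
    · intro g hg N hN
      exact ⟨hinv g hg N hN.1, by rw [edgeFlat_smul, hN.2, Set.smul_set_empty]⟩
    · rintro N ⟨⟨hE, h1, h2⟩, h3⟩
      exact ⟨(addLoop_mem_pointedQSP_iff hι hv hE).2 ⟨h1, (hrank N).2 h2⟩,
        (edgeFlat_addLoop_iff hι hv hE).2 h3⟩
    · rintro N hN N' hN' h
      exact addLoop_injective hι (hN.1.1.trans hN'.1.1.symm) h
    · rintro N ⟨hN, hN'⟩
      obtain ⟨N, hE, rfl⟩ := exists_addLoop_eq hι hv hN.1
      obtain ⟨h1, h2⟩ := (addLoop_mem_pointedQSP_iff hι hv hE).1 hN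
      exact ⟨N, ⟨⟨hE, h1, (hrank N).1 h2⟩, (edgeFlat_addLoop_iff hι hv hE).1 hN'⟩, rfl⟩
  · rw [equivariantZ_eq_candidateKL_zPoly hC]
    conv_lhs => rw [hK]
    rw [candidateKL_zPoly hF hH, contract_empty, hr]
    refine (VRep.perm_eq_permOn _ _ hinv (addLoop ι hι) ⟨?_, ?_, ?_⟩ heq).symm
    · rintro N ⟨hE, h1, h2⟩
      exact (addLoop_mem_pointedQSP_iff hι hv hE).2 ⟨h1, (hrank N).2 h2⟩
    · rintro N hN N' hN' h
      exact addLoop_injective hι (hN.1.trans hN'.1.symm) h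
    · rintro N hN
      obtain ⟨N, hE, rfl⟩ := exists_addLoop_eq hι hv hN.1
      obtain ⟨h1, h2⟩ := (addLoop_mem_pointedQSP_iff hι hv hE).1 hN
      exact ⟨N, ⟨hE, h1, (hrank N).1 h2⟩, rfl⟩
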